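/- **Setting.** Let $g:\mathbb R\to\mathbb R$ be $1$-Lipschitz and non-decreasing, $d\ge 1$, $\Delta>0$, $\alpha\in(0,1]$, $R>0$, $\sigma\ge 0$, $\delta\in(0,1)$. An *instance* consists of a probability distribution $D$ on $\mathbb R^d$ supported in the unit ball, a probability distribution of $\xi$ on $\mathbb R$ with $\Pr[\xi=0]\ge\alpha$, and a vector $w^*\in\mathbb R^d$ with $\|w^*\|_2\le R$. An *example* of the instance is $(x,y)$ with $y=g(w^*\cdot x)+\xi+\epsilon$, where $x\sim D$, $\xi$ and $\epsilon\sim\mathcal N(0,\sigma^2)$ are independent. The *excess loss* of $w$ is $\mathbb E_{x\sim D}|g(w\cdot x)-g(w^*\cdot x)|$. The instance is *$(\Delta,\tau)$-identifiable* if all $u,v\in\mathbb R^d$ with $\mathbb E_x|g(u\cdot x)-g(v\cdot x)|>\Delta$ satisfy $\Pr_x[|g(u\cdot x)-g(v\cdot x)-A|>\tau]>\tau$ for every $A\in\mathbb R$. An *algorithm* is a single program, independent of all parameters, for a real random access machine (unit-cost arithmetic, square roots and comparisons of real numbers, integer arithmetic, indexed memory, one step per evaluation of $g$, and $d+1$ steps,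 besides those for computing the address, to draw a fresh independent example); it is given $d$ and the listed real parameters. For a constant $C>0$ put $$\gamma(\Delta)=\min\Big(\frac{\Delta}{4\sigma},\frac12\Big)\ \Big(=\tfrac12\text{ if }\sigma=0\Big),\qquad T(\Delta)=\Big\lceil C\Big(\frac{R}{\gamma(\Delta)\,\alpha\,\Delta}\Big)^2\Big\rceil,\qquad W(\Delta)=T(\Delta)\Big\lceil\frac{64R}{\gamma(\Delta)\,\alpha\,\Delta}\Big\rceil .$$ **Theorem.** (1) There are an algorithm and an absolute constant $C>0$ such that, for all parameters and all $g$ as above, on input $(\Delta,\alpha,R,\sigma,\delta)$ the algorithm always draws at most $$m_1=\Big\lceil C\,\alpha^{-2}\log\Big(2+\frac{R}{\Delta\alpha\delta}\Big)\frac{R^2}{(\gamma(\Delta)\,\Delta)^2}\Big\rceil$$ examples, halts within $C\,d\,T(\Delta)\,m_1$ steps, and returns a list of at most $W(\Delta)$ vectors; and, for every instance, with probability at least $1-\delta$ over the examples, some vector of the list has excess loss at most $\Delta$. (2) There are an algorithm and an absolute constant $C>0$ such that, for all parameters and all $g$ as above and all $\tau'>0$, with $\Delta'=\min(\Delta,\tau'^2/16)$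 and $W=W(\Delta')$, on input $(\Delta,\alpha,R,\sigma,\delta,\tau')$ the algorithm always draws at most $$m=\Big\lceil C\,\alpha^{-2}\log\Big(\frac W\delta\Big)\Big(\frac{R^2}{(\gamma(\Delta')\,\Delta')^2}+\frac{1}{(\tau'\min(\tau'/\sigma,1))^2}\Big)\Big\rceil$$ examples (where $\min(\tau'/\sigma,1)=1$ if $\sigma=0$), halts within $C\,d\,m\,W^2$ steps, and returns a single vector; and, for every instance that is $(\Delta,\tau)$-identifiable for some $\tau\ge\tau'$, with probability at least $1-\delta$ over the examples, this vector has excess loss at most $4\Delta$. -/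

import Mathlib

open MeasureTheory ProbabilityTheory

noncomputable section

namespace ObliviousGLM

/-! ### The regression model -/

/-- The feature space `ℝ^d` with the Euclidean norm. -/
abbrev Vec (d : ℕ) : Type := EuclideanSpace ℝ (Fin d)

/-- A labelled example `(x, y)`. -/
abbrev Sample (d : ℕ) : Type := Vec d × ℝ

/-- The excess loss `E_x |g (w ⬝ x) - g (v ⬝ x)|` of `w` with respect to `v`, where `x ∼ D`. -/
def excessLoss {d : ℕ} (D : Measure (Vec d)) (g : ℝ → ℝ) (w v : Vec d) : ℝ :=
  ∫ x, |g (inner ℝ w x) - g (inner ℝ v x)| ∂D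

/-- `(Δ, τ)`-identifiability: any two `Δ`-separated vectors `u`, `v` satisfy
`Pr_x [|g (u ⬝ x) - g (v ⬝ x) - A| > τ] > τ` for every real `A`. -/
def Identifiable {d : ℕ} (D : Measure (Vec d)) (g : ℝ → ℝ) (Δ τ : ℝ) : Prop :=
  ∀ u v : Vec d, Δ < excessLoss D g u v →
    ∀ A : ℝ, τ < D.real {x | τ < |g (inner ℝ u x) - g (inner ℝ v x) - A|}

/-- The law of one example `(x, g (w ⬝ x) + ξ + ε)`, where `x ∼ D`, `ξ ∼ ν` and `ε ∼ N(0, σ²)`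
are independent. -/
def glmLaw {d : ℕ} (D : Measure (Vec d)) (ν : Measure ℝ) (g : ℝ → ℝ) (σ : ℝ) (w : Vec d) :
    Measure (Sample d) :=
  (D.prod (ν.prod (gaussianReal 0 (σ ^ 2).toNNReal))).map
    fun p => (p.1, g (inner ℝ w p.1) + p.2.1 + p.2.2)

/-- The law of an infinite sequence of independent examples. -/
def streamLaw {d : ℕ} (D : Measure (Vec d)) (ν : Measure ℝ) (g : ℝ → ℝ) (σ : ℝ) (w : Vec d) :
    Measure (ℕ → Sample d) :=
  Measure.infinitePi fun _ => glmLaw D ν g σ w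

/-- The features are almost surely in the unit ball, the oblivious noise vanishes with
probability at least `α`, and the target vector has norm at most `R`. -/
structure IsInstance {d : ℕ} (α R : ℝ) (D : Measure (Vec d)) (ν : Measure ℝ) (w : Vec d) :
    Prop where
  prob_features : IsProbabilityMeasure D
  prob_noise : IsProbabilityMeasure ν
  features_le : ∀ᵐ x ∂D, ‖x‖ ≤ 1
  noise_zero : α ≤ ν.real {0}
  target_le : ‖w‖ ≤ R

/-! ### The parameters -/

/-- `γ = min (Δ / 4σ) (1/2)`, which is `1/2` if `σ = 0`. -/
def gam (Δ σ : ℝ) : ℝ := if σ = 0 then 1 / 2 else min (Δ / (4 * σ)) (1 / 2)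

/-- `min (τ / σ) 1`, which is `1` if `σ = 0`. -/
def ratio (τ σ : ℝ) : ℝ := if σ = 0 then 1 else min (τ / σ) 1

/-- `T = ⌈C (R / (γ α Δ))²⌉`. -/
def numSteps (C Δ α R σ : ℝ) : ℕ := ⌈C * (R / (gam Δ σ * α * Δ)) ^ 2⌉₊

/-- The size `T ⌈64 R / (γ α Δ)⌉` of the list of candidates. -/
def listSize (C Δ α R σ : ℝ) : ℕ := numSteps C Δ α R σ * ⌈64 * R / (gam Δ σ * α * Δ)⌉₊

/-- The sample size `⌈C α⁻² log (2 + R / (Δ α δ)) R² / (γ Δ)²⌉`. -/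
def listSamples (C Δ α R σ δ : ℝ) : ℕ :=
  ⌈C * (α⁻¹ ^ 2 * Real.log (2 + R / (Δ * α * δ)) * (R ^ 2 / (gam Δ σ * Δ) ^ 2))⌉₊

/-- `Δ' = min Δ (τ² / 16)`. -/
def fineAcc (Δ τ : ℝ) : ℝ := min Δ (τ ^ 2 / 16)

/-- The sample size `⌈C α⁻² log (W / δ) (R² / (γ' Δ')² + 1 / (τ min (τ / σ) 1)²)⌉`, where `Δ'` is
as above, and `γ'` and `W` are the quantities `gam` and `listSize` at accuracy `Δ'`. -/
def singleSamples (C Δ α R σ δ τ : ℝ) : ℕ :=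
  ⌈C * (α⁻¹ ^ 2 * Real.log (listSize C (fineAcc Δ τ) α R σ / δ) *
    (R ^ 2 / (gam (fineAcc Δ τ) σ * fineAcc Δ τ) ^ 2 + 1 / (τ * ratio τ σ) ^ 2))⌉₊

/-! ### Algorithms: a real random access machine

A program has finitely many integer variables, real variables and real arrays. It can draw fresh
examples, evaluate the activation function `g`, do the operations of arithmetic and extract square
roots. It contains no real constants, and reals influence the control flow only through
comparisons. Every operation costs one step, and drawing an example costs `d + 1` steps. -/

/-- Integer expressions (subtraction is truncated). -/
inductive NExp : Type
  | const (n : ℕ)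
  | var (i : ℕ)
  | add (a b : NExp)
  | sub (a b : NExp)
  | mul (a b : NExp)

/-- Real expressions; `arr a e` is entry `e` of array `a`, and `act` is the activation. -/
inductive RExp : Type
  | cast (e : NExp)
  | var (i : ℕ)
  | arr (a : ℕ) (e : NExp)
  | add (a b : RExp)
  | sub (a b : RExp)
  | mul (a b : RExp)
  | div (a b : RExp)
  | sqrt (a : RExp)
  | act (a : RExp)

/-- Tests. -/
inductive BExp : Type
  | nlt (a b : NExp)
  | rlt (a b : RExp)
  | not (a : BExp)
  | and (a b : BExp)

/-- Programs. `draw a e` writes the next example `(x, y)` into entries `e, …, e + d` of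
array `a`. -/
inductive Prog : Type
  | skip
  | nset (i : ℕ) (e : NExp)
  | rset (i : ℕ) (e : RExp)
  | store (a : ℕ) (k : NExp) (e : RExp)
  | draw (a : ℕ) (k : NExp)
  | seq (p q : Prog)
  | ite (b : BExp) (p q : Prog)
  | while (b : BExp) (p : Prog)

/-- A memory state, with the number of examples drawn so far. -/
@[ext] structure State : Type where
  nvar : ℕ → ℕ
  rvar : ℕ → ℝ
  arr : ℕ → ℕ → ℝ
  drawn : ℕ

/-- The value of an integer expression. -/
def NExp.eval (s : State) : NExp → ℕ
  | .const n => n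
  | .var i => s.nvar i
  | .add a b => a.eval s + b.eval s
  | .sub a b => a.eval s - b.eval s
  | .mul a b => a.eval s * b.eval s

/-- The number of operations in an integer expression. -/
def NExp.cost : NExp → ℕ
  | .const _ => 1
  | .var _ => 1
  | .add a b => a.cost + b.cost + 1
  | .sub a b => a.cost + b.cost + 1
  | .mul a b => a.cost + b.cost + 1

/-- The value of a real expression, given the activation `g`. -/
def RExp.eval (g : ℝ → ℝ) (s : State) : RExp → ℝ
  | .cast e => (e.eval s : ℝ)
  | .var i => s.rvar i
  | .arr a e => s.arr a (e.eval s)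
  | .add a b => a.eval g s + b.eval g s
  | .sub a b => a.eval g s - b.eval g s
  | .mul a b => a.eval g s * b.eval g s
  | .div a b => a.eval g s / b.eval g s
  | .sqrt a => Real.sqrt (a.eval g s)
  | .act a => g (a.eval g s)

/-- The number of operations in a real expression. -/
def RExp.cost : RExp → ℕ
  | .cast e => e.cost + 1
  | .var _ => 1
  | .arr _ e => e.cost + 1
  | .add a b => a.cost + b.cost + 1
  | .sub a b => a.cost + b.cost + 1
  | .mul a b => a.cost + b.cost + 1
  | .div a b => a.cost + b.cost + 1
  | .sqrt a => a.cost + 1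
  | .act a => a.cost + 1

/-- The truth of a test. -/
def BExp.Holds (g : ℝ → ℝ) (s : State) : BExp → Prop
  | .nlt a b => a.eval s < b.eval s
  | .rlt a b => a.eval g s < b.eval g s
  | .not a => ¬ a.Holds g s
  | .and a b => a.Holds g s ∧ b.Holds g s

/-- The number of operations in a test. -/
def BExp.cost : BExp → ℕ
  | .nlt a b => a.cost + b.cost + 1
  | .rlt a b => a.cost + b.cost + 1
  | .not a => a.cost + 1
  | .and a b => a.cost + b.cost + 1

/-- Assign an integer variable. -/
def State.setN (s : State) (i n : ℕ) : State := { s with nvar := Function.update s.nvar i n }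

/-- Assign a real variable. -/
def State.setR (s : State) (i : ℕ) (r : ℝ) : State := { s with rvar := Function.update s.rvar i r }

/-- Assign entry `k` of array `a`. -/
def State.setA (s : State) (a k : ℕ) (r : ℝ) : State :=
  { s with arr := Function.update s.arr a (Function.update (s.arr a) k r) }

/-- Write the example `z = (x, y)` into entries `k, …, k + d` of array `a`, the label `y` last, and
count it as drawn. -/
def State.addSample {d : ℕ} (s : State) (a k : ℕ) (z : Sample d) : State :=
  { s with
    arr := Function.update s.arr a fun j =>
      if h : k ≤ j ∧ j - k < d then z.1 ⟨j - k, h.2⟩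
      else if j = k + d then z.2
      else s.arr a j
    drawn := s.drawn + 1 }

/-- `Exec g ω p s t s'`: the program `p`, started in state `s` with activation `g` and with the
sequence `ω` of examples, halts after `t` steps in state `s'`. -/
inductive Exec {d : ℕ} (g : ℝ → ℝ) (ω : ℕ → Sample d) : Prog → State → ℕ → State → Prop
  | skip (s : State) : Exec g ω .skip s 1 s
  | nset (s : State) (i : ℕ) (e : NExp) :
      Exec g ω (.nset i e) s (e.cost + 1) (s.setN i (e.eval s))
  | rset (s : State) (i : ℕ) (e : RExp) :
      Exec g ω (.rset i e) s (e.cost + 1) (s.setR i (e.eval g s))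
  | store (s : State) (a : ℕ) (k : NExp) (e : RExp) :
      Exec g ω (.store a k e) s (k.cost + e.cost + 1) (s.setA a (k.eval s) (e.eval g s))
  | draw (s : State) (a : ℕ) (k : NExp) :
      Exec g ω (.draw a k) s (k.cost + d + 1) (s.addSample a (k.eval s) (ω s.drawn))
  | seq {p q : Prog} {s s₁ s₂ : State} {t₁ t₂ : ℕ} (h₁ : Exec g ω p s t₁ s₁)
      (h₂ : Exec g ω q s₁ t₂ s₂) : Exec g ω (.seq p q) s (t₁ + t₂) s₂
  | ite_true {b : BExp} {p : Prog} (q : Prog) {s s₁ : State} {t : ℕ} (hb : b.Holds g s)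
      (h : Exec g ω p s t s₁) : Exec g ω (.ite b p q) s (b.cost + t) s₁
  | ite_false {b : BExp} (p : Prog) {q : Prog} {s s₁ : State} {t : ℕ} (hb : ¬ b.Holds g s)
      (h : Exec g ω q s t s₁) : Exec g ω (.ite b p q) s (b.cost + t) s₁
  | while_true {b : BExp} {p : Prog} {s s₁ s₂ : State} {t₁ t₂ : ℕ} (hb : b.Holds g s)
      (h₁ : Exec g ω p s t₁ s₁) (h₂ : Exec g ω (.while b p) s₁ t₂ s₂) :
      Exec g ω (.while b p) s (b.cost + t₁ + t₂) s₂
  | while_false {b : BExp} (p : Prog) {s : State} (hb : ¬ b.Holds g s) :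
      Exec g ω (.while b p) s b.cost s

/-- A program has at most one run. -/
theorem Exec.unique {d : ℕ} {g : ℝ → ℝ} {ω : ℕ → Sample d} {p : Prog} {s s₁ s₂ : State}
    {t₁ t₂ : ℕ} (h₁ : Exec g ω p s t₁ s₁) (h₂ : Exec g ω p s t₂ s₂) : t₁ = t₂ ∧ s₁ = s₂ := by
  induction h₁ generalizing t₂ s₂ with
  | skip | nset | rset | store | draw => cases h₂; exact ⟨rfl, rfl⟩
  | seq _ _ ih₁ ih₂ =>
    cases h₂ with
    | seq k₁ k₂ =>
      obtain ⟨rfl, rfl⟩ := ih₁ k₁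
      obtain ⟨rfl, rfl⟩ := ih₂ k₂
      exact ⟨rfl, rfl⟩
  | ite_true _ hb _ ih =>
    cases h₂ with
    | ite_true _ _ k => obtain ⟨rfl, rfl⟩ := ih k; exact ⟨rfl, rfl⟩
    | ite_false _ hb' _ => exact absurd hb hb'
  | ite_false _ hb _ ih =>
    cases h₂ with
    | ite_true _ hb' _ => exact absurd hb' hb
    | ite_false _ _ k => obtain ⟨rfl, rfl⟩ := ih k; exact ⟨rfl, rfl⟩
  | while_true hb _ _ ih₁ ih₂ =>
    cases h₂ with
    | while_true _ k₁ k₂ =>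
      obtain ⟨rfl, rfl⟩ := ih₁ k₁
      obtain ⟨rfl, rfl⟩ := ih₂ k₂
      exact ⟨rfl, rfl⟩
    | while_false _ hb' => exact absurd hb hb'
  | while_false _ hb =>
    cases h₂ with
    | while_true hb' _ _ => exact absurd hb' hb
    | while_false => exact ⟨rfl, rfl⟩

/-- The initial state: the dimension in integer variable `0`, the real parameters in the first real
variables, and zeros elsewhere. -/
def State.init (d : ℕ) (params : List ℝ) : State where
  nvar := fun i => if i = 0 then d else 0
  rvar := fun i => params.getD i 0
  arr := fun _ _ => 0
  drawn := 0

/-- The output: integer variable `0` holds the number of vectors, which stand one after the other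
in array `0`. -/
def State.output (d : ℕ) (s : State) : List (Vec d) :=
  List.ofFn fun i : Fin (s.nvar 0) => WithLp.toLp 2 fun j : Fin d => s.arr 0 (i * d + j)

/-- On the given real parameters, the program `p` halts after `t` steps, has drawn `n` examples, and
returns the list `L`. -/
def Returns {d : ℕ} (p : Prog) (g : ℝ → ℝ) (params : List ℝ) (ω : ℕ → Sample d) (t n : ℕ)
    (L : List (Vec d)) : Prop :=
  ∃ s : State, Exec g ω p (State.init d params) t s ∧ s.drawn = n ∧ s.output d = L

end ObliviousGLM

end

open ObliviousGLM

/-! Let `Λ` be the law of ξ + ε, let s be a width of order Δ, and let ρ = `ramp s` be r/s truncated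
to [-1, 1], the derivative of the Huber loss. As ρ is bounded, the oblivious noise enters, however
heavy its tails, only through G(t) = E ρ(z - t) with z of law `Λ` (`meanRamp`), an antitone function
with values in [-1, 1]. The noise need not be centred, so ρ is replaced by ρ - c for a guess c of
the unknown G(0), called a tilt. Since ξ vanishes with probability at least α, `Λ` has mass at least
αγ/10 on each of [0, s] and [-s, 0] (`noiseLaw_anchor`); hence G moves by at least that much between
0 and ±2s.

Descent. Each sample adds a multiple of (ρ(y - b - g(w·x)) - c) x to w, without any derivative of g.
Let v be the target and f = g(w·x) - g(v·x). Monotonicity of g and G gives G(b + f) - G(b) the sign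
of (v - w)·x, and |f| ≤ |(v - w)·x| because g is 1-Lipschitz. So the expected progress towards v is
at least E |G(b + f) - G(b)| |f|, the `slack`, up to the error 2R |G(b) - c| (`integral_coeff_ge`).
The regret of projected descent bounds the total progress, and a martingale bound
(`measure_le_sum_le`) turns this into an iterate of small slack, with failure probability
exponentially small in the batch size (`measure_slack_le`). At b = 0 small slack means small excess
loss, because G(f) is far from G(0) once |f| > 2s (`excessLoss_le_of_slack`). A grid of tilts
contains one near G(0), and the iterates for all tilts form the list.

Selection. The population loss of g(w·x) + b for tilt c is, up to a constant, E pot_c(b + f), where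
`pot` is convex with derivative c - G. Put κ = αγ/20, half the anchor mass. A candidate found with
tilt c is compared, at the tilts c + κ and c - κ, with the least loss reached by any descent with
any offset b from a grid. A candidate of small slack with c near G(0) passes, since offset 0 is
nearly optimal for all tilts that close to G(0) (`popLoss_zero_le`). Conversely, passing for both
tilts forces f to be nearly constant: pot_{c±κ}(t) = pot_c(t) ± κt, so a deviation of f from a
minimiser m of pot_c costs at least κ|f - m| for one of the two tilts (`integral_abs_gap_sub_le`).
This converse needs the scan to compete with all constants for every tilt c, which explains the
offsets: if c = G(b), then descent with offset b and tilt c is unbiased at the target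
(`GoodRun.exists_competitor`). The outcome E |f - m| ≤ 52 s is below τ², and Markov's inequality
with identifiability bounds the excess loss.

Machine. `Halts` carries step bounds through the programs. Descents are recomputed instead of
stored, which costs of order d T³ N steps for T steps of descent and N samples per run. As T is a
multiple of K², where K is the number of tilts for the list, T³ is of order (T K)² and hence at most
of order W². -/

namespace ObliviousGLM

/-! ### A program logic with running times -/

/-- The integer variables a program may change. -/
def Prog.NWrites : Prog → ℕ → Prop
  | .nset i _, j => j = i
  | .seq p q, j => p.NWrites j ∨ q.NWrites j
  | .ite _ p q, j => p.NWrites j ∨ q.NWrites j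
  | .while _ p, j => p.NWrites j
  | _, _ => False

/-- The real variables a program may change. -/
def Prog.RWrites : Prog → ℕ → Prop
  | .rset i _, j => j = i
  | .seq p q, j => p.RWrites j ∨ q.RWrites j
  | .ite _ p q, j => p.RWrites j ∨ q.RWrites j
  | .while _ p, j => p.RWrites j
  | _, _ => False

/-- The arrays a program may change. -/
def Prog.AWrites : Prog → ℕ → Prop
  | .store a _ _, j => j = a
  | .draw a _, j => j = a
  | .seq p q, j => p.AWrites j ∨ q.AWrites j
  | .ite _ p q, j => p.AWrites j ∨ q.AWrites j
  | .while _ p, j => p.AWrites j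
  | _, _ => False

/-- Whether a program contains a `draw`. -/
def Prog.Draws : Prog → Prop
  | .draw _ _ => True
  | .seq p q => p.Draws ∨ q.Draws
  | .ite _ p q => p.Draws ∨ q.Draws
  | .while _ p => p.Draws
  | _ => False

/-- The states `s` and `s'` agree on everything that `p` cannot change. -/
structure Frame (p : Prog) (s s' : State) : Prop where
  n : ∀ i, ¬ p.NWrites i → s'.nvar i = s.nvar i
  r : ∀ i, ¬ p.RWrites i → s'.rvar i = s.rvar i
  a : ∀ i, ¬ p.AWrites i → s'.arr i = s.arr i
  drawn : ¬ p.Draws → s'.drawn = s.drawn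

theorem Frame.refl (p : Prog) (s : State) : Frame p s s :=
  ⟨fun _ _ => rfl, fun _ _ => rfl, fun _ _ => rfl, fun _ => rfl⟩

theorem Frame.trans {p : Prog} {s s' s'' : State} (h : Frame p s s') (h' : Frame p s' s'') :
    Frame p s s'' :=
  ⟨fun i hi => (h'.n i hi).trans (h.n i hi), fun i hi => (h'.r i hi).trans (h.r i hi),
    fun i hi => (h'.a i hi).trans (h.a i hi), fun hi => (h'.drawn hi).trans (h.drawn hi)⟩

theorem Frame.mono {p q : Prog} {s s' : State} (h : Frame p s s')
    (hn : ∀ i, p.NWrites i → q.NWrites i) (hr : ∀ i, p.RWrites i → q.RWrites i)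
    (ha : ∀ i, p.AWrites i → q.AWrites i) (hd : p.Draws → q.Draws) : Frame q s s' :=
  ⟨fun i hi => h.n i (mt (hn i) hi), fun i hi => h.r i (mt (hr i) hi),
    fun i hi => h.a i (mt (ha i) hi), fun hi => h.drawn (mt hd hi)⟩

/-- Specifications below mention only what a program changes; the rest of the memory is recovered
from the write sets, which `simp` computes from the syntax. -/
theorem Exec.frame {d : ℕ} {g : ℝ → ℝ} {ω : ℕ → Sample d} {p : Prog} {s s' : State} {t : ℕ}
    (h : Exec g ω p s t s') : Frame p s s' := by
  induction h with
  | skip s => exact Frame.refl _ _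
  | nset s i e =>
    exact ⟨fun j hj => Function.update_of_ne hj _ _, fun _ _ => rfl, fun _ _ => rfl, fun _ => rfl⟩
  | rset s i e =>
    exact ⟨fun _ _ => rfl, fun j hj => Function.update_of_ne hj _ _, fun _ _ => rfl, fun _ => rfl⟩
  | store s a k e =>
    exact ⟨fun _ _ => rfl, fun _ _ => rfl, fun j hj => Function.update_of_ne hj _ _, fun _ => rfl⟩
  | draw s a k =>
    exact ⟨fun _ _ => rfl, fun _ _ => rfl, fun j hj => Function.update_of_ne hj _ _,
      fun hj => absurd trivial hj⟩
  | seq _ _ ih₁ ih₂ =>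
    exact (ih₁.mono (fun _ => Or.inl) (fun _ => Or.inl) (fun _ => Or.inl) Or.inl).trans
      (ih₂.mono (fun _ => Or.inr) (fun _ => Or.inr) (fun _ => Or.inr) Or.inr)
  | ite_true _ _ _ ih =>
    exact ih.mono (fun _ => Or.inl) (fun _ => Or.inl) (fun _ => Or.inl) Or.inl
  | ite_false _ _ _ ih =>
    exact ih.mono (fun _ => Or.inr) (fun _ => Or.inr) (fun _ => Or.inr) Or.inr
  | while_true _ _ _ ih₁ ih₂ =>
    exact (ih₁.mono (q := .while _ _) (fun _ => id) (fun _ => id) (fun _ => id) id).trans ih₂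
  | while_false => exact Frame.refl _ _

/-- The program `p`, started in `s`, halts within `c` steps in a state that satisfies `Q`. -/
def Halts {d : ℕ} (g : ℝ → ℝ) (ω : ℕ → Sample d) (p : Prog) (s : State) (c : ℕ)
    (Q : State → Prop) : Prop :=
  ∃ t s', Exec g ω p s t s' ∧ t ≤ c ∧ Q s'

section
variable {d : ℕ} {g : ℝ → ℝ} {ω : ℕ → Sample d}

theorem Halts.mono {p : Prog} {s : State} {c c' : ℕ} {Q Q' : State → Prop}
    (h : Halts g ω p s c Q) (hc : c ≤ c') (hQ : ∀ s', Frame p s s' → Q s' → Q' s') :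
    Halts g ω p s c' Q' := by
  obtain ⟨t, s', he, ht, hq⟩ := h
  exact ⟨t, s', he, ht.trans hc, hQ s' he.frame hq⟩

theorem Halts.seq {p q : Prog} {s : State} {c₁ c₂ : ℕ} {R : State → Prop}
    (h : Halts g ω p s c₁ fun s₁ => Halts g ω q s₁ c₂ R) :
    Halts g ω (.seq p q) s (c₁ + c₂) R := by
  obtain ⟨t, s₁, he, ht, t', s₂, he', ht', hr⟩ := h
  exact ⟨_, _, .seq he he', add_le_add ht ht', hr⟩

theorem Halts.seq' {p q : Prog} {s : State} {c₁ c₂ : ℕ} {Q R : State → Prop}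
    (h : Halts g ω p s c₁ Q) (h' : ∀ s₁, Frame p s s₁ → Q s₁ → Halts g ω q s₁ c₂ R) :
    Halts g ω (.seq p q) s (c₁ + c₂) R :=
  (h.mono le_rfl h').seq

theorem Halts.skip {s : State} {Q : State → Prop} (h : Q s) : Halts g ω .skip s 1 Q :=
  ⟨_, _, .skip s, le_rfl, h⟩

theorem Halts.nset {i : ℕ} {e : NExp} {s : State} {Q : State → Prop}
    (h : Q (s.setN i (e.eval s))) : Halts g ω (.nset i e) s (e.cost + 1) Q :=
  ⟨_, _, .nset s i e, le_rfl, h⟩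

theorem Halts.rset {i : ℕ} {e : RExp} {s : State} {Q : State → Prop}
    (h : Q (s.setR i (e.eval g s))) : Halts g ω (.rset i e) s (e.cost + 1) Q :=
  ⟨_, _, .rset s i e, le_rfl, h⟩

theorem Halts.store {a : ℕ} {k : NExp} {e : RExp} {s : State} {Q : State → Prop}
    (h : Q (s.setA a (k.eval s) (e.eval g s))) :
    Halts g ω (.store a k e) s (k.cost + e.cost + 1) Q :=
  ⟨_, _, .store s a k e, le_rfl, h⟩

theorem Halts.draw {a : ℕ} {k : NExp} {s : State} {Q : State → Prop}
    (h : Q (s.addSample a (k.eval s) (ω s.drawn))) :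
    Halts g ω (.draw a k) s (k.cost + d + 1) Q :=
  ⟨_, _, .draw s a k, le_rfl, h⟩

theorem Halts.ite {b : BExp} {p q : Prog} {s : State} {c : ℕ} {Q : State → Prop}
    (hp : b.Holds g s → Halts g ω p s c Q) (hq : ¬ b.Holds g s → Halts g ω q s c Q) :
    Halts g ω (.ite b p q) s (b.cost + c) Q := by
  by_cases hb : b.Holds g s
  · obtain ⟨t, s', he, ht, h⟩ := hp hb
    exact ⟨_, _, .ite_true q hb he, by omega, h⟩
  · obtain ⟨t, s', he, ht, h⟩ := hq hb
    exact ⟨_, _, .ite_false p hb he, by omega, h⟩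

/-- A loop that runs at most `m` more times. -/
theorem Halts.while {b : BExp} {p : Prog} {c : ℕ} {Q : State → Prop} (Inv : ℕ → State → Prop)
    (hlast : ∀ m s, Inv m s → ¬ b.Holds g s → Q s)
    (step : ∀ m s, Inv m s → b.Holds g s → 0 < m ∧ Halts g ω p s c (Inv (m - 1))) :
    ∀ m s, Inv m s → Halts g ω (.while b p) s (m * (b.cost + c) + b.cost) Q := by
  intro m
  induction m with
  | zero =>
    intro s hs
    have hb : ¬ b.Holds g s := fun hb => absurd (step 0 s hs hb).1 (lt_irrefl 0)
    exact ⟨_, _, .while_false p hb, by omega, hlast _ _ hs hb⟩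
  | succ m ih =>
    intro s hs
    by_cases hb : b.Holds g s
    · obtain ⟨t, s₁, he, ht, h₁⟩ := (step _ s hs hb).2
      obtain ⟨t', s₂, he', ht', h₂⟩ := ih s₁ h₁
      refine ⟨_, _, .while_true hb he he', ?_, h₂⟩
      have : (m + 1) * (b.cost + c) = m * (b.cost + c) + b.cost + c := by ring
      omega
    · exact ⟨_, _, .while_false p hb, by omega, hlast _ _ hs hb⟩

end

/-- `for i < n do p`, where `i` and `n` are integer variables. -/
def loop (i n : ℕ) (p : Prog) : Prog :=
  .seq (.nset i (.const 0))
    (.while (.nlt (.var i) (.var n)) (.seq p (.nset i (.add (.var i) (.const 1)))))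

@[simp] theorem loop_nWrites (i n : ℕ) (p : Prog) (j : ℕ) :
    (loop i n p).NWrites j ↔ j = i ∨ p.NWrites j := by
  simp [loop, Prog.NWrites]; tauto

@[simp] theorem loop_rWrites (i n : ℕ) (p : Prog) (j : ℕ) :
    (loop i n p).RWrites j ↔ p.RWrites j := by
  simp [loop, Prog.RWrites]

@[simp] theorem loop_aWrites (i n : ℕ) (p : Prog) (j : ℕ) :
    (loop i n p).AWrites j ↔ p.AWrites j := by
  simp [loop, Prog.AWrites]

@[simp] theorem loop_draws (i n : ℕ) (p : Prog) : (loop i n p).Draws ↔ p.Draws := by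
  simp [loop, Prog.Draws]

@[simp] theorem seq_nWrites (p q : Prog) (j : ℕ) :
    (Prog.seq p q).NWrites j ↔ p.NWrites j ∨ q.NWrites j := Iff.rfl
@[simp] theorem seq_rWrites (p q : Prog) (j : ℕ) :
    (Prog.seq p q).RWrites j ↔ p.RWrites j ∨ q.RWrites j := Iff.rfl
@[simp] theorem seq_aWrites (p q : Prog) (j : ℕ) :
    (Prog.seq p q).AWrites j ↔ p.AWrites j ∨ q.AWrites j := Iff.rfl
@[simp] theorem seq_draws (p q : Prog) : (Prog.seq p q).Draws ↔ p.Draws ∨ q.Draws := Iff.rfl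
@[simp] theorem ite_nWrites (b : BExp) (p q : Prog) (j : ℕ) :
    (Prog.ite b p q).NWrites j ↔ p.NWrites j ∨ q.NWrites j := Iff.rfl
@[simp] theorem ite_rWrites (b : BExp) (p q : Prog) (j : ℕ) :
    (Prog.ite b p q).RWrites j ↔ p.RWrites j ∨ q.RWrites j := Iff.rfl
@[simp] theorem ite_aWrites (b : BExp) (p q : Prog) (j : ℕ) :
    (Prog.ite b p q).AWrites j ↔ p.AWrites j ∨ q.AWrites j := Iff.rfl
@[simp] theorem ite_draws (b : BExp) (p q : Prog) :
    (Prog.ite b p q).Draws ↔ p.Draws ∨ q.Draws := Iff.rfl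
@[simp] theorem nset_nWrites (i : ℕ) (e : NExp) (j : ℕ) : (Prog.nset i e).NWrites j ↔ j = i :=
  Iff.rfl
@[simp] theorem nset_rWrites (i : ℕ) (e : NExp) (j : ℕ) : (Prog.nset i e).RWrites j ↔ False :=
  Iff.rfl
@[simp] theorem nset_aWrites (i : ℕ) (e : NExp) (j : ℕ) : (Prog.nset i e).AWrites j ↔ False :=
  Iff.rfl
@[simp] theorem nset_draws (i : ℕ) (e : NExp) : (Prog.nset i e).Draws ↔ False := Iff.rfl
@[simp] theorem rset_nWrites (i : ℕ) (e : RExp) (j : ℕ) : (Prog.rset i e).NWrites j ↔ False :=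
  Iff.rfl
@[simp] theorem rset_rWrites (i : ℕ) (e : RExp) (j : ℕ) : (Prog.rset i e).RWrites j ↔ j = i :=
  Iff.rfl
@[simp] theorem rset_aWrites (i : ℕ) (e : RExp) (j : ℕ) : (Prog.rset i e).AWrites j ↔ False :=
  Iff.rfl
@[simp] theorem rset_draws (i : ℕ) (e : RExp) : (Prog.rset i e).Draws ↔ False := Iff.rfl
@[simp] theorem store_nWrites (a : ℕ) (k : NExp) (e : RExp) (j : ℕ) :
    (Prog.store a k e).NWrites j ↔ False := Iff.rfl
@[simp] theorem store_rWrites (a : ℕ) (k : NExp) (e : RExp) (j : ℕ) :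
    (Prog.store a k e).RWrites j ↔ False := Iff.rfl
@[simp] theorem store_aWrites (a : ℕ) (k : NExp) (e : RExp) (j : ℕ) :
    (Prog.store a k e).AWrites j ↔ j = a := Iff.rfl
@[simp] theorem store_draws (a : ℕ) (k : NExp) (e : RExp) :
    (Prog.store a k e).Draws ↔ False := Iff.rfl
@[simp] theorem draw_nWrites (a : ℕ) (k : NExp) (j : ℕ) :
    (Prog.draw a k).NWrites j ↔ False := Iff.rfl
@[simp] theorem draw_rWrites (a : ℕ) (k : NExp) (j : ℕ) :
    (Prog.draw a k).RWrites j ↔ False := Iff.rfl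
@[simp] theorem draw_aWrites (a : ℕ) (k : NExp) (j : ℕ) :
    (Prog.draw a k).AWrites j ↔ j = a := Iff.rfl
@[simp] theorem while_nWrites (b : BExp) (p : Prog) (j : ℕ) :
    (Prog.while b p).NWrites j ↔ p.NWrites j := Iff.rfl
@[simp] theorem while_rWrites (b : BExp) (p : Prog) (j : ℕ) :
    (Prog.while b p).RWrites j ↔ p.RWrites j := Iff.rfl
@[simp] theorem while_aWrites (b : BExp) (p : Prog) (j : ℕ) :
    (Prog.while b p).AWrites j ↔ p.AWrites j := Iff.rfl
@[simp] theorem while_draws (b : BExp) (p : Prog) : (Prog.while b p).Draws ↔ p.Draws := Iff.rfl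
@[simp] theorem skip_nWrites (j : ℕ) : Prog.skip.NWrites j ↔ False := Iff.rfl
@[simp] theorem skip_rWrites (j : ℕ) : Prog.skip.RWrites j ↔ False := Iff.rfl
@[simp] theorem skip_aWrites (j : ℕ) : Prog.skip.AWrites j ↔ False := Iff.rfl
@[simp] theorem skip_draws : Prog.skip.Draws ↔ False := Iff.rfl

@[simp] theorem setN_nvar (s : State) (i n j : ℕ) :
    (s.setN i n).nvar j = if j = i then n else s.nvar j := by
  simp [State.setN, Function.update_apply]
@[simp] theorem setN_rvar (s : State) (i n : ℕ) : (s.setN i n).rvar = s.rvar := rfl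
@[simp] theorem setN_arr (s : State) (i n : ℕ) : (s.setN i n).arr = s.arr := rfl
@[simp] theorem setN_drawn (s : State) (i n : ℕ) : (s.setN i n).drawn = s.drawn := rfl
@[simp] theorem setR_rvar (s : State) (i : ℕ) (r : ℝ) (j : ℕ) :
    (s.setR i r).rvar j = if j = i then r else s.rvar j := by
  simp [State.setR, Function.update_apply]
@[simp] theorem setR_nvar (s : State) (i : ℕ) (r : ℝ) : (s.setR i r).nvar = s.nvar := rfl
@[simp] theorem setR_arr (s : State) (i : ℕ) (r : ℝ) : (s.setR i r).arr = s.arr := rfl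
@[simp] theorem setR_drawn (s : State) (i : ℕ) (r : ℝ) : (s.setR i r).drawn = s.drawn := rfl
@[simp] theorem setA_arr (s : State) (a k : ℕ) (r : ℝ) (b j : ℕ) :
    (s.setA a k r).arr b j = if b = a ∧ j = k then r else s.arr b j := by
  by_cases hb : b = a
  · subst hb; simp [State.setA, Function.update_apply]
  · simp [State.setA, hb]
@[simp] theorem setA_nvar (s : State) (a k : ℕ) (r : ℝ) : (s.setA a k r).nvar = s.nvar := rfl
@[simp] theorem setA_rvar (s : State) (a k : ℕ) (r : ℝ) : (s.setA a k r).rvar = s.rvar := rfl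
@[simp] theorem setA_drawn (s : State) (a k : ℕ) (r : ℝ) : (s.setA a k r).drawn = s.drawn := rfl
attribute [simp] NExp.eval RExp.eval BExp.Holds

section
variable {d : ℕ} {g : ℝ → ℝ} {ω : ℕ → Sample d}

/-- The counter is advanced after the body, so the body must establish the invariant for the state
whose counter is already `k + 1`. A round adds 3 steps for the test and 4 for the increment; the
initial assignment and the last test give 5. -/
theorem Halts.loop {i n : ℕ} {p : Prog} (hi : ¬ p.NWrites i) (hn : ¬ p.NWrites n) (hin : n ≠ i)
    (Inv : ℕ → State → Prop) {c N : ℕ} {s₀ : State}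
    (hN : s₀.nvar n = N) (h₀ : Inv 0 (s₀.setN i 0))
    (step : ∀ k s, k < N → s.nvar i = k → Frame (loop i n p) s₀ s → Inv k s →
      Halts g ω p s c fun s' => Inv (k + 1) (s'.setN i (k + 1))) :
    Halts g ω (loop i n p) s₀ (N * (c + 7) + 5) (Inv N) := by
  subst hN
  have key := Halts.while (g := g) (ω := ω) (b := .nlt (.var i) (.var n))
    (p := .seq p (.nset i (.add (.var i) (.const 1)))) (c := c + 4) (Q := Inv (s₀.nvar n))
    (fun m s => ∃ k, k + m = s₀.nvar n ∧ s.nvar i = k ∧ Frame (ObliviousGLM.loop i n p) s₀ s ∧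
      Inv k s) ?_ ?_ (s₀.nvar n) (s₀.setN i 0) ⟨0, by simp, by simp, ?_, h₀⟩
  · refine ((Halts.nset (e := .const 0) (i := i) key).seq).mono ?_ fun _ _ h => h
    simp only [NExp.cost, BExp.cost]
    ring_nf; omega
  · rintro m s ⟨k, hk, hik, hF, hI⟩ hb
    have : s.nvar n = s₀.nvar n := hF.n n (by simp [hin, hn])
    simp only [BExp.Holds, NExp.eval, this, hik] at hb
    have : k = s₀.nvar n := by omega
    rwa [← this]
  · rintro m s ⟨k, hk, hik, hF, hI⟩ hb
    have hn' : s.nvar n = s₀.nvar n := hF.n n (by simp [hin, hn])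
    simp only [BExp.Holds, NExp.eval, hn', hik] at hb
    refine ⟨by omega, ?_⟩
    refine (Halts.seq' (step k s hb hik hF hI) fun s₁ hF₁ h₁ => ?_).mono (c := c + 4) le_rfl
      fun _ _ h => h
    refine Halts.nset (e := .add (.var i) (.const 1)) ⟨k + 1, by omega, ?_, ?_, ?_⟩
    · simp [hF₁.n i hi, hik]
    · refine hF.trans ⟨fun j hj => ?_, fun j hj => ?_, fun j hj => ?_, fun hj => ?_⟩
      · simp only [loop_nWrites, not_or] at hj
        simp [hj.1, hF₁.n j hj.2]
      · exact hF₁.r j (by simpa using hj)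
      · exact hF₁.a j (by simpa using hj)
      · exact hF₁.drawn (by simpa using hj)
    · simpa [hF₁.n i hi, hik] using h₁
  · refine ⟨fun j hj => ?_, fun _ _ => rfl, fun _ _ => rfl, fun _ => rfl⟩
    simp only [loop_nWrites, not_or] at hj
    simp [hj.1]

/-- Accumulation of a sum in a real variable. -/
theorem Halts.sumLoop {i n x : ℕ} {e : RExp} (hin : n ≠ i) {s₀ : State} {N : ℕ} (hN : s₀.nvar n = N) (v : ℕ → ℝ)
    (he : ∀ k s, k < N → s.nvar i = k → (∀ j, j ≠ i → s.nvar j = s₀.nvar j) →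
      (∀ j, j ≠ x → s.rvar j = s₀.rvar j) → s.arr = s₀.arr → e.eval g s = v k) :
    Halts g ω (ObliviousGLM.loop i n (.rset x (.add (.var x) e))) s₀
      (N * (e.cost + 10) + 5)
      fun s => s.rvar x = s₀.rvar x + ∑ k ∈ Finset.range N, v k := by
  refine (Halts.loop (c := e.cost + 3) (by simp) (by simp) hin (hN := hN)
    (fun m s => s.rvar x = s₀.rvar x + ∑ k ∈ Finset.range m, v k) (by simp)
    fun k s hk hik hF hI => ?_).mono (by ring_nf; omega) fun _ _ h => h
  refine (Halts.rset (e := .add (.var x) e) ?_).mono (by simp [RExp.cost]; omega) fun _ _ h => h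
  have := he k s hk hik (fun j hj => hF.n j (by simpa using hj))
    (fun j hj => hF.r j (by simpa using hj)) (funext fun a => hF.a a (by simp))
  simp [hI, this, Finset.sum_range_succ, add_assoc]

/-- Assignment to a block of an array. -/
theorem Halts.storeLoop {i n a : ℕ} {k : NExp} {e : RExp} (hin : n ≠ i) {s₀ : State} {N : ℕ} (hN : s₀.nvar n = N) (o : ℕ)
    (v : ℕ → ℝ) (hk : ∀ m s, m < N → s.nvar i = m → (∀ j, j ≠ i → s.nvar j = s₀.nvar j) →
      k.eval s = o + m)
    (he : ∀ m s, m < N → s.nvar i = m → (∀ j, j ≠ i → s.nvar j = s₀.nvar j) →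
      s.rvar = s₀.rvar → (∀ b, b ≠ a → s.arr b = s₀.arr b) → s.arr a (o + m) = s₀.arr a (o + m) →
      e.eval g s = v m) :
    Halts g ω (ObliviousGLM.loop i n (.store a k e)) s₀ (N * (k.cost + e.cost + 8) + 5)
      fun s => (∀ m < N, s.arr a (o + m) = v m) ∧
        ∀ j, (j < o ∨ o + N ≤ j) → s.arr a j = s₀.arr a j := by
  refine (Halts.loop (c := k.cost + e.cost + 1) (by simp) (by simp) hin (hN := hN)
    (fun m s => (∀ l < m, s.arr a (o + l) = v l) ∧
        ∀ j, (j < o ∨ o + m ≤ j) → s.arr a j = s₀.arr a j) (by simp)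
    fun m s hm him hF hI => ?_).mono (by ring_nf; omega) fun _ _ h => h
  refine Halts.store ?_
  have hn : ∀ j, j ≠ i → s.nvar j = s₀.nvar j := fun j hj => hF.n j (by simpa using hj)
  rw [hk m s hm him hn, he m s hm him hn (funext fun b => hF.r b (by simp))
    (fun b hb => hF.a b (by simpa using hb)) (hI.2 _ (Or.inr le_rfl))]
  refine ⟨fun l hl => ?_, fun j hj => ?_⟩
  · by_cases h : l = m
    · simp [h]
    · simpa [h] using hI.1 l (by omega)
  · have : j ≠ o + m := by omega
    simpa [this] using hI.2 j (by omega)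

end

end ObliviousGLM

namespace ObliviousGLM

noncomputable section

/-! ### The iteration and the empirical Huber loss -/

/-- The function `r ↦ r / s`, truncated to `[-1, 1]`. -/
def ramp (s r : ℝ) : ℝ := (|r / s + 1| - |r / s - 1|) / 2

/-- The Huber loss, whose derivative is `ramp s`. -/
def huber (s r : ℝ) : ℝ := r * ramp s r - s * (ramp s r * ramp s r) / 2

/-- The projection to the ball of radius `R`. -/
def clip {d : ℕ} (R : ℝ) (w : Vec d) : Vec d := (R / max R ‖w‖) • w

/-- The multiple of the feature vector that the sample `z` adds to `w`. -/
def coeff {d : ℕ} (g : ℝ → ℝ) (s b c : ℝ) (w : Vec d) (z : Sample d) : ℝ :=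
  ramp s (z.2 - b - g (inner ℝ w z.1)) - c

/-- Projected stochastic descent with batches of `B` samples. -/
def descent {d : ℕ} (g : ℝ → ℝ) (R s η b c : ℝ) (B : ℕ) (ω : ℕ → Sample d) : ℕ → Vec d
  | 0 => 0
  | t + 1 => clip R (descent g R s η b c B ω t + ∑ j ∈ Finset.range B,
      (η * coeff g s b c (descent g R s η b c B ω t) (ω (t * B + j))) • (ω (t * B + j)).1)

/-- The Huber loss of the predictor `g (w ⬝ x) + b`, relative to the constant predictor `g 0`. -/
def huberGap {d : ℕ} (g : ℝ → ℝ) (s b : ℝ) (w : Vec d) (z : Sample d) : ℝ :=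
  huber s (z.2 - b - g (inner ℝ w z.1)) - huber s (z.2 - g 0)

/-- The difference of the predictor `g (w ⬝ x) + b` and the constant predictor `g 0`. -/
def shift {d : ℕ} (g : ℝ → ℝ) (b : ℝ) (w : Vec d) (z : Sample d) : ℝ :=
  b + g (inner ℝ w z.1) - g 0

/-- The sum of `huberGap` over the samples `N, …, 2 N - 1`. -/
def huberSum {d : ℕ} (g : ℝ → ℝ) (s b : ℝ) (N : ℕ) (ω : ℕ → Sample d) (w : Vec d) : ℝ :=
  ∑ j ∈ Finset.range N, huberGap g s b w (ω (N + j))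

/-- The sum of `shift` over the samples `N, …, 2 N - 1`. -/
def shiftSum {d : ℕ} (g : ℝ → ℝ) (b : ℝ) (N : ℕ) (ω : ℕ → Sample d) (w : Vec d) : ℝ :=
  ∑ j ∈ Finset.range N, shift g b w (ω (N + j))

/-- The empirical tilted Huber loss. -/
def empLoss {d : ℕ} (g : ℝ → ℝ) (s b c : ℝ) (N : ℕ) (ω : ℕ → Sample d) (w : Vec d) : ℝ :=
  (huberSum g s b N ω w + c * shiftSum g b N ω w) / N

/-! ### Subroutines -/

/-- The vector in entries `o, …, o + d - 1` of array `a`. -/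
def State.read (d : ℕ) (s : State) (a o : ℕ) : Vec d := WithLp.toLp 2 fun j => s.arr a (o + j)

theorem State.read_congr {d : ℕ} {s s' : State} {a o : ℕ} (h : s'.arr a = s.arr a) :
    s'.read d a o = s.read d a o := by
  simp [State.read, h]

@[simp] theorem State.read_setN (d : ℕ) (s : State) (i n a o : ℕ) :
    (s.setN i n).read d a o = s.read d a o := rfl

@[simp] theorem State.read_setR (d : ℕ) (s : State) (i : ℕ) (r : ℝ) (a o : ℕ) :
    (s.setR i r).read d a o = s.read d a o := rfl

theorem State.read_eq {d : ℕ} {s : State} {a o : ℕ} {v : Vec d}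
    (h : ∀ j : Fin d, s.arr a (o + j) = v j) : s.read d a o = v := by
  ext j; simpa [State.read] using h j

theorem inner_eq_sum_range {d : ℕ} {v w : Vec d} {f e : ℕ → ℝ} (hf : ∀ j : Fin d, f j = v j)
    (he : ∀ j : Fin d, e j = w j) :
    ∑ j ∈ Finset.range d, f j * e j = (inner ℝ v w : ℝ) := by
  rw [Finset.sum_range, PiLp.inner_apply]
  refine Finset.sum_congr rfl fun j _ => ?_
  simp [hf, he, mul_comm]

/-- Expressions offer square roots but no absolute value and no branching, so the programs obtain
`ramp` and the maximum in `clip` from |a| = √(a·a). -/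
theorem sqrt_mul_self_abs (a : ℝ) : Real.sqrt (a * a) = |a| := Real.sqrt_mul_self_eq_abs a

/-- The truncation of `e / s`, where `s` is in real variable `9`. -/
def rampE (e : RExp) : RExp :=
  .div (.sub
    (.sqrt (.mul (.add (.div e (.var 9)) (.cast (.const 1)))
      (.add (.div e (.var 9)) (.cast (.const 1)))))
    (.sqrt (.mul (.sub (.div e (.var 9)) (.cast (.const 1)))
      (.sub (.div e (.var 9)) (.cast (.const 1))))))
    (.cast (.const 2))

theorem rampE_eval (g : ℝ → ℝ) (s : State) (e : RExp) :
    (rampE e).eval g s = ramp (s.rvar 9) (e.eval g s) := by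
  simp [rampE, ramp, sqrt_mul_self_abs]

/-- The Huber loss of `e`. -/
def huberE (e : RExp) : RExp :=
  .sub (.mul e (rampE e))
    (.div (.mul (.var 9) (.mul (rampE e) (rampE e))) (.cast (.const 2)))

theorem huberE_eval (g : ℝ → ℝ) (s : State) (e : RExp) :
    (huberE e).eval g s = huber (s.rvar 9) (e.eval g s) := by
  simp [huberE, huber, rampE_eval]

/-- The static part of the memory: the parameters and the first `n` samples. -/
structure Ctx {d : ℕ} (R σ η : ℝ) (T B N n : ℕ) (ω : ℕ → Sample d) (s : State) : Prop where
  dim : s.nvar 0 = d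
  steps : s.nvar 2 = T
  batch : s.nvar 4 = B
  half : s.nvar 5 = N
  radius : s.rvar 2 = R
  scale : s.rvar 9 = σ
  rate : s.rvar 14 = η
  feature : ∀ i < n, s.read d 1 (i * (d + 1)) = (ω i).1
  label : ∀ i < n, s.arr 1 (i * (d + 1) + d) = (ω i).2

theorem Ctx.congr {d : ℕ} {R σ η : ℝ} {T B N n : ℕ} {ω : ℕ → Sample d} {s s' : State}
    (h : Ctx R σ η T B N n ω s) (h0 : s'.nvar 0 = s.nvar 0) (h2 : s'.nvar 2 = s.nvar 2)
    (h4 : s'.nvar 4 = s.nvar 4) (h5 : s'.nvar 5 = s.nvar 5) (hr : s'.rvar 2 = s.rvar 2)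
    (h9 : s'.rvar 9 = s.rvar 9) (h14 : s'.rvar 14 = s.rvar 14) (ha : s'.arr 1 = s.arr 1) :
    Ctx R σ η T B N n ω s' :=
  ⟨h0.trans h.dim, h2.trans h.steps, h4.trans h.batch, h5.trans h.half, hr.trans h.radius,
    h9.trans h.scale, h14.trans h.rate, fun i hi => (State.read_congr ha).trans (h.feature i hi),
    fun i hi => by rw [ha]; exact h.label i hi⟩

/-- The program preserves the static part of the memory. -/
structure Safe (p : Prog) : Prop where
  n0 : ¬ p.NWrites 0
  n2 : ¬ p.NWrites 2
  n4 : ¬ p.NWrites 4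
  n5 : ¬ p.NWrites 5
  r2 : ¬ p.RWrites 2
  r9 : ¬ p.RWrites 9
  r14 : ¬ p.RWrites 14
  a1 : ¬ p.AWrites 1

theorem Ctx.frame {d : ℕ} {R σ η : ℝ} {T B N n : ℕ} {ω : ℕ → Sample d} {s s' : State}
    (h : Ctx R σ η T B N n ω s) {p : Prog} (hp : Safe p) (hF : Frame p s s') :
    Ctx R σ η T B N n ω s' :=
  h.congr (hF.n _ hp.n0) (hF.n _ hp.n2) (hF.n _ hp.n4) (hF.n _ hp.n5) (hF.r _ hp.r2)
    (hF.r _ hp.r9) (hF.r _ hp.r14) (hF.a _ hp.a1)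

/-- The inner product of array `2` and the sample at address `nvar 11`, into real variable `10`. -/
def dotP : Prog :=
  .seq (.rset 10 (.cast (.const 0)))
    (loop 6 0 (.rset 10 (.add (.var 10)
      (.mul (.arr 2 (.var 6)) (.arr 1 (.add (.var 11) (.var 6)))))))

section
variable {d : ℕ} {g : ℝ → ℝ} {ω : ℕ → Sample d}

theorem dotP_halts (hd : 0 < d) {s : State} (h0 : s.nvar 0 = d) :
    Halts g ω dotP s (100 * d) fun s' =>
      s'.rvar 10 = (inner ℝ (s.read d 2 0) (s.read d 1 (s.nvar 11)) : ℝ) := by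
  refine Halts.mono (Halts.seq' (Halts.rset (Q := fun s' => s' = s.setR 10 0) (by simp))
    fun s₁ _ h₁ => (Halts.sumLoop (by decide) (N := d) ?_
      (fun k => s.arr 2 k * s.arr 1 (s.nvar 11 + k)) ?_).mono le_rfl ?_) ?_ fun _ _ h => h
  · simp [h₁, h0]
  · intro k s' hk hi hn hr ha
    simp [h₁, hi, hn, ha]
  · intro s' _ h
    rw [h, h₁]
    simp only [setR_rvar, if_true, zero_add]
    exact inner_eq_sum_range (fun j => by simp [State.read]) (fun j => by simp [State.read])
  · simp [RExp.cost, NExp.cost]; omega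

/-- Add the contribution of sample `t B + j` to array `3`. -/
def gradP : Prog :=
  .seq (.nset 11 (.mul (.add (.mul (.var 8) (.var 4)) (.var 7)) (.add (.var 0) (.const 1))))
    (.seq dotP
      (.seq (.rset 11 (.mul (.var 14) (.sub (rampE (.sub (.sub (.arr 1 (.add (.var 11) (.var 0)))
        (.var 12)) (.act (.var 10)))) (.var 13))))
        (loop 6 0 (.store 3 (.var 6) (.add (.arr 3 (.var 6))
          (.mul (.var 11) (.arr 1 (.add (.var 11) (.var 6)))))))))

/-- Array 2 keeps the iterate while array 3 collects the sum, so that all samples of a batch act at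
the same point, which depends on earlier batches only. -/
theorem gradP_halts (hd : 0 < d) {R σ η : ℝ} {T B N n : ℕ} {s : State}
    (h : Ctx R σ η T B N n ω s) {w : Vec d} (hw : s.read d 2 0 = w)
    {i : ℕ} (hi : s.nvar 8 * B + s.nvar 7 = i) (hin : i < n) :
    Halts g ω gradP s (400 * d) fun s' => s'.read d 3 0 = s.read d 3 0 +
      (η * coeff g σ (s.rvar 12) (s.rvar 13) w (ω i)) • (ω i).1 := by
  refine (Halts.seq' (Halts.nset (Q := fun s' => s' = s.setN 11 (i * (d + 1)))
    (by simp [h.batch, hi, h.dim])) fun s₁ _ h₁ => Halts.seq' (dotP_halts hd ?_) fun s₂ hF₂ h₂ =>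
      Halts.seq' (Halts.rset (Q := fun s' => s' = s₂.setR 11
        (η * coeff g σ (s.rvar 12) (s.rvar 13) w (ω i))) ?_) fun s₃ _ h₃ =>
      (Halts.storeLoop (by decide) (N := d) ?_ 0
        (fun j => s.arr 3 j + (η * coeff g σ (s.rvar 12) (s.rvar 13) w (ω i)) *
          s.arr 1 (i * (d + 1) + j)) ?_ ?_).mono le_rfl ?_).mono ?_ fun _ _ h => h
  · simp [h₁, h.dim]
  · subst h₁
    have hC : Ctx R σ η T B N n ω s₂ :=
      (h.congr (s' := s.setN 11 (i * (d + 1))) (by simp) (by simp) (by simp) (by simp)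
        rfl rfl rfl rfl).frame (by constructor <;> simp [dotP]) hF₂
    have e10 : s₂.rvar 10 = inner ℝ w (ω i).1 := by
      rw [h₂]; simp [hw, h.feature i hin]
    have e12 : s₂.rvar 12 = s.rvar 12 := hF₂.r 12 (by simp [dotP])
    have e13 : s₂.rvar 13 = s.rvar 13 := hF₂.r 13 (by simp [dotP])
    have e11 : s₂.nvar 11 = i * (d + 1) := by rw [hF₂.n 11 (by simp [dotP])]; simp
    simp [rampE_eval, coeff, hC.rate, hC.scale, e10, e12, e13, e11, hC.dim, hC.label i hin]
  · rw [h₃]; simp only [setR_nvar]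
    rw [hF₂.n 0 (by simp [dotP]), h₁]; simp [h.dim]
  · intro m s' hm hi' hn
    simp [hi']
  · intro m s' hm hi' hn hr ha h3
    subst h₁ h₃
    have e3 : s₂.arr 3 = s.arr 3 := hF₂.a 3 (by simp [dotP])
    have e1 : s₂.arr 1 = s.arr 1 := hF₂.a 1 (by simp [dotP])
    have e11 : s₂.nvar 11 = i * (d + 1) := by rw [hF₂.n 11 (by simp [dotP])]; simp
    have h3' : s'.arr 3 m = s.arr 3 m := by simpa [e3] using h3
    have n11 : s'.nvar 11 = i * (d + 1) := by rw [hn 11 (by decide)]; simpa using e11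
    simp [hi', h3', hr, ha, e1, n11]
  · intro s' _ hs'
    refine State.read_eq fun j => ?_
    rw [hs'.1 j j.2, ← h.feature i hin]
    simp [State.read]
  · simp [RExp.cost, NExp.cost, rampE]; omega

/-- One step of the descent. -/
def stepP : Prog :=
  .seq (loop 6 0 (.store 3 (.var 6) (.arr 2 (.var 6))))
    (.seq (loop 7 4 gradP)
      (.seq (.rset 10 (.cast (.const 0)))
        (.seq (loop 6 0 (.rset 10 (.add (.var 10) (.mul (.arr 3 (.var 6)) (.arr 3 (.var 6))))))
          (.seq (.rset 11 (.div (.var 2) (.div (.add (.add (.var 2) (.sqrt (.var 10)))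
            (.sqrt (.mul (.sub (.var 2) (.sqrt (.var 10))) (.sub (.var 2) (.sqrt (.var 10))))))
            (.cast (.const 2)))))
            (loop 6 0 (.store 2 (.var 6) (.mul (.var 11) (.arr 3 (.var 6)))))))))

theorem stepP_safe : Safe stepP := by constructor <;> simp [stepP, gradP, dotP]

theorem max_eq_abs (a b : ℝ) : (a + b + |a - b|) / 2 = max a b := by
  rcases le_total a b with h | h
  · rw [abs_of_nonpos (by linarith), max_eq_right h]; ring
  · rw [abs_of_nonneg (by linarith), max_eq_left h]; ring

theorem stepP_halts (hd : 0 < d) {R σ η b c : ℝ} {T B N n t : ℕ} (hB : 0 < B) {s : State}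
    (h : Ctx R σ η T B N n ω s) (hb : s.rvar 12 = b) (hc : s.rvar 13 = c) (ht : s.nvar 8 = t)
    (hw : s.read d 2 0 = descent g R σ η b c B ω t) (hn : (t + 1) * B ≤ n) :
    Halts g ω stepP s (1000 * d * B) fun s' =>
      s'.read d 2 0 = descent g R σ η b c B ω (t + 1) := by
  set w := descent g R σ η b c B ω t with hwdef
  -- `u m` is the content of array 3 after `m` samples of the batch, and `u B` is the point to be
  -- projected.
  set u : ℕ → Vec d := fun m => w + ∑ j ∈ Finset.range m,
      (η * coeff g σ b c w (ω (t * B + j))) • (ω (t * B + j)).1 with hu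
  refine Halts.mono (Halts.seq' ((Halts.storeLoop (by decide) h.dim 0 (fun j => s.arr 2 j)
      (by intro m s' _ hi _; simp [hi])
      (by intro m s' _ hi _ _ ha _; simp [hi, ha])).mono (c' := d * 11 + 5)
        (Q' := fun s' => s'.read d 3 0 = u 0) (by simp [RExp.cost, NExp.cost]) ?_) fun s₁ hF₁ h₁ =>
    Halts.seq' (Halts.loop (N := B) (c := 400 * d) (by simp [gradP, dotP]) (by simp [gradP, dotP])
      (by decide) (fun m s' => s'.read d 3 0 = u m) ?_ (by simpa using h₁) ?_) fun s₂ hF₂ h₂ =>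
    Halts.seq' (Halts.rset (Q := fun s' => s' = s₂.setR 10 0) (by simp)) fun s₃ _ h₃ =>
    Halts.seq' (Halts.sumLoop (by decide) (N := d) ?_ (fun j => s₂.arr 3 j * s₂.arr 3 j)
      (by intro m s' _ hi _ _ ha; simp [hi, ha, h₃])) fun s₄ hF₄ h₄ =>
    Halts.seq' (Halts.rset (Q := fun s' => s' = s₄.setR 11 (R / max R ‖u B‖)) ?_) fun s₅ _ h₅ =>
    (Halts.storeLoop (by decide) (N := d) ?_ 0 (fun j => (R / max R ‖u B‖) * s₂.arr 3 j) ?_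
      ?_).mono le_rfl ?_) ?_ fun _ _ h => h
  · intro s' _ hs'
    refine State.read_eq fun j => ?_
    rw [hs'.1 j j.2]
    simp [hu, ← hw, State.read]
  · rw [hF₁.n 4 (by simp), h.batch]
  · intro m s' hm hm' hF hs'
    have hF' : Frame stepP s s' :=
      (hF₁.mono (by simp [stepP]) (by simp) (by simp [stepP]) (by simp)).trans
        (hF.mono (by simp [stepP]; tauto) (by simp [stepP]; tauto) (by simp [stepP]; tauto)
          (by simp [stepP]))
    have e8 : s'.nvar 8 = t := by rw [hF'.n 8 (by simp [stepP, gradP, dotP]), ht]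
    have e2 : s'.arr 2 = s.arr 2 := by
      rw [hF.a 2 (by simp [gradP, dotP]), hF₁.a 2 (by simp)]
    have e12 : s'.rvar 12 = b := by rw [hF'.r 12 (by simp [stepP, gradP, dotP]), hb]
    have e13 : s'.rvar 13 = c := by rw [hF'.r 13 (by simp [stepP, gradP, dotP]), hc]
    refine (gradP_halts hd (h.frame stepP_safe hF') (w := w) (i := t * B + m)
      (by rw [State.read_congr e2, hw]) (by rw [e8, hm']) (by nlinarith)).mono le_rfl ?_
    intro s'' _ hs''
    simp only [State.read_setN]
    rw [hs'', hs', e12, e13]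
    simp [hu, Finset.sum_range_succ, add_assoc]
  · simp only [h₃, setR_nvar]
    rw [hF₂.n 0 (by simp [gradP, dotP]), hF₁.n 0 (by simp), h.dim]
  · have e2 : s₄.rvar 2 = R := by
      rw [hF₄.r 2 (by simp), h₃]
      simp [hF₂.r 2 (by simp [gradP, dotP]), hF₁.r 2 (by simp), h.radius]
    have e10 : Real.sqrt (s₄.rvar 10) = ‖u B‖ := by
      rw [h₄, h₃]
      simp only [setR_rvar, if_true, zero_add]
      rw [inner_eq_sum_range (v := u B) (w := u B), real_inner_self_eq_norm_mul_norm,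
        Real.sqrt_mul_self (norm_nonneg _)] <;>
      · intro j; rw [← h₂]; simp [State.read]
    simp [e2, e10, sqrt_mul_self_abs, max_eq_abs]
  · rw [h₅]; simp only [setR_nvar]
    rw [hF₄.n 0 (by simp), h₃]; simp only [setR_nvar]
    rw [hF₂.n 0 (by simp [gradP, dotP]), hF₁.n 0 (by simp), h.dim]
  · intro m s' _ hi _; simp [hi]
  · intro m s' _ hi _ hr ha _
    have e3 : s₄.arr 3 = s₂.arr 3 := by rw [hF₄.a 3 (by simp), h₃]; simp
    simp [hi, hr, ha 3 (by decide), h₅, e3]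
  · intro s' _ hs'
    refine State.read_eq fun j => ?_
    rw [hs'.1 j j.2]
    simp only [descent, clip]
    change _ = ((R / max R ‖u B‖) • u B) j
    rw [← h₂]
    simp [State.read]
  · simp [RExp.cost, NExp.cost]
    nlinarith [Nat.mul_le_mul hd hB, Nat.mul_le_mul hd (le_refl B), Nat.mul_le_mul (le_refl d) hB]

end
end

end ObliviousGLM

/-! ### Running the descent and listing its iterates -/

namespace ObliviousGLM

noncomputable section

section
variable {d : ℕ} {g : ℝ → ℝ} {ω : ℕ → Sample d}

/-- Run the descent for offset `rvar 12` and tilt `rvar 13`, applying `post` to every iterate. -/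
def runP (post : Prog) : Prog :=
  .seq (loop 6 0 (.store 2 (.var 6) (.cast (.const 0)))) (loop 8 2 (.seq post stepP))

/-- One proof serves all uses: `post` is the work done on every iterate (append, take a minimum,
compare), and `I t` is what holds after `t` iterates. `hI` asks that `I` ignore the scratch memory
that the descent overwrites. -/
theorem runP_halts (hd : 0 < d) {R σ η b c : ℝ} {T B N n : ℕ} (hB : 0 < B) {s : State}
    (h : Ctx R σ η T B N n ω s) (hb : s.rvar 12 = b) (hc : s.rvar 13 = c) (hn : T * B ≤ n)
    {post : Prog} (hs : Safe post) (h8 : ¬ post.NWrites 8) (h12 : ¬ post.RWrites 12)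
    (h13 : ¬ post.RWrites 13) (h2 : ¬ post.AWrites 2) {m : ℕ} (I : ℕ → State → Prop)
    (hI : ∀ t s s', (∀ j, j ≠ 6 → j ≠ 7 → j ≠ 8 → j ≠ 11 → s'.nvar j = s.nvar j) →
      (∀ j, j ≠ 10 → j ≠ 11 → s'.rvar j = s.rvar j) →
      (∀ a, a ≠ 2 → a ≠ 3 → s'.arr a = s.arr a) → I t s → I t s')
    (h0 : I 0 s)
    (hpost : ∀ t s', t < T → Frame (runP post) s s' → Ctx R σ η T B N n ω s' →
      s'.rvar 12 = b → s'.rvar 13 = c → s'.read d 2 0 = descent g R σ η b c B ω t → I t s' →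
      Halts g ω post s' m (I (t + 1))) :
    Halts g ω (runP post) s (100 * d + T * (m + 1000 * d * B + 7)) (I T) := by
  refine Halts.mono (Halts.seq' ((Halts.storeLoop (by decide) h.dim 0 (fun _ => 0)
      (by intro m s' _ hi _; simp [hi]) (by intro m s' _ hi _ _ ha _; simp)).mono (c' := d * 11 + 5)
        (Q' := fun s' => s'.read d 2 0 = 0 ∧ I 0 s')
        (by simp [RExp.cost, NExp.cost]) ?_) fun s₁ hF₁ h₁ =>
    Halts.loop (N := T) (c := m + 1000 * d * B) (by simp [h8, stepP, gradP, dotP])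
      (by simp [hs.n2, stepP, gradP, dotP])
      (by decide) (fun t s' => s'.read d 2 0 = descent g R σ η b c B ω t ∧ I t s') ?_ ?_ ?_) ?_
        fun _ _ h => h.2
  · intro s' hF hs'
    refine ⟨State.read_eq fun j => by simpa using hs'.1 j j.2, hI 0 s s' (fun j h6 _ _ _ => ?_)
      (fun j _ _ => ?_) (fun a ha _ => ?_) h0⟩
    · exact hF.n j (by simpa using h6)
    · exact hF.r j (by simp)
    · exact hF.a a (by simpa using ha)
  · rw [hF₁.n 2 (by simp), h.steps]
  · refine ⟨by simpa [descent] using h₁.1, hI 0 s₁ _ (fun j _ _ h _ => by simp [h])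
      (fun _ _ _ => rfl) (fun _ _ _ => rfl) h₁.2⟩
  · intro t s' ht h8' hF hs'
    have hF' : Frame (runP post) s s' :=
      (hF₁.mono (by simp [runP]) (by simp) (by simp [runP]) (by simp)).trans
        (hF.mono (by simp [runP]; tauto) (by simp [runP]) (by simp [runP]; tauto)
          (by simp [runP]))
    have hsafe : Safe (runP post) := by
      constructor <;> simp [runP, hs.n0, hs.n2, hs.n4, hs.n5, hs.r2, hs.r9, hs.r14, hs.a1,
        stepP_safe.n0, stepP_safe.n2, stepP_safe.n4, stepP_safe.n5, stepP_safe.r2, stepP_safe.r9,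
        stepP_safe.r14, stepP_safe.a1]
    have hC := h.frame hsafe hF'
    have e12 : s'.rvar 12 = b := by
      rw [hF'.r 12 (by simp [runP, h12, stepP, gradP, dotP]), hb]
    have e13 : s'.rvar 13 = c := by
      rw [hF'.r 13 (by simp [runP, h13, stepP, gradP, dotP]), hc]
    refine Halts.seq' (hpost t s' ht hF' hC e12 e13 hs'.1 hs'.2) fun s₂ hF₂ h₂ =>
      (stepP_halts hd hB (hC.frame hs hF₂) ((hF₂.r _ h12).trans e12) ((hF₂.r _ h13).trans e13)
        ((hF₂.n _ h8).trans h8') ((State.read_congr (hF₂.a _ h2)).trans hs'.1)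
        (le_trans (Nat.mul_le_mul_right B ht) hn)).mono le_rfl fun s₃ hF₃ h₃ => ?_
    refine ⟨by simpa using h₃, hI _ s₂ _ (fun j h6 h7 h8 h11 => ?_) (fun j h10 h11 => ?_)
      (fun a ha2 ha3 => ?_) h₂⟩
    · simp only [setN_nvar, h8, if_false]
      exact hF₃.n j (by simp [stepP, gradP, dotP, h6, h7, h11])
    · exact hF₃.r j (by simp [stepP, gradP, dotP, h10, h11])
    · exact hF₃.a a (by simp [stepP, gradP, dotP, ha2, ha3])
  · omega

/-- Append array `2` to the output list. -/
def appendP : Prog :=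
  .seq (loop 6 0 (.store 0 (.add (.mul (.var 12) (.var 0)) (.var 6)) (.arr 2 (.var 6))))
    (.nset 12 (.add (.var 12) (.const 1)))

/-- The tilt of number `k` out of `M`. -/
def tilt (M k : ℕ) : ℝ := ((2 * k + 1 : ℕ) : ℝ) / M - 1

/-- The tilt of number `nvar 9` out of `nvar m`. -/
def tiltE (m : ℕ) : RExp :=
  .sub (.div (.cast (.add (.mul (.const 2) (.var 9)) (.const 1))) (.cast (.var m)))
    (.cast (.const 1))

/-- List all iterates for all tilts. -/
def listP : Prog :=
  .seq (.nset 12 (.const 0)) (.seq (.rset 12 (.cast (.const 0)))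
    (.seq (loop 9 1 (.seq (.rset 13 (tiltE 1)) (runP appendP))) (.nset 0 (.var 12))))

/-- The output list contains the vectors `W m` for `m < n`. -/
def Listed (d : ℕ) (W : ℕ → Vec d) (n : ℕ) (s : State) : Prop :=
  s.nvar 12 = n ∧ ∀ m < n, s.read d 0 (m * d) = W m

theorem appendP_halts (hd : 0 < d) {s : State} (h0 : s.nvar 0 = d) {W : ℕ → Vec d} {n : ℕ}
    (hW : Listed d W n s) (hw : s.read d 2 0 = W n) :
    Halts g ω appendP s (100 * d) (Listed d W (n + 1)) := by
  refine Halts.mono (Halts.seq' (Halts.storeLoop (by decide) h0 (n * d) (s.arr 2) ?_ ?_)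
    fun s₁ hF₁ h₁ => Halts.nset ?_) ?_ fun _ _ h => h
  · intro m s' _ hi hn
    simp [hi, hn, hW.1, h0]
  · intro m s' _ hi _ _ ha _
    simp [hi, ha]
  · have e : s₁.nvar 12 = n := (hF₁.n 12 (by simp)).trans hW.1
    refine ⟨by simp [e], fun m hm => ?_⟩
    rw [State.read_setN]
    rcases Nat.lt_succ_iff_lt_or_eq.mp hm with hm | rfl
    · rw [← hW.2 m hm]
      refine State.read_eq fun j => ?_
      rw [h₁.2]
      · simp [State.read]
      · left
        have := j.2
        nlinarith
    · rw [← hw]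
      refine State.read_eq fun j => ?_
      rw [h₁.1 j j.2]
      simp [State.read]
  · simp [NExp.cost, RExp.cost]; omega

theorem listP_halts (hd : 0 < d) {R σ η : ℝ} {K T B N n : ℕ} (hB : 0 < B) (hT : 0 < T) {s : State}
    (h : Ctx R σ η T B N n ω s) (hK : s.nvar 1 = K) (hn : T * B ≤ n) :
    Halts g ω listP s (4000 * d * (K + 1) * T * B) fun s' => s'.nvar 0 = K * T ∧
      ∀ k < K, ∀ t < T, s'.read d 0 ((k * T + t) * d) =
        descent g R σ η 0 (tilt K k) B ω t := by
  -- Output vector `k T + t` is iterate `t` for tilt `k`; quotient and remainder modulo `T` recover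
  -- the pair.
  set W : ℕ → Vec d := fun m => descent g R σ η 0 (tilt K (m / T)) B ω (m % T) with hWdef
  have hWk : ∀ k t, t < T → W (k * T + t) = descent g R σ η 0 (tilt K k) B ω t := by
    intro k t ht
    simp only [hWdef]
    rw [Nat.mul_comm k T, Nat.mul_add_div hT, Nat.div_eq_of_lt ht, Nat.mul_add_mod,
      Nat.mod_eq_of_lt ht, add_zero]
  have hsafe : Safe appendP := by constructor <;> simp [appendP]
  refine Halts.mono (Halts.seq' (Halts.nset (Q := fun s' => s' = s.setN 12 0) (by simp))
    fun s₁ _ h₁ => Halts.seq' (Halts.rset (Q := fun s' => s' = s₁.setR 12 0) (by simp))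
    fun s₂ _ h₂ => Halts.seq' (Halts.loop (N := K) (c := 20 + (100 * d +
      T * (100 * d + 1000 * d * B + 7))) ?_ ?_ (by decide)
      (fun k => Listed d W (k * T)) ?_ ?_ ?_) fun s₃ hF₃ h₃ => Halts.nset ?_) ?_ fun _ _ h => h
  · simp [runP, appendP, stepP, gradP, dotP]
  · simp [runP, appendP, stepP, gradP, dotP]
  · simp [h₂, h₁, hK]
  · simp [h₂, h₁, Listed]
  · intro k s' hk h9 hF hs'
    have hC : Ctx R σ η T B N n ω s' :=
      Ctx.frame (h.congr (s' := s₂) (by simp [h₂, h₁]) (by simp [h₂, h₁]) (by simp [h₂, h₁])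
        (by simp [h₂, h₁]) (by simp [h₂, h₁]) (by simp [h₂, h₁]) (by simp [h₂, h₁])
        (by simp [h₂, h₁]))
        (by constructor <;> simp [runP, appendP, stepP, gradP, dotP]) hF
    have e1 : s'.nvar 1 = K := by
      rw [hF.n 1 (by simp [runP, appendP, stepP, gradP, dotP])]; simp [h₂, h₁, hK]
    have e12 : s'.rvar 12 = 0 := by
      rw [hF.r 12 (by simp [runP, appendP, stepP, gradP, dotP])]; simp [h₂]
    refine Halts.mono (Halts.seq' (Halts.rset (Q := fun s'' => s'' = s'.setR 13 (tilt K k))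
      (by simp [tiltE, tilt, h9, e1])) fun s₄ _ h₄ =>
      runP_halts hd hB (b := 0) (c := tilt K k) (m := 100 * d)
        (hC.congr (s' := s₄) (by simp [h₄]) (by simp [h₄]) (by simp [h₄])
        (by simp [h₄]) (by simp [h₄]) (by simp [h₄]) (by simp [h₄])
        (by simp [h₄])) (by simp [h₄, e12]) (by simp [h₄]) hn hsafe (by simp [appendP])
        (by simp [appendP]) (by simp [appendP]) (by simp [appendP])
        (fun t => Listed d W (k * T + t)) ?_ ?_ ?_) ?_ ?_
    · intro t s s' hN _ hA hs
      refine ⟨(hN 12 (by decide) (by decide) (by decide) (by decide)).trans hs.1, fun m hm => ?_⟩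
      rw [State.read_congr (hA 0 (by decide) (by decide)), hs.2 m hm]
    · simpa [h₄, Listed] using hs'
    · intro t s' ht _ hC' _ _ hw hL
      refine appendP_halts hd hC'.dim hL (hw.trans (hWk k t ht).symm)
    · simp [tiltE, RExp.cost, NExp.cost]
    · intro s'' _ hs''
      simpa [Listed, add_mul] using hs''
  · refine ⟨by simp [h₃.1], fun k hk t ht => ?_⟩
    rw [State.read_setN, h₃.2 _ (by nlinarith), hWk k t ht]
  · simp only [NExp.cost, RExp.cost]
    -- All costs are compared with this one product, so that only linear inequalities remain for
    -- `omega`.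
    obtain ⟨a, ha⟩ : ∃ a, a = d * T * B := ⟨_, rfl⟩
    have a1 : 1 ≤ a := by rw [ha]; exact Nat.mul_pos (Nat.mul_pos hd hT) hB
    have a2 : T ≤ a := by
      rw [ha, mul_comm d, mul_assoc]; exact Nat.le_mul_of_pos_right _ (Nat.mul_pos hd hB)
    have a3 : d * T ≤ a := by rw [ha]; exact Nat.le_mul_of_pos_right _ hB
    have a4 : d ≤ a := by rw [ha, mul_assoc]; exact Nat.le_mul_of_pos_right _ (Nat.mul_pos hT hB)
    have : 20 + (100 * d + T * (100 * d + 1000 * d * B + 7)) + 7 ≤ 2000 * a := by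
      have : T * (100 * d + 1000 * d * B + 7) = 100 * (d * T) + 1000 * a + 7 * T := by
        rw [ha]; ring
      omega
    have := Nat.mul_le_mul_left K this
    have : 4000 * d * (K + 1) * T * B = K * (2000 * a) + (2000 * (K * a) + 4000 * a) := by
      rw [ha]; ring
    omega

end
end

end ObliviousGLM

/-! ### Empirical losses and the scan over offsets -/

namespace ObliviousGLM

noncomputable section

section
variable {d : ℕ} {g : ℝ → ℝ} {ω : ℕ → Sample d}

/-- The residual of the current sample. -/
def residualE : RExp :=
  .sub (.sub (.arr 1 (.add (.var 11) (.var 0))) (.var 12)) (.act (.var 10))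

/-- Add the losses of sample `N + j` to the real variables `15` and `16`. -/
def evalBody : Prog :=
  .seq (.nset 11 (.mul (.add (.var 5) (.var 7)) (.add (.var 0) (.const 1))))
    (.seq dotP
      (.seq (.rset 15 (.add (.var 15) (.sub (huberE residualE)
          (huberE (.sub (.arr 1 (.add (.var 11) (.var 0))) (.act (.cast (.const 0))))))))
        (.rset 16 (.add (.var 16)
          (.sub (.add (.var 12) (.act (.var 10))) (.act (.cast (.const 0))))))))

/-- Evaluate the loss sums of array `2` with offset `rvar 12`. -/
def evalP : Prog :=
  .seq (.rset 15 (.cast (.const 0))) (.seq (.rset 16 (.cast (.const 0))) (loop 7 5 evalBody))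

theorem evalBody_halts (hd : 0 < d) {R σ η b : ℝ} {T B N n i : ℕ} {s : State}
    (h : Ctx R σ η T B N n ω s) (hb : s.rvar 12 = b) {w : Vec d} (hw : s.read d 2 0 = w)
    (hi : N + s.nvar 7 = i) (hin : i < n) :
    Halts g ω evalBody s (900 * d) fun s' =>
      s'.rvar 15 = s.rvar 15 + huberGap g σ b w (ω i) ∧
      s'.rvar 16 = s.rvar 16 + shift g b w (ω i) := by
  refine Halts.mono (Halts.seq' (Halts.nset (Q := fun s' => s' = s.setN 11 (i * (d + 1)))
    (by simp [h.half, hi, h.dim])) fun s₁ _ h₁ => Halts.seq' (dotP_halts hd ?_) fun s₂ hF₂ h₂ =>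
      Halts.seq' (Halts.rset (Q := fun s' => s' = s₂.setR 15
        (s.rvar 15 + huberGap g σ b w (ω i))) ?_) fun s₃ _ h₃ =>
      Halts.rset ?_) ?_ fun _ _ h => h
  · simp [h₁, h.dim]
  · subst h₁
    have hC : Ctx R σ η T B N n ω s₂ :=
      (h.congr (s' := s.setN 11 (i * (d + 1))) (by simp) (by simp) (by simp) (by simp)
        rfl rfl rfl rfl).frame (by constructor <;> simp [dotP]) hF₂
    have e10 : s₂.rvar 10 = inner ℝ w (ω i).1 := by
      rw [h₂]; simp [hw, h.feature i hin]
    have e12 : s₂.rvar 12 = b := by rw [hF₂.r 12 (by simp [dotP])]; simp [hb]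
    have e15 : s₂.rvar 15 = s.rvar 15 := hF₂.r 15 (by simp [dotP])
    have e11 : s₂.nvar 11 = i * (d + 1) := by rw [hF₂.n 11 (by simp [dotP])]; simp
    simp [huberE_eval, residualE, huberGap, hC.scale, e10, e12, e15, e11, hC.dim,
      hC.label i hin]
  · subst h₁ h₃
    have e10 : s₂.rvar 10 = inner ℝ w (ω i).1 := by
      rw [h₂]; simp [hw, h.feature i hin]
    have e12 : s₂.rvar 12 = b := by rw [hF₂.r 12 (by simp [dotP])]; simp [hb]
    have e16 : s₂.rvar 16 = s.rvar 16 := hF₂.r 16 (by simp [dotP])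
    simp [shift, e10, e12, e16]
  · simp [RExp.cost, NExp.cost, huberE, rampE, residualE]; omega

/-- The empirical loss is affine in the tilt. Keeping the Huber sum and the shift sum apart lets one
pass serve every tilt; `bestP` needs two. -/
theorem evalP_halts (hd : 0 < d) {R σ η b : ℝ} {T B N n : ℕ} (hN : 0 < N) {s : State}
    (h : Ctx R σ η T B N n ω s) (hb : s.rvar 12 = b) (hn : 2 * N ≤ n) {w : Vec d}
    (hw : s.read d 2 0 = w) :
    Halts g ω evalP s (1000 * d * N) fun s' =>
      s'.rvar 15 = huberSum g σ b N ω w ∧ s'.rvar 16 = shiftSum g b N ω w := by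
  refine Halts.mono (Halts.seq' (Halts.rset (Q := fun s' => s' = s.setR 15 0) (by simp))
    fun s₁ _ h₁ => Halts.seq' (Halts.rset (Q := fun s' => s' = s₁.setR 16 0) (by simp))
    fun s₂ _ h₂ => Halts.loop (N := N) (c := 900 * d) (by simp [evalBody, dotP])
      (by simp [evalBody, dotP]) (by decide)
      (fun m s' => s'.rvar 15 = ∑ j ∈ Finset.range m, huberGap g σ b w (ω (N + j)) ∧
        s'.rvar 16 = ∑ j ∈ Finset.range m, shift g b w (ω (N + j))) ?_ ?_ ?_) ?_ fun _ _ h => h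
  · simp [h₂, h₁, h.half]
  · simp [h₂, h₁]
  · intro k s' hk h7 hF hs'
    have hC : Ctx R σ η T B N n ω s' :=
      Ctx.frame (h.congr (s' := s₂) (by simp [h₂, h₁]) (by simp [h₂, h₁]) (by simp [h₂, h₁])
        (by simp [h₂, h₁]) (by simp [h₂, h₁]) (by simp [h₂, h₁]) (by simp [h₂, h₁])
        (by simp [h₂, h₁]))
        (by constructor <;> simp [evalBody, dotP]) hF
    refine (evalBody_halts hd (w := w) hC (b := b) ?_ ?_ rfl (by omega)).mono le_rfl
      fun s'' _ hs'' => ?_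
    · rw [hF.r 12 (by simp [evalBody, dotP])]; simp [h₂, h₁, hb]
    · rw [← hw, State.read_congr (hF.a 2 (by simp [evalBody, dotP]))]; simp [h₂, h₁]
    · simp only [setN_rvar, Finset.sum_range_succ]
      rw [hs''.1, hs''.2, hs'.1, hs'.2, h7]
      exact ⟨rfl, rfl⟩
  · simp [RExp.cost, NExp.cost]
    nlinarith [Nat.mul_le_mul hd hN, Nat.mul_le_mul hd (le_refl N)]

/-- The empirical loss for tilt `e` that results from the current loss sums. -/
def lossE (e : RExp) : RExp :=
  .div (.add (.var 15) (.mul e (.var 16))) (.cast (.var 5))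

/-- Lower real variable `17` to the current loss. -/
def minP : Prog :=
  .seq evalP (.ite (.rlt (lossE (.var 13)) (.var 17)) (.rset 17 (lossE (.var 13))) .skip)

/-- Offset number `i` out of `T`, between `-8 R` and `8 R`. -/
def offset (R : ℝ) (T i : ℕ) : ℝ := 16 * R * (i / T) - 8 * R

/-- The program for `offset`. -/
def offsetE : RExp :=
  .sub (.mul (.mul (.cast (.const 16)) (.var 2)) (.div (.cast (.var 10)) (.cast (.var 2))))
    (.mul (.cast (.const 8)) (.var 2))

/-- Compute the least loss of all iterates for all offsets, for tilt `rvar 13`. -/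
def scanP : Prog :=
  .seq (.rset 17 (.mul (.cast (.const 1000)) (.var 2)))
    (loop 10 2 (.seq (.rset 12 offsetE) (runP minP)))

/-- The empirical loss of iterate `t` for the offset `b` and tilt `c`, evaluated at the
tilt `c'`. -/
def iterLoss (g : ℝ → ℝ) (R σ η : ℝ) (B N : ℕ) (ω : ℕ → Sample d) (b c c' : ℝ) (t : ℕ) : ℝ :=
  empLoss g σ b c' N ω (descent g R σ η b c B ω t)

/-- The losses that `scanP` has seen before iterate `t` for offset `i`. -/
def seenLosses (g : ℝ → ℝ) (R σ η : ℝ) (T B N : ℕ) (ω : ℕ → Sample d) (c : ℝ) (i t : ℕ) : Set ℝ :=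
  insert (1000 * R) {v | ∃ i' t', (i' < i ∧ t' < T ∨ i' = i ∧ t' < t) ∧
    v = iterLoss g R σ η B N ω (offset R T i') c c t'}

theorem seenLosses_succ (R σ η : ℝ) (T B N : ℕ) (c : ℝ) (i t : ℕ) :
    seenLosses g R σ η T B N ω c i (t + 1) =
      insert (iterLoss g R σ η B N ω (offset R T i) c c t) (seenLosses g R σ η T B N ω c i t) := by
  unfold seenLosses
  rw [Set.insert_comm]
  congr 1
  ext v
  simp only [Set.mem_ofPred_eq, Set.mem_insert_iff]
  constructor
  · rintro ⟨i', t', h | ⟨rfl, h⟩, rfl⟩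
    · exact Or.inr ⟨i', t', Or.inl h, rfl⟩
    · rcases Nat.lt_succ_iff_lt_or_eq.mp h with h | rfl
      · exact Or.inr ⟨i', t', Or.inr ⟨rfl, h⟩, rfl⟩
      · exact Or.inl rfl
  · rintro (rfl | ⟨i', t', h | ⟨rfl, h⟩, rfl⟩)
    · exact ⟨i, t, Or.inr ⟨rfl, t.lt_succ_self⟩, rfl⟩
    · exact ⟨i', t', Or.inl h, rfl⟩
    · exact ⟨i', t', Or.inr ⟨rfl, h.trans t.lt_succ_self⟩, rfl⟩

/-- This hands the invariant of the loop over iterates to the loop over offsets. -/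
theorem seenLosses_next (R σ η : ℝ) (T B N : ℕ) (c : ℝ) (i : ℕ) :
    seenLosses g R σ η T B N ω c (i + 1) 0 = seenLosses g R σ η T B N ω c i T := by
  unfold seenLosses
  congr 1
  ext v
  simp only [Set.mem_ofPred_eq, not_lt_zero, and_false, or_false]
  refine exists_congr fun i' => exists_congr fun t' => and_congr_left fun _ => ?_
  omega

/-- The result of `scanP`. -/
def scanMin (g : ℝ → ℝ) (R σ η : ℝ) (T B N : ℕ) (ω : ℕ → Sample d) (c : ℝ) : ℝ :=
  sInf (seenLosses g R σ η T B N ω c T 0)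

/-- The set is finite, and nonempty because of the initial value `1000 * R`, so the infimum is
attained. -/
theorem isLeast_scanMin (R σ η : ℝ) (T B N : ℕ) (c : ℝ) :
    IsLeast (seenLosses g R σ η T B N ω c T 0) (scanMin g R σ η T B N ω c) := by
  have hf : (seenLosses g R σ η T B N ω c T 0).Finite := by
    refine Set.Finite.insert _ (Set.Finite.subset
      (((Finset.range T) ×ˢ (Finset.range T)).image fun p : ℕ × ℕ =>
        iterLoss g R σ η B N ω (offset R T p.1) c c p.2).finite_toSet ?_)
    rintro v ⟨i', t', h, rfl⟩
    simp only [not_lt_zero, and_false, or_false] at h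
    simp only [Finset.coe_image, Set.mem_image, Finset.mem_coe, Finset.mem_product,
      Finset.mem_range]
    exact ⟨(i', t'), h, rfl⟩
  exact ⟨Set.Nonempty.csInf_mem ⟨_, Set.mem_insert _ _⟩ hf, fun v hv => csInf_le hf.bddBelow hv⟩

theorem minP_safe : Safe minP := by constructor <;> simp [minP, evalP, evalBody, dotP]

theorem minP_halts (hd : 0 < d) {R σ η b c : ℝ} {T B N n : ℕ} (hN : 0 < N) {s : State}
    (h : Ctx R σ η T B N n ω s) (hb : s.rvar 12 = b) (hc : s.rvar 13 = c) (hn : 2 * N ≤ n)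
    {w : Vec d} (hw : s.read d 2 0 = w) {S : Set ℝ} (hS : IsLeast S (s.rvar 17)) :
    Halts g ω minP s (1100 * d * N) fun s' =>
      IsLeast (insert (empLoss g σ b c N ω w) S) (s'.rvar 17) := by
  refine Halts.mono (Halts.seq' (evalP_halts hd hN h hb hn hw) fun s₁ hF₁ h₁ =>
    Halts.ite (c := 20) (fun hlt => (Halts.rset ?_).mono (by decide) fun _ _ h => h)
      fun hlt => (Halts.skip ?_).mono (by decide) fun _ _ h => h) ?_ fun _ _ h => h
  all_goals try
    have e : (lossE (.var 13)).eval g s₁ = empLoss g σ b c N ω w := by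
      simp [lossE, empLoss, h₁.1, h₁.2, hF₁.n 5 (by simp [evalP, evalBody, dotP]), h.half,
        hF₁.r 13 (by simp [evalP, evalBody, dotP]), hc]
    have e17 : s₁.rvar 17 = s.rvar 17 := hF₁.r 17 (by simp [evalP, evalBody, dotP])
    have hlt' := hlt
    simp only [BExp.Holds, e] at hlt'
  · simp only [setR_rvar, if_true, e]
    have := hS.insert (empLoss g σ b c N ω w)
    rwa [min_eq_left] at this
    simp only [RExp.eval, e17] at hlt'
    exact hlt'.le
  · rw [e17]
    have := hS.insert (empLoss g σ b c N ω w)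
    rwa [min_eq_right] at this
    simp only [RExp.eval, e17] at hlt'
    exact not_lt.mp hlt'
  · simp [RExp.cost, NExp.cost, BExp.cost, lossE]
    nlinarith [Nat.mul_le_mul hd hN, Nat.mul_le_mul hd (le_refl N)]

/-- Each of the `T` offsets costs `T` steps of `B` samples and `T` loss evaluations of `N` samples;
as `N = T * B`, the evaluations dominate. -/
theorem scanP_halts (hd : 0 < d) {R σ η c : ℝ} {T B N n : ℕ} (hB : 0 < B) (hT : 0 < T)
    (hN : N = T * B) {s : State} (h : Ctx R σ η T B N n ω s) (hc : s.rvar 13 = c)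
    (hn : 2 * N ≤ n) :
    Halts g ω scanP s (5000 * d * T * T * N) fun s' =>
      s'.rvar 17 = scanMin g R σ η T B N ω c := by
  have hNpos : 0 < N := hN ▸ Nat.mul_pos hT hB
  refine Halts.mono (Halts.seq' (Halts.rset (Q := fun s' => s' = s.setR 17 (1000 * R))
    (by simp [h.radius])) fun s₁ _ h₁ => Halts.loop (N := T) (c := 40 + (100 * d +
      T * (1100 * d * N + 1000 * d * B + 7))) ?_ ?_ (by decide)
      (fun i s' => IsLeast (seenLosses g R σ η T B N ω c i 0) (s'.rvar 17)) ?_ ?_ ?_) ?_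
      fun s' _ hs' => (hs'.csInf_eq).symm
  · simp [runP, minP, evalP, evalBody, stepP, gradP, dotP]
  · simp [runP, minP, evalP, evalBody, stepP, gradP, dotP]
  · simp [h₁, h.steps]
  · have e : (s₁.setN 10 0).rvar 17 = 1000 * R := by simp [h₁]
    have e' : seenLosses g R σ η T B N ω c 0 0 = {1000 * R} := by simp [seenLosses]
    change IsLeast _ ((s₁.setN 10 0).rvar 17)
    rw [e, e']
    exact isLeast_singleton
  · intro i s' hi h10 hF hs'
    have hC : Ctx R σ η T B N n ω s' :=
      Ctx.frame (h.congr (s' := s₁) (by simp [h₁]) (by simp [h₁]) (by simp [h₁])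
        (by simp [h₁]) (by simp [h₁]) (by simp [h₁]) (by simp [h₁]) (by simp [h₁]))
        (by constructor <;> simp [runP, minP, evalP, evalBody, stepP, gradP, dotP]) hF
    have e13 : s'.rvar 13 = c := by
      rw [hF.r 13 (by simp [runP, minP, evalP, evalBody, stepP, gradP, dotP])]; simp [h₁, hc]
    refine Halts.mono (Halts.seq' (Halts.rset (Q := fun s'' => s'' = s'.setR 12 (offset R T i))
      (by simp [offsetE, offset, h10, hC.radius, hC.steps])) fun s₂ _ h₂ =>
      runP_halts hd hB (b := offset R T i) (c := c) (m := 1100 * d * N)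
        (hC.congr (s' := s₂) (by simp [h₂]) (by simp [h₂]) (by simp [h₂])
        (by simp [h₂]) (by simp [h₂]) (by simp [h₂]) (by simp [h₂])
        (by simp [h₂])) (by simp [h₂]) (by simp [h₂, e13]) (by omega) minP_safe
        (by simp [minP, evalP, evalBody, dotP]) (by simp [minP, evalP, evalBody, dotP])
        (by simp [minP, evalP, evalBody, dotP]) (by simp [minP, evalP, evalBody, dotP])
        (fun t s' => IsLeast (seenLosses g R σ η T B N ω c i t) (s'.rvar 17)) ?_ ?_ ?_) ?_ ?_
    · intro t s s' _ hR _ hs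
      rwa [hR 17 (by decide) (by decide)]
    · simpa [h₂] using hs'
    · intro t s' ht _ hC' hb' hc' hw hL
      rw [seenLosses_succ]
      exact minP_halts hd hNpos hC' hb' hc' hn hw hL
    · simp [offsetE, RExp.cost, NExp.cost]
    · intro s'' _ hs''
      rw [seenLosses_next]
      simpa using hs''
  · simp only [NExp.cost, RExp.cost]
    obtain ⟨a, ha⟩ : ∃ a, a = d * T * N := ⟨_, rfl⟩
    have a1 : 1 ≤ a := by rw [ha]; exact Nat.mul_pos (Nat.mul_pos hd hT) hNpos
    have a2 : T ≤ a := by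
      rw [ha, mul_comm d, mul_assoc]; exact Nat.le_mul_of_pos_right _ (Nat.mul_pos hd hNpos)
    have a4 : d ≤ a := by
      rw [ha, mul_assoc]; exact Nat.le_mul_of_pos_right _ (Nat.mul_pos hT hNpos)
    have a5 : d * T * B ≤ a := by
      rw [ha]; exact Nat.mul_le_mul_left _ (hN ▸ Nat.le_mul_of_pos_left _ hT)
    have : 40 + (100 * d + T * (1100 * d * N + 1000 * d * B + 7)) + 7 ≤ 3000 * a := by
      have : T * (1100 * d * N + 1000 * d * B + 7) = 1100 * a + 1000 * (d * T * B) + 7 * T := by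
        rw [ha]; ring
      omega
    have := Nat.mul_le_mul_left T this
    have : 5000 * d * T * T * N = T * (3000 * a) + 2000 * (T * a) := by
      rw [ha]; ring
    have : 1 ≤ T * a := Nat.mul_pos hT a1
    omega

end
end

end ObliviousGLM

/-! ### Choosing the candidate of least score -/

namespace ObliviousGLM

noncomputable section

section
variable {d : ℕ} {g : ℝ → ℝ} {ω : ℕ → Sample d}

/-- The excess of the iterate `t` for tilt number `k` over the best loss found by `scanP`, at the
tilts increased and decreased by `κ`. -/
def score (g : ℝ → ℝ) (R σ η κ : ℝ) (T B N : ℕ) (ω : ℕ → Sample d) (k t : ℕ) : ℝ :=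
  max (iterLoss g R σ η B N ω 0 (tilt T k) (tilt T k + κ) t -
      scanMin g R σ η T B N ω (tilt T k + κ))
    (iterLoss g R σ η B N ω 0 (tilt T k) (tilt T k - κ) t -
      scanMin g R σ η T B N ω (tilt T k - κ))

/-- The candidates before iterate `t` for tilt number `k`, with their scores. -/
def candidates (g : ℝ → ℝ) (R σ η κ : ℝ) (T B N : ℕ) (ω : ℕ → Sample d) (k t : ℕ) :
    Set (Vec d × ℝ) :=
  {p | ∃ k' t', (k' < k ∧ t' < T ∨ k' = k ∧ t' < t) ∧
    p = (descent g R σ η 0 (tilt T k') B ω t', score g R σ η κ T B N ω k' t')}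

theorem candidates_succ (R σ η κ : ℝ) (T B N k t : ℕ) :
    candidates g R σ η κ T B N ω k (t + 1) =
      insert (descent g R σ η 0 (tilt T k) B ω t, score g R σ η κ T B N ω k t)
        (candidates g R σ η κ T B N ω k t) := by
  unfold candidates
  ext v
  simp only [Set.mem_ofPred_eq, Set.mem_insert_iff]
  constructor
  · rintro ⟨i', t', h | ⟨rfl, h⟩, rfl⟩
    · exact Or.inr ⟨i', t', Or.inl h, rfl⟩
    · rcases Nat.lt_succ_iff_lt_or_eq.mp h with h | rfl
      · exact Or.inr ⟨i', t', Or.inr ⟨rfl, h⟩, rfl⟩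
      · exact Or.inl rfl
  · rintro (rfl | ⟨i', t', h | ⟨rfl, h⟩, rfl⟩)
    · exact ⟨k, t, Or.inr ⟨rfl, t.lt_succ_self⟩, rfl⟩
    · exact ⟨i', t', Or.inl h, rfl⟩
    · exact ⟨i', t', Or.inr ⟨rfl, h.trans t.lt_succ_self⟩, rfl⟩

theorem candidates_next (R σ η κ : ℝ) (T B N k : ℕ) :
    candidates g R σ η κ T B N ω (k + 1) 0 = candidates g R σ η κ T B N ω k T := by
  unfold candidates
  ext v
  simp only [Set.mem_ofPred_eq, not_lt_zero, and_false, or_false]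
  refine exists_congr fun i' => exists_congr fun t' => and_congr_left fun _ => ?_
  omega

/-- The pair `(v, β)` has the least score among `S`, unless all scores are at least `β₀ = β`. -/
def Best (S : Set (Vec d × ℝ)) (β₀ : ℝ) (v : Vec d) (β : ℝ) : Prop :=
  β ≤ β₀ ∧ (β = β₀ ∨ (v, β) ∈ S) ∧ ∀ p ∈ S, β ≤ p.2

theorem Best.replace {S : Set (Vec d × ℝ)} {β₀ β γ : ℝ} {v w : Vec d} (h : Best S β₀ v β)
    (hγ : γ < β) : Best (insert (w, γ) S) β₀ w γ := by
  refine ⟨hγ.le.trans h.1, Or.inr (Set.mem_insert _ _), ?_⟩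
  rintro p (rfl | hp)
  · exact le_rfl
  · exact hγ.le.trans (h.2.2 p hp)

theorem Best.keep {S : Set (Vec d × ℝ)} {β₀ β γ : ℝ} {v w : Vec d} (h : Best S β₀ v β)
    (hγ : β ≤ γ) : Best (insert (w, γ) S) β₀ v β := by
  refine ⟨h.1, h.2.1.imp_right (Set.mem_insert_of_mem _), ?_⟩
  rintro p (rfl | hp)
  · exact hγ
  · exact h.2.2 p hp

/-- Compare array `2` with the best candidate so far, which is in array `0`. -/
def bestP : Prog :=
  .seq evalP
    (.seq (.rset 20 (.sub (lossE (.add (.var 21) (.var 22))) (.var 18)))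
      (.seq (.rset 11 (.sub (lossE (.sub (.var 21) (.var 22))) (.var 17)))
        (.seq (.ite (.rlt (.var 20) (.var 11)) (.rset 20 (.var 11)) .skip)
          (.ite (.rlt (.var 20) (.var 19))
            (.seq (.rset 19 (.var 20)) (loop 6 0 (.store 0 (.var 6) (.arr 2 (.var 6))))) .skip))))

theorem bestP_safe : Safe bestP := by constructor <;> simp [bestP, evalP, evalBody, dotP]

theorem bestP_halts (hd : 0 < d) {R σ η c κ M M' β₀ : ℝ} {T B N n : ℕ} (hN : 0 < N) {s : State}
    (h : Ctx R σ η T B N n ω s) (hb : s.rvar 12 = 0) (hc : s.rvar 21 = c) (hκ : s.rvar 22 = κ)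
    (hM : s.rvar 18 = M) (hM' : s.rvar 17 = M') (hn : 2 * N ≤ n)
    {w : Vec d} (hw : s.read d 2 0 = w) {S : Set (Vec d × ℝ)}
    (hS : Best S β₀ (s.read d 0 0) (s.rvar 19)) :
    Halts g ω bestP s (1300 * d * N) fun s' =>
      Best (insert (w, max (empLoss g σ 0 (c + κ) N ω w - M) (empLoss g σ 0 (c - κ) N ω w - M')) S)
        β₀ (s'.read d 0 0) (s'.rvar 19) := by
  set x := empLoss g σ 0 (c + κ) N ω w - M with hx
  set y := empLoss g σ 0 (c - κ) N ω w - M' with hy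
  refine Halts.mono (Halts.seq' (evalP_halts hd hN h hb hn hw) fun s₁ hF₁ h₁ =>
    Halts.seq' (Halts.rset (Q := fun s' => s' = s₁.setR 20 x) ?_) fun s₂ _ h₂ =>
    Halts.seq' (Halts.rset (Q := fun s' => s' = s₂.setR 11 y) ?_) fun s₃ _ h₃ =>
    Halts.seq' (c₁ := BExp.cost (.rlt (.var 20) (.var 11)) + 2) (Q := fun s' => s' = s₃.setR 20 (max x y))
      (Halts.ite (c := 2) (fun hlt => Halts.rset ?_)
        fun hlt => (Halts.skip ?_).mono (by decide) fun _ _ h => h) fun s₄ _ h₄ =>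
    Halts.ite (c := 2 + (d * 11 + 5)) (fun hlt => Halts.seq'
      (Halts.rset (Q := fun s' => s' = s₄.setR 19 (max x y)) ?_) fun s₅ _ h₅ =>
        (Halts.storeLoop (by decide) (N := d) ?_ 0 (s₁.arr 2) ?_ ?_).mono le_rfl ?_)
      fun hlt => (Halts.skip ?_).mono (by omega) fun _ _ h => h) ?_ fun _ _ h => h
  all_goals try
    have e5 : s₁.nvar 5 = N := (hF₁.n 5 (by simp [evalP, evalBody, dotP])).trans h.half
    have e0 : s₁.nvar 0 = d := (hF₁.n 0 (by simp [evalP, evalBody, dotP])).trans h.dim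
    have e17 : s₁.rvar 17 = M' := (hF₁.r 17 (by simp [evalP, evalBody, dotP])).trans hM'
    have e18 : s₁.rvar 18 = M := (hF₁.r 18 (by simp [evalP, evalBody, dotP])).trans hM
    have e21 : s₁.rvar 21 = c := (hF₁.r 21 (by simp [evalP, evalBody, dotP])).trans hc
    have e22 : s₁.rvar 22 = κ := (hF₁.r 22 (by simp [evalP, evalBody, dotP])).trans hκ
    have e19 : s₁.rvar 19 = s.rvar 19 := hF₁.r 19 (by simp [evalP, evalBody, dotP])
    have a0 : s₁.arr 0 = s.arr 0 := hF₁.a 0 (by simp [evalP, evalBody, dotP])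
    have a2 : s₁.arr 2 = s.arr 2 := hF₁.a 2 (by simp [evalP, evalBody, dotP])
  · simp [lossE, h₁.1, h₁.2, e5, e21, e22, e18, hx, empLoss]
  · simp [h₂, lossE, h₁.1, h₁.2, e5, e21, e22, e17, hy, empLoss]
  · have : x < y := by simpa [h₃, h₂] using hlt
    simp [h₃, max_eq_right this.le]
  · have : y ≤ x := by simpa [h₃, h₂] using hlt
    ext <;> simp only [h₃, h₂, setR_rvar, setR_nvar, setR_arr, setR_drawn, max_eq_left this]
    split_ifs <;> first | rfl | omega
  · simp [h₄]
  · simp [h₅, h₄, h₃, h₂, e0]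
  · intro m s' _ hi _; simp [hi]
  · intro m s' _ hi _ _ ha _
    simp [hi, ha, h₅, h₄, h₃, h₂]
  · intro s' hF hs'
    have hlt' : max x y < s.rvar 19 := by simpa [h₄, h₃, h₂, e19] using hlt
    have e1 : s'.rvar 19 = max x y := by rw [hF.r 19 (by simp)]; simp [h₅]
    have e2 : s'.read d 0 0 = w := by
      rw [← hw]
      exact State.read_eq fun j => by rw [hs'.1 j j.2, a2]; simp [State.read]
    rw [e1, e2]
    exact hS.replace hlt'
  · have e1 : s₄.rvar 19 = s.rvar 19 := by simp [h₄, h₃, h₂, e19]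
    have e20 : s₄.rvar 20 = max x y := by simp [h₄]
    have hlt' : s.rvar 19 ≤ max x y := by
      rw [← e1, ← e20]
      exact not_lt.mp hlt
    have e2 : s₄.read d 0 0 = s.read d 0 0 := State.read_congr (by simp [h₄, h₃, h₂, a0])
    rw [e1, e2]
    exact hS.keep hlt'
  · simp [RExp.cost, NExp.cost, BExp.cost, lossE]
    nlinarith [Nat.mul_le_mul hd hN, Nat.mul_le_mul hd (le_refl N), Nat.mul_le_mul (le_refl d) hN]

/-- Select the candidate with the least score. -/
def selectP : Prog :=
  .seq (.rset 19 (.mul (.cast (.const 1000)) (.var 2)))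
    (.seq (loop 9 2
      (.seq (.rset 21 (tiltE 2)) (.seq (.rset 13 (.add (.var 21) (.var 22)))
        (.seq scanP (.seq (.rset 18 (.var 17)) (.seq (.rset 13 (.sub (.var 21) (.var 22)))
          (.seq scanP (.seq (.rset 12 (.cast (.const 0))) (.seq (.rset 13 (.var 21))
            (runP bestP))))))))))
      (.nset 0 (.const 1)))

theorem scanP_safe : Safe scanP := by
  constructor <;> simp [scanP, runP, minP, evalP, evalBody, stepP, gradP, dotP]

/-- For each tilt the two scans, at the raised and at the lowered tilt, dominate the cost; the loop
over `T` tilts supplies the third factor `T`. -/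
theorem selectP_halts (hd : 0 < d) {R σ η κ : ℝ} {T B N n : ℕ} (hB : 0 < B) (hT : 0 < T)
    (hN : N = T * B) {s : State} (h : Ctx R σ η T B N n ω s) (hκ : s.rvar 22 = κ)
    (hn : 2 * N ≤ n) :
    Halts g ω selectP s (20000 * d * T * T * T * N) fun s' => s'.nvar 0 = 1 ∧
      ∃ β, Best (candidates g R σ η κ T B N ω T 0) (1000 * R) (s'.read d 0 0) β := by
  have hNpos : 0 < N := hN ▸ Nat.mul_pos hT hB
  refine Halts.mono (Halts.seq' (Halts.rset (Q := fun s' => s' = s.setR 19 (1000 * R))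
    (by simp [h.radius])) fun s₁ _ h₁ => Halts.seq' (Halts.loop (N := T)
      (c := 100 + 10000 * d * T * T * N + (100 * d + T * (1300 * d * N + 1000 * d * B + 7)))
      ?_ ?_ (by decide)
      (fun k s' => Best (candidates g R σ η κ T B N ω k 0) (1000 * R) (s'.read d 0 0) (s'.rvar 19))
      ?_ ?_ ?_)
      fun s₂ _ hs₂ => Halts.nset ⟨by simp, s₂.rvar 19, hs₂⟩) ?_ fun _ _ h => h
  · simp [runP, scanP, minP, bestP, evalP, evalBody, stepP, gradP, dotP]
  · simp [runP, scanP, minP, bestP, evalP, evalBody, stepP, gradP, dotP]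
  · simp [h₁, h.steps]
  · have e : (s₁.setN 9 0).rvar 19 = 1000 * R := by simp [h₁]
    change Best _ _ _ ((s₁.setN 9 0).rvar 19)
    rw [e]
    exact ⟨le_rfl, Or.inl rfl, by simp [candidates]⟩
  · intro k s' hk h9 hF hs'
    have hC : Ctx R σ η T B N n ω s' :=
      Ctx.frame (h.congr (s' := s₁) (by simp [h₁]) (by simp [h₁]) (by simp [h₁])
        (by simp [h₁]) (by simp [h₁]) (by simp [h₁]) (by simp [h₁]) (by simp [h₁]))
        (by constructor <;>
          simp [runP, scanP, minP, bestP, evalP, evalBody, stepP, gradP, dotP]) hF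
    have e22 : s'.rvar 22 = κ := by
      rw [hF.r 22 (by simp [runP, scanP, minP, bestP, evalP, evalBody, stepP, gradP, dotP])]
      simp [h₁, hκ]
    refine Halts.mono (Halts.seq' (Halts.rset (Q := fun s'' => s'' = s'.setR 21 (tilt T k))
        (by simp [tiltE, tilt, h9, hC.steps])) fun s₂ hF₂ h₂ =>
      Halts.seq' (Halts.rset (Q := fun s'' => s'' = s₂.setR 13 (tilt T k + κ))
        (by simp [h₂, e22])) fun s₃ hF₃ h₃ =>
      Halts.seq' (scanP_halts hd hB hT hN (c := tilt T k + κ) ((hC.frame (by constructor <;> simp)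
        hF₂).frame (by constructor <;> simp) hF₃) (by simp [h₃]) hn) fun s₄ hF₄ h₄ =>
      Halts.seq' (Halts.rset (Q := fun s'' => s'' = s₄.setR 18 (s₄.rvar 17)) (by simp))
        fun s₅ hF₅ h₅ =>
      Halts.seq' (Halts.rset (Q := fun s'' => s'' = s₅.setR 13 (tilt T k - κ)) ?_) fun s₆ hF₆ h₆ =>
      Halts.seq' (scanP_halts hd hB hT hN (c := tilt T k - κ) (((((hC.frame (by constructor <;> simp)
        hF₂).frame (by constructor <;> simp) hF₃).frame scanP_safe hF₄).frame
        (by constructor <;> simp) hF₅).frame (by constructor <;> simp) hF₆) (by simp [h₆]) hn)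
        fun s₇ hF₇ h₇ =>
      Halts.seq' (Halts.rset (Q := fun s'' => s'' = s₇.setR 12 0) (by simp)) fun s₈ hF₈ h₈ =>
      Halts.seq' (Halts.rset (Q := fun s'' => s'' = s₈.setR 13 (tilt T k)) ?_) fun s₉ hF₉ h₉ =>
      runP_halts hd hB (b := 0) (c := tilt T k) (m := 1300 * d * N)
        ((((((((hC.frame (by constructor <;> simp)
        hF₂).frame (by constructor <;> simp) hF₃).frame scanP_safe hF₄).frame
        (by constructor <;> simp) hF₅).frame (by constructor <;> simp) hF₆).frame scanP_safe
        hF₇).frame (by constructor <;> simp) hF₈).frame (by constructor <;> simp) hF₉)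
        (by simp [h₉, h₈]) (by simp [h₉]) (by omega) bestP_safe
        (by simp [bestP, evalP, evalBody, dotP]) (by simp [bestP, evalP, evalBody, dotP])
        (by simp [bestP, evalP, evalBody, dotP]) (by simp [bestP, evalP, evalBody, dotP])
        (fun t s' => Best (candidates g R σ η κ T B N ω k t) (1000 * R) (s'.read d 0 0)
          (s'.rvar 19)) ?_ ?_ ?_) ?_ ?_
    all_goals try
      have w21 : s₄.rvar 21 = tilt T k := by
        rw [hF₄.r 21 (by simp [scanP, runP, minP, evalP, evalBody, stepP, gradP, dotP])]
        simp [h₃, h₂]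
      have w22 : s₄.rvar 22 = κ := by
        rw [hF₄.r 22 (by simp [scanP, runP, minP, evalP, evalBody, stepP, gradP, dotP])]
        simp [h₃, h₂, e22]
    all_goals try
      have x21 : s₇.rvar 21 = tilt T k := by
        rw [hF₇.r 21 (by simp [scanP, runP, minP, evalP, evalBody, stepP, gradP, dotP])]
        simp [h₆, h₅, w21]
      have x22 : s₇.rvar 22 = κ := by
        rw [hF₇.r 22 (by simp [scanP, runP, minP, evalP, evalBody, stepP, gradP, dotP])]
        simp [h₆, h₅, w22]
      have x18 : s₇.rvar 18 = scanMin g R σ η T B N ω (tilt T k + κ) := by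
        rw [hF₇.r 18 (by simp [scanP, runP, minP, evalP, evalBody, stepP, gradP, dotP])]
        simp [h₆, h₅, h₄]
    · simp [h₅, w21, w22]
    · simp [h₈, x21]
    · intro t s s' _ hR hA hs
      rwa [hR 19 (by decide) (by decide), State.read_congr (hA 0 (by decide) (by decide))]
    · have r19 : s₉.rvar 19 = s'.rvar 19 := by
        simp only [h₉, h₈, setR_rvar]
        norm_num
        rw [hF₇.r 19 (by simp [scanP, runP, minP, evalP, evalBody, stepP, gradP, dotP])]
        simp only [h₆, h₅, setR_rvar]
        norm_num
        rw [hF₄.r 19 (by simp [scanP, runP, minP, evalP, evalBody, stepP, gradP, dotP])]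
        simp [h₃, h₂]
      have r0 : s₉.read d 0 0 = s'.read d 0 0 := by
        refine State.read_congr ?_
        simp only [h₉, h₈, setR_arr]
        rw [hF₇.a 0 (by simp [scanP, runP, minP, evalP, evalBody, stepP, gradP, dotP])]
        simp only [h₆, h₅, setR_arr]
        rw [hF₄.a 0 (by simp [scanP, runP, minP, evalP, evalBody, stepP, gradP, dotP])]
        simp [h₃, h₂]
      rw [r19, r0]
      exact hs'
    · intro t s₁₀ ht hF₁₀ hC' hb' hc' hw hL
      rw [candidates_succ]
      refine bestP_halts hd hNpos hC' hb' ?_ ?_ ?_ ?_ hn hw hL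
      · rw [hF₁₀.r 21 (by simp [runP, bestP, evalP, evalBody, stepP, gradP, dotP])]
        simp [h₉, h₈, x21]
      · rw [hF₁₀.r 22 (by simp [runP, bestP, evalP, evalBody, stepP, gradP, dotP])]
        simp [h₉, h₈, x22]
      · rw [hF₁₀.r 18 (by simp [runP, bestP, evalP, evalBody, stepP, gradP, dotP])]
        simp [h₉, h₈, x18]
      · rw [hF₁₀.r 17 (by simp [runP, bestP, evalP, evalBody, stepP, gradP, dotP])]
        simp [h₉, h₈, h₇]
    · simp only [tiltE, RExp.cost, NExp.cost]
      have : 10000 * d * T * T * N = 2 * (5000 * d * T * T * N) := by ring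
      omega
    · intro s'' _ hs''
      rw [candidates_next]
      exact hs''
  · simp only [NExp.cost, RExp.cost]
    obtain ⟨a, ha⟩ : ∃ a, a = d * T * T * N := ⟨_, rfl⟩
    have hTT : 0 < T * T := Nat.mul_pos hT hT
    have a1 : 1 ≤ a := by rw [ha]; exact Nat.mul_pos (Nat.mul_pos (Nat.mul_pos hd hT) hT) hNpos
    have a2 : T ≤ a := by
      have : a = T * (d * T * N) := by rw [ha]; ring
      rw [this]; exact Nat.le_mul_of_pos_right _ (Nat.mul_pos (Nat.mul_pos hd hT) hNpos)
    have a4 : d ≤ a := by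
      have : a = d * (T * T * N) := by rw [ha]; ring
      rw [this]; exact Nat.le_mul_of_pos_right _ (Nat.mul_pos hTT hNpos)
    have a6 : d * T * N ≤ a := by
      have : a = d * T * N * T := by rw [ha]; ring
      rw [this]; exact Nat.le_mul_of_pos_right _ hT
    have a5 : d * T * B ≤ a := by
      refine le_trans ?_ a6
      exact Nat.mul_le_mul_left _ (hN ▸ Nat.le_mul_of_pos_left _ hT)
    have : 100 + 10000 * d * T * T * N + (100 * d + T * (1300 * d * N + 1000 * d * B + 7)) + 7
        ≤ 13000 * a := by
      have e1 : T * (1300 * d * N + 1000 * d * B + 7) =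
        1300 * (d * T * N) + 1000 * (d * T * B) + 7 * T := by ring
      have e2 : 10000 * d * T * T * N = 10000 * a := by rw [ha]; ring
      omega
    have := Nat.mul_le_mul_left T this
    have : 20000 * d * T * T * T * N = T * (13000 * a) + 7000 * (T * a) := by
      rw [ha]; ring
    have : 1 ≤ T * a := Nat.mul_pos hT a1
    omega

end
end

end ObliviousGLM

/-! ### Computing the parameters, and the complete programs -/

namespace ObliviousGLM

noncomputable section

section
variable {d : ℕ} {g : ℝ → ℝ} {ω : ℕ → Sample d}

/-- Set real variable `6` to `gam`. -/
def gamP : Prog :=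
  .seq (.rset 6 (.div (.cast (.const 1)) (.cast (.const 2))))
    (.ite (.rlt (.cast (.const 0)) (.var 3))
      (.ite (.rlt (.div (.var 0) (.mul (.cast (.const 4)) (.var 3))) (.var 6))
        (.rset 6 (.div (.var 0) (.mul (.cast (.const 4)) (.var 3)))) .skip) .skip)

theorem gamP_halts {Δ σ : ℝ} (hσ : 0 ≤ σ) {s : State} (h0 : s.rvar 0 = Δ) (h3 : s.rvar 3 = σ) :
    Halts g ω gamP s 40 fun s' => s'.rvar 6 = gam Δ σ := by
  refine Halts.mono (Halts.seq' (Halts.rset (Q := fun s' => s' = s.setR 6 (1 / 2))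
    (by simp)) fun s₁ _ h₁ => Halts.ite (c := BExp.cost (.rlt (.div (.var 0)
      (.mul (.cast (.const 4)) (.var 3))) (.var 6)) + 7)
      (fun hb => Halts.ite (fun hb' => Halts.rset ?_)
        fun hb' => (Halts.skip ?_).mono (by decide) fun _ _ h => h)
      fun hb => (Halts.skip ?_).mono (by decide) fun _ _ h => h)
    (by simp [RExp.cost, NExp.cost, BExp.cost]) fun _ _ h => h
  · have hb : 0 < σ := by simpa [h₁, h3] using hb
    have hb' : Δ / (4 * σ) < 1 / 2 := by simpa [h₁, h3, h0] using hb'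
    simp only [h₁, setR_rvar, RExp.eval, NExp.eval]
    norm_num [h0, h3]
    rw [gam, if_neg hb.ne', min_eq_left hb'.le]
  · have hb : 0 < σ := by simpa [h₁, h3] using hb
    have hb' : 1 / 2 ≤ Δ / (4 * σ) := by simpa [h₁, h3, h0] using hb'
    rw [gam, if_neg hb.ne', min_eq_right hb']
    simp [h₁]
  · have hb : σ ≤ 0 := by simpa [h₁, h3] using hb
    rw [gam, if_pos (le_antisymm hb hσ)]
    simp [h₁]

/-- Increase integer variable `1` to `⌈64 R / rvar 7⌉`. -/
def ceilP : Prog :=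
  .while (.rlt (.cast (.var 1)) (.div (.mul (.cast (.const 64)) (.var 2)) (.var 7)))
    (.nset 1 (.add (.var 1) (.const 1)))

/-- A real cannot be rounded in one operation, so the ceiling is found by counting up. The cost is
linear in the number of tilts, which the main loops exceed anyway. -/
theorem ceilP_halts {R ρ : ℝ} {s : State} (h1 : s.nvar 1 = 0) (h2 : s.rvar 2 = R)
    (h7 : s.rvar 7 = ρ) :
    Halts g ω ceilP s (13 * ⌈64 * R / ρ⌉₊ + 9) fun s' => s'.nvar 1 = ⌈64 * R / ρ⌉₊ := by
  refine Halts.mono (Halts.while (c := 4) (fun m s' => s'.nvar 1 + m = ⌈64 * R / ρ⌉₊ ∧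
    s'.rvar 2 = R ∧ s'.rvar 7 = ρ) ?_ ?_ _ s ⟨by rw [h1, zero_add], h2, h7⟩) ?_ fun _ _ h => h
  · rintro m s' ⟨hm, h2, h7⟩ hb
    simp only [BExp.Holds, RExp.eval, NExp.eval, h2, h7, not_lt, Nat.cast_ofNat] at hb
    have := Nat.ceil_le.mpr hb
    omega
  · rintro m s' ⟨hm, h2, h7⟩ hb
    simp only [BExp.Holds, RExp.eval, NExp.eval, h2, h7, Nat.cast_ofNat] at hb
    have := Nat.lt_ceil.mpr hb
    refine ⟨by omega, Halts.nset (e := .add (.var 1) (.const 1)) ⟨?_, by simp [h2], by simp [h7]⟩⟩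
    simp; omega
  · simp [RExp.cost, NExp.cost, BExp.cost]; omega

/-- Set integer variable `3` to the binary logarithm of `e`, rounded up. -/
def logP (e : RExp) : Prog :=
  .seq (.rset 8 (.cast (.const 1))) (.while (.rlt (.var 8) e)
    (.seq (.rset 8 (.add (.var 8) (.var 8))) (.nset 3 (.add (.var 3) (.const 1)))))

/-- Real variable 8 runs through the powers of two until it reaches `z`. The hypothesis `he` says
that the bound is not affected by the two variables that the loop changes. -/
theorem logP_halts {e : RExp} {z : ℝ} {s : State} (h3 : s.nvar 3 = 0)
    (he : ∀ s', (∀ j, j ≠ 3 → s'.nvar j = s.nvar j) → (∀ j, j ≠ 8 → s'.rvar j = s.rvar j) →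
      e.eval g s' = z) (hc : e.cost ≤ 10) :
    Halts g ω (logP e) s (20 * Nat.clog 2 ⌈z⌉₊ + 15) fun s' => s'.nvar 3 = Nat.clog 2 ⌈z⌉₊ := by
  refine Halts.mono (Halts.seq' (Halts.rset (Q := fun s' => s' = s.setR 8 1) (by simp))
    fun s₁ _ h₁ => Halts.while (c := 8) (fun m s' => s'.nvar 3 + m = Nat.clog 2 ⌈z⌉₊ ∧
    s'.rvar 8 = 2 ^ (s'.nvar 3) ∧ (∀ j, j ≠ 3 → s'.nvar j = s.nvar j) ∧
    (∀ j, j ≠ 8 → s'.rvar j = s.rvar j)) ?_ ?_ (Nat.clog 2 ⌈z⌉₊) s₁ ?_) ?_ fun _ _ h => h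
  · rintro m s' ⟨hm, h8, hn, hr⟩ hb
    simp only [BExp.Holds, RExp.eval, he s' hn hr, h8, not_lt] at hb
    have : ⌈z⌉₊ ≤ 2 ^ s'.nvar 3 := Nat.ceil_le.mpr (by exact_mod_cast hb)
    have := Nat.clog_le_of_le_pow this
    omega
  · rintro m s' ⟨hm, h8, hn, hr⟩ hb
    simp only [BExp.Holds, RExp.eval, he s' hn hr, h8] at hb
    have : 2 ^ s'.nvar 3 < ⌈z⌉₊ := Nat.lt_ceil.mpr (by exact_mod_cast hb)
    have := (Nat.lt_clog_iff_pow_lt (by norm_num)).mpr this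
    refine ⟨by omega, (Halts.seq' (Halts.rset (e := .add (.var 8) (.var 8)) (i := 8)
      (Q := fun s'' => s'' = s'.setR 8 (2 ^ (s'.nvar 3 + 1))) (by simp [h8, pow_succ, mul_two]))
      fun s₂ _ h₂ => Halts.nset (e := .add (.var 3) (.const 1)) ⟨?_, ?_, ?_, ?_⟩).mono
        le_rfl fun _ _ h => h⟩
    · simp [h₂]; omega
    · simp [h₂]
    · intro j hj; simp [h₂, hj, hn j hj]
    · intro j hj; simp [h₂, hj, hr j hj]
  · refine ⟨by simp [h₁, h3], by simp [h₁, h3], fun j _ => by simp [h₁], fun j hj => by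
      simp [h₁, hj]⟩
  · simp only [RExp.cost, NExp.cost, BExp.cost]
    have := Nat.mul_le_mul_left (Nat.clog 2 ⌈z⌉₊) (show 1 + e.cost + 1 + 8 ≤ 20 by omega)
    omega

/-- Draw `nvar 12` examples. -/
def drawP : Prog := loop 7 12 (.draw 1 (.mul (.var 7) (.add (.var 0) (.const 1))))

theorem drawP_halts {n : ℕ} {s : State} (h0 : s.nvar 0 = d) (h12 : s.nvar 12 = n)
    (hs : s.drawn = 0) :
    Halts g ω drawP s (n * (d + 13) + 5) fun s' => s'.drawn = n ∧
      ∀ i < n, s'.read d 1 (i * (d + 1)) = (ω i).1 ∧ s'.arr 1 (i * (d + 1) + d) = (ω i).2 := by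
  refine Halts.mono (Halts.loop (c := d + 6) (by simp) (by simp) (by decide) (fun k s' =>
    s'.drawn = k ∧ ∀ i < k, s'.read d 1 (i * (d + 1)) = (ω i).1 ∧
      s'.arr 1 (i * (d + 1) + d) = (ω i).2) h12 (by simpa using hs) ?_) le_rfl fun _ _ h => h
  intro k s' hk h7 hF hs'
  have e0 : s'.nvar 0 = d := (hF.n 0 (by simp)).trans h0
  refine (Halts.draw ?_).mono (by simp [NExp.cost]; omega) fun _ _ h => h
  refine ⟨by simp [State.addSample, hs'.1], fun i hi => ?_⟩
  have hk' : (NExp.mul (.var 7) (.add (.var 0) (.const 1))).eval s' = k * (d + 1) := by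
    simp [h7, e0]
  rw [hk', hs'.1]
  rcases Nat.lt_succ_iff_lt_or_eq.mp hi with hi | rfl
  · have hlt : i * (d + 1) + d < k * (d + 1) := by nlinarith
    refine ⟨?_, ?_⟩
    · rw [← (hs'.2 i hi).1]
      refine State.read_eq fun j => ?_
      have hj := j.2
      have h1 : ¬ k * (d + 1) ≤ i * (d + 1) + j := by omega
      have h2 : i * (d + 1) + (j : ℕ) ≠ k * (d + 1) + d := by omega
      simp [State.addSample, State.read, h1, h2]
    · rw [← (hs'.2 i hi).2]
      have h1 : ¬ k * (d + 1) ≤ i * (d + 1) + d := by omega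
      have h2 : i * (d + 1) + d ≠ k * (d + 1) + d := by omega
      simp only [State.addSample, setN_arr, Function.update_self, h1, false_and, dite_false, h2,
        if_false]
  · refine ⟨State.read_eq fun j => ?_, ?_⟩
    · simp [State.addSample]
    · simp [State.addSample]

/-- The number of tilts for the list of candidates. -/
def sizeK (Δ α R σ : ℝ) : ℕ := ⌈64 * R / (gam Δ σ * α * Δ)⌉₊

/-- The number of steps of the descent. -/
def sizeT (Δ α R σ : ℝ) : ℕ := 10000 * sizeK Δ α R σ * sizeK Δ α R σ

/-- The size of a batch, for the inverse failure probability `z`. -/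
def sizeB (z : ℝ) : ℕ := 12 * Nat.clog 2 ⌈z⌉₊

/-- The number of samples for one run of the descent. -/
def sizeN (Δ α R σ z : ℝ) : ℕ := sizeT Δ α R σ * sizeB z

/-- The step size of the descent, divided by the size of the batch. -/
def sizeη (Δ α R σ z : ℝ) : ℝ := R / (100 * sizeK Δ α R σ) / sizeB z

/-- Compute the parameters and draw `m` times the number of samples for one run. -/
def prepP (e : RExp) (m : ℕ) : Prog :=
  .seq gamP (.seq (.rset 7 (.mul (.mul (.var 6) (.var 1)) (.var 0)))
    (.seq ceilP (.seq (.nset 2 (.mul (.mul (.const 10000) (.var 1)) (.var 1)))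
    (.seq (logP e) (.seq (.nset 4 (.mul (.const 12) (.var 3)))
    (.seq (.nset 5 (.mul (.var 2) (.var 4))) (.seq (.nset 12 (.mul (.const m) (.var 5)))
    (.seq (.rset 9 (.div (.var 0) (.cast (.const 8))))
    (.seq (.rset 14 (.div (.div (.var 2) (.mul (.cast (.const 100)) (.cast (.var 1))))
      (.cast (.var 4))))
    (.seq (.rset 22 (.div (.mul (.var 1) (.var 6)) (.cast (.const 20)))) drawP))))))))))

/-- The inverse failure probability comes as an expression: 1/δ for the list, T/δ for the single
vector, where a union bound has to be paid. `he` lets it read δ and the number of steps, both final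
when the logarithm is computed. -/
theorem prepP_halts {Δ α R σ z : ℝ} (hσ : 0 ≤ σ) {e : RExp} {m : ℕ} {s : State}
    (hd : s.nvar 0 = d) (hn1 : s.nvar 1 = 0) (hn3 : s.nvar 3 = 0) (hdr : s.drawn = 0)
    (hΔ : s.rvar 0 = Δ) (hα : s.rvar 1 = α) (hR : s.rvar 2 = R) (hσ' : s.rvar 3 = σ)
    (he : ∀ s', s'.rvar 4 = s.rvar 4 → s'.nvar 2 = sizeT Δ α R σ → e.eval g s' = z)
    (hc : e.cost ≤ 10) :
    Halts g ω (prepP e m) s (13 * sizeK Δ α R σ + 20 * Nat.clog 2 ⌈z⌉₊ +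
        m * sizeN Δ α R σ z * (d + 13) + 200) fun s' =>
      Ctx R (Δ / 8) (sizeη Δ α R σ z) (sizeT Δ α R σ) (sizeB z) (sizeN Δ α R σ z)
        (m * sizeN Δ α R σ z) ω s' ∧ s'.nvar 1 = sizeK Δ α R σ ∧
      s'.rvar 22 = α * gam Δ σ / 20 ∧ s'.drawn = m * sizeN Δ α R σ z := by
  refine Halts.mono (Halts.seq' (gamP_halts hσ hΔ hσ') fun s₁ hF₁ h₁ =>
    Halts.seq' (Halts.rset (Q := fun s' => s' = s₁.setR 7 (gam Δ σ * α * Δ)) ?_) fun s₂ _ h₂ =>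
    Halts.seq' (ceilP_halts (R := R) (ρ := gam Δ σ * α * Δ) ?_ ?_ (by simp [h₂])) fun s₃ hF₃ h₃ =>
    Halts.seq' (Halts.nset (Q := fun s' => s' = s₃.setN 2 (sizeT Δ α R σ)) ?_) fun s₄ _ h₄ =>
    Halts.seq' (logP_halts (z := z) ?_ ?_ hc) fun s₅ hF₅ h₅ =>
    Halts.seq' (Halts.nset (Q := fun s' => s' = s₅.setN 4 (sizeB z)) (by simp [h₅, sizeB]))
      fun s₆ _ h₆ =>
    Halts.seq' (Halts.nset (Q := fun s' => s' = s₆.setN 5 (sizeN Δ α R σ z)) ?_) fun s₇ _ h₇ =>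
    Halts.seq' (Halts.nset (Q := fun s' => s' = s₇.setN 12 (m * sizeN Δ α R σ z))
      (by simp [h₇])) fun s₈ _ h₈ =>
    Halts.seq' (Halts.rset (Q := fun s' => s' = s₈.setR 9 (Δ / 8)) ?_) fun s₉ _ h₉ =>
    Halts.seq' (Halts.rset (Q := fun s' => s' = s₉.setR 14 (sizeη Δ α R σ z)) ?_) fun s₁₀ _ h₁₀ =>
    Halts.seq' (Halts.rset (Q := fun s' => s' = s₁₀.setR 22 (α * gam Δ σ / 20)) ?_)
      fun s₁₁ _ h₁₁ => (drawP_halts (n := m * sizeN Δ α R σ z) ?_ ?_ ?_).mono le_rfl ?_) ?_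
      fun _ _ h => h
  all_goals try
    have p0 : s₁.rvar 0 = Δ := (hF₁.r 0 (by simp [gamP])).trans hΔ
    have p1 : s₁.rvar 1 = α := (hF₁.r 1 (by simp [gamP])).trans hα
    have p2 : s₁.rvar 2 = R := (hF₁.r 2 (by simp [gamP])).trans hR
    have p4 : s₁.rvar 4 = s.rvar 4 := hF₁.r 4 (by simp [gamP])
    have q0 : s₁.nvar 0 = d := (hF₁.n 0 (by simp [gamP])).trans hd
    have q1 : s₁.nvar 1 = 0 := (hF₁.n 1 (by simp [gamP])).trans hn1
    have q3 : s₁.nvar 3 = 0 := (hF₁.n 3 (by simp [gamP])).trans hn3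
    have qd : s₁.drawn = 0 := (hF₁.drawn (by simp [gamP])).trans hdr
  all_goals try
    have r0 : s₃.rvar 0 = Δ := by rw [hF₃.r 0 (by simp [ceilP])]; simp [h₂, p0]
    have r1 : s₃.rvar 1 = α := by rw [hF₃.r 1 (by simp [ceilP])]; simp [h₂, p1]
    have r2 : s₃.rvar 2 = R := by rw [hF₃.r 2 (by simp [ceilP])]; simp [h₂, p2]
    have r4 : s₃.rvar 4 = s.rvar 4 := by rw [hF₃.r 4 (by simp [ceilP])]; simp [h₂, p4]
    have r6 : s₃.rvar 6 = gam Δ σ := by rw [hF₃.r 6 (by simp [ceilP])]; simp [h₂, h₁]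
    have t0 : s₃.nvar 0 = d := by rw [hF₃.n 0 (by simp [ceilP])]; simp [h₂, q0]
    have t1 : s₃.nvar 1 = sizeK Δ α R σ := h₃
    have t3 : s₃.nvar 3 = 0 := by rw [hF₃.n 3 (by simp [ceilP])]; simp [h₂, q3]
    have td : s₃.drawn = 0 := by rw [hF₃.drawn (by simp [ceilP])]; simp [h₂, qd]
  all_goals try
    have u0 : s₅.rvar 0 = Δ := by rw [hF₅.r 0 (by simp [logP])]; simp [h₄, r0]
    have u1 : s₅.rvar 1 = α := by rw [hF₅.r 1 (by simp [logP])]; simp [h₄, r1]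
    have u2 : s₅.rvar 2 = R := by rw [hF₅.r 2 (by simp [logP])]; simp [h₄, r2]
    have u6 : s₅.rvar 6 = gam Δ σ := by rw [hF₅.r 6 (by simp [logP])]; simp [h₄, r6]
    have v0 : s₅.nvar 0 = d := by rw [hF₅.n 0 (by simp [logP])]; simp [h₄, t0]
    have v1 : s₅.nvar 1 = sizeK Δ α R σ := by rw [hF₅.n 1 (by simp [logP])]; simp [h₄, t1]
    have v2 : s₅.nvar 2 = sizeT Δ α R σ := by rw [hF₅.n 2 (by simp [logP])]; simp [h₄]
    have vd : s₅.drawn = 0 := by rw [hF₅.drawn (by simp [logP])]; simp [h₄, td]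
  · simp [h₁, p1, p0]
  · simp [h₂, q1]
  · simp [h₂, p2]
  · simp [sizeT, t1]
  · simp [h₄, t3]
  · intro s' hn hr
    refine he s' ?_ ?_
    · rw [hr 4 (by decide), h₄]; simp [r4]
    · rw [hn 2 (by decide), h₄]; simp
  · simp [h₆, v2, sizeN]
  · simp [h₈, h₇, h₆, u0]
  · simp [h₉, h₈, h₇, h₆, u2, v1, sizeη]
  · simp [h₁₀, h₉, h₈, h₇, h₆, u1, u6]
  · simp [h₁₁, h₁₀, h₉, h₈, h₇, h₆, v0]
  · simp [h₁₁, h₁₀, h₉, h₈]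
  · simp [h₁₁, h₁₀, h₉, h₈, h₇, h₆, vd]
  · intro s' hF hs'
    have n : ∀ j, j ≠ 7 → s'.nvar j = s₁₁.nvar j := fun j hj => hF.n j (by simp [drawP, hj])
    have r : ∀ j, s'.rvar j = s₁₁.rvar j := fun j => hF.r j (by simp [drawP])
    refine ⟨⟨?_, ?_, ?_, ?_, ?_, ?_, ?_, fun i hi => (hs'.2 i hi).1, fun i hi => (hs'.2 i hi).2⟩,
      ?_, ?_, hs'.1⟩
    · rw [n 0 (by decide)]; simp [h₁₁, h₁₀, h₉, h₈, h₇, h₆, v0]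
    · rw [n 2 (by decide)]; simp [h₁₁, h₁₀, h₉, h₈, h₇, h₆, v2]
    · rw [n 4 (by decide)]; simp [h₁₁, h₁₀, h₉, h₈, h₇, h₆]
    · rw [n 5 (by decide)]; simp [h₁₁, h₁₀, h₉, h₈, h₇]
    · rw [r 2]; simp [h₁₁, h₁₀, h₉, h₈, h₇, h₆, u2]
    · rw [r 9]; simp [h₁₁, h₁₀, h₉]
    · rw [r 14]; simp [h₁₁, h₁₀]
    · rw [n 1 (by decide)]; simp [h₁₁, h₁₀, h₉, h₈, h₇, h₆, v1]
    · rw [r 22]; simp [h₁₁]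
  · simp only [RExp.cost, NExp.cost, sizeK]
    omega

/-- The whole program: return the zero vector if `R ≤ Δ`. -/
def mainP (e : RExp) (m : ℕ) (p : Prog) : Prog :=
  .ite (.rlt (.var 0) (.var 2)) (.seq (prepP e m) p) (.nset 0 (.const 1))

/-- The program that returns a list of candidates. -/
def candidatesP : Prog := mainP (.div (.cast (.const 1)) (.var 4)) 1 listP

/-- The program that returns a single candidate. -/
def singleP : Prog :=
  .seq (.ite (.rlt (.div (.mul (.var 5) (.var 5)) (.cast (.const 16))) (.var 0))
      (.rset 0 (.div (.mul (.var 5) (.var 5)) (.cast (.const 16)))) .skip)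
    (mainP (.div (.cast (.var 2)) (.var 4)) 2 selectP)

theorem output_eq {s : State} (n : ℕ) (hn : s.nvar 0 = n) :
    s.output d = List.ofFn fun i : Fin n => s.read d 0 (i * d) := by
  subst hn; rfl

/-- For `R ≤ Δ` the zero vector is good enough. Stopping here lets the rest assume `Δ < R`, where
rounding up the sizes costs only constant factors. -/
theorem candidatesP_small {Δ α R σ δ : ℝ} (h : R ≤ Δ) :
    ∃ t, Returns candidatesP g [Δ, α, R, σ, δ] ω t 0 [(0 : Vec d)] ∧ t ≤ 5 := by
  obtain ⟨t, s', he, ht, rfl⟩ : Halts g ω candidatesP (State.init d [Δ, α, R, σ, δ])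
      (BExp.cost (.rlt (.var 0) (.var 2)) + 2)
      (fun s' => s' = (State.init d [Δ, α, R, σ, δ]).setN 0 1) :=
    Halts.ite (fun hb => absurd hb (by simpa [State.init] using h)) fun _ => Halts.nset (by simp)
  refine ⟨t, ⟨_, he, rfl, ?_⟩, ht⟩
  rw [output_eq 1 (by simp)]
  simp only [List.ofFn_succ, List.ofFn_zero, List.cons.injEq, and_true]
  exact State.read_eq fun j => by simp [State.init]

theorem candidatesP_large (hd : 0 < d) {Δ α R σ δ : ℝ} (hσ : 0 ≤ σ) (h : Δ < R)
    (hK : 0 < sizeK Δ α R σ) (hB : 0 < sizeB (1 / δ)) :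
    ∃ t L, Returns candidatesP g [Δ, α, R, σ, δ] ω t (sizeN Δ α R σ (1 / δ)) L ∧
      t ≤ 10000 * d * sizeK Δ α R σ * sizeN Δ α R σ (1 / δ) ∧
      L.length = sizeK Δ α R σ * sizeT Δ α R σ ∧
      ∀ k < sizeK Δ α R σ, ∀ t < sizeT Δ α R σ,
        descent g R (Δ / 8) (sizeη Δ α R σ (1 / δ)) 0 (tilt (sizeK Δ α R σ) k) (sizeB (1 / δ)) ω t
          ∈ L := by
  have hT : 0 < sizeT Δ α R σ := by unfold sizeT; positivity
  set K := sizeK Δ α R σ with hKdef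
  set T := sizeT Δ α R σ with hTdef
  set B := sizeB (1 / δ) with hBdef
  set s₀ := State.init d [Δ, α, R, σ, δ] with hs₀
  obtain ⟨t, s', he, ht, h0, hL, hdr⟩ : Halts g ω candidatesP s₀
      (BExp.cost (.rlt (.var 0) (.var 2)) + (13 * K + 20 * Nat.clog 2 ⌈1 / δ⌉₊ +
        1 * sizeN Δ α R σ (1 / δ) * (d + 13) + 200 + 4000 * d * (K + 1) * T * B))
      (fun s' => s'.nvar 0 = K * T ∧ (∀ k < K, ∀ t < T, s'.read d 0 ((k * T + t) * d) =
        descent g R (Δ / 8) (sizeη Δ α R σ (1 / δ)) 0 (tilt K k) B ω t) ∧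
        s'.drawn = sizeN Δ α R σ (1 / δ)) := by
    refine Halts.ite (fun _ => Halts.seq' (prepP_halts (z := 1 / δ) hσ (by simp [s₀, State.init])
      (by simp [s₀, State.init]) (by simp [s₀, State.init]) (by simp [s₀, State.init])
      (by simp [s₀, State.init]) (by simp [s₀, State.init])
      (by simp [s₀, State.init])
      (by simp [s₀, State.init]) ?_ (by decide)) fun s₁ _ h₁ =>
      (listP_halts hd hB hT h₁.1 h₁.2.1 (by simp [sizeN, T, B])).mono le_rfl ?_)
      fun hb => absurd (by simpa [s₀, State.init] using h) hb
    · intro s' h4 _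
      simp [h4, s₀, State.init]
    · intro s' hF hs'
      refine ⟨hs'.1, hs'.2, ?_⟩
      rw [hF.drawn (by simp [listP, runP, appendP, stepP, gradP, dotP]), h₁.2.2.2, one_mul]
  refine ⟨t, _, ⟨s', he, hdr, rfl⟩, ht.trans ?_, ?_, ?_⟩
  · have e1 : BExp.cost (.rlt (.var 0) (.var 2)) = 3 := rfl
    have e2 : Nat.clog 2 ⌈1 / δ⌉₊ ≤ B := by
      rw [hBdef, sizeB]; exact Nat.le_mul_of_pos_left _ (by norm_num)
    have e3 : sizeN Δ α R σ (1 / δ) = T * B := rfl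
    rw [e1, e3]
    obtain ⟨a, ha⟩ : ∃ a, a = d * K * (T * B) := ⟨_, rfl⟩
    have hTB := Nat.mul_pos hT hB
    have a1 : d ≤ a := by
      rw [ha, mul_assoc]; exact Nat.le_mul_of_pos_right _ (Nat.mul_pos hK hTB)
    have a2 : K ≤ a := by
      rw [ha, mul_comm d, mul_assoc]; exact Nat.le_mul_of_pos_right _ (Nat.mul_pos hd hTB)
    have a3 : d * (T * B) ≤ a := by
      rw [ha, mul_right_comm]; exact Nat.le_mul_of_pos_right _ hK
    have a4 : T * B ≤ d * (T * B) := Nat.le_mul_of_pos_left _ hd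
    have a5 : B ≤ T * B := Nat.le_mul_of_pos_left _ hT
    have e4 : 1 * (T * B) * (d + 13) = d * (T * B) + 13 * (T * B) := by ring
    have e5 : 4000 * d * (K + 1) * T * B = 4000 * a + 4000 * (d * (T * B)) := by rw [ha]; ring
    have e6 : 10000 * d * K * (T * B) = 10000 * a := by rw [ha]; ring
    omega
  · rw [output_eq _ h0]; simp
  · intro k hk t ht
    rw [output_eq _ h0, List.mem_ofFn]
    exact ⟨⟨k * T + t, by nlinarith⟩, hL k hk t ht⟩

/-- The initial state of `singleP`, with the accuracy replaced by `fineAcc`. -/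
theorem singleP_fineAcc {Δ α R σ δ τ : ℝ} :
    Halts g ω (.ite (.rlt (.div (.mul (.var 5) (.var 5)) (.cast (.const 16))) (.var 0))
      (.rset 0 (.div (.mul (.var 5) (.var 5)) (.cast (.const 16)))) .skip)
      (State.init d [Δ, α, R, σ, δ, τ]) 20
      (fun s => s = State.init d [fineAcc Δ τ, α, R, σ, δ, τ]) := by
  refine Halts.mono (Halts.ite (c := 10) (fun hb => (Halts.rset ?_).mono (by decide)
    fun _ _ h => h) fun hb => (Halts.skip ?_).mono (by decide) fun _ _ h => h) (by decide)
    fun _ _ h => h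
  · have hb : τ ^ 2 / 16 < Δ := by simpa [State.init, pow_two] using hb
    ext j
    · rfl
    · rcases j with _ | j
      · simpa [State.init, fineAcc, pow_two] using hb.le
      · simp [State.init]
    · rfl
    · rfl
  · have hb : Δ ≤ τ ^ 2 / 16 := by simpa [State.init, pow_two] using hb
    rw [fineAcc, min_eq_left hb]

theorem singleP_small {Δ α R σ δ τ : ℝ} (h : R ≤ fineAcc Δ τ) :
    ∃ t, Returns singleP g [Δ, α, R, σ, δ, τ] ω t 0 [(0 : Vec d)] ∧ t ≤ 25 := by
  obtain ⟨t, s', he, ht, rfl⟩ : Halts g ω singleP (State.init d [Δ, α, R, σ, δ, τ])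
      (20 + (BExp.cost (.rlt (.var 0) (.var 2)) + 2))
      (fun s' => s' = (State.init d [fineAcc Δ τ, α, R, σ, δ, τ]).setN 0 1) := by
    refine Halts.seq' singleP_fineAcc fun s₁ _ h₁ => ?_
    subst h₁
    exact Halts.ite (fun hb => absurd hb (by simpa [State.init] using h))
      fun _ => Halts.nset (by simp)
  refine ⟨t, ⟨_, he, rfl, ?_⟩, ht⟩
  rw [output_eq 1 (by simp)]
  simp only [List.ofFn_succ, List.ofFn_zero, List.cons.injEq, and_true]
  exact State.read_eq fun j => by simp [State.init]

/-- Everything runs at the refined accuracy `Δ`. Twice the samples of one descent are drawn: the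
second half is the holdout sample on which the losses are measured. -/
theorem singleP_large (hd : 0 < d) {Δ Δ₀ α R σ δ τ z : ℝ} (hσ : 0 ≤ σ) (hΔ : fineAcc Δ₀ τ = Δ)
    (h : Δ < R) (hK : 0 < sizeK Δ α R σ) (hz : sizeT Δ α R σ / δ = z) (hB : 0 < sizeB z) :
    ∃ t v, Returns singleP g [Δ₀, α, R, σ, δ, τ] ω t (2 * sizeN Δ α R σ z) [v] ∧
      t ≤ 30000 * d * sizeN Δ α R σ z * sizeT Δ α R σ ^ 3 ∧
      ∃ β, Best (candidates g R (Δ / 8) (sizeη Δ α R σ z) (α * gam Δ σ / 20) (sizeT Δ α R σ)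
        (sizeB z) (sizeN Δ α R σ z) ω (sizeT Δ α R σ) 0) (1000 * R) v β := by
  have hT : 0 < sizeT Δ α R σ := by unfold sizeT; positivity
  set K := sizeK Δ α R σ with hKdef
  set T := sizeT Δ α R σ with hTdef
  set B := sizeB z with hBdef
  set N := sizeN Δ α R σ z with hNdef
  have hN : N = T * B := rfl
  set s₀ := State.init d [Δ, α, R, σ, δ, τ] with hs₀
  obtain ⟨t, s', he, ht, h0, hL, hdr⟩ : Halts g ω singleP (State.init d [Δ₀, α, R, σ, δ, τ])
      (20 + (BExp.cost (.rlt (.var 0) (.var 2)) + (13 * K + 20 * Nat.clog 2 ⌈z⌉₊ +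
        2 * N * (d + 13) + 200 + 20000 * d * T * T * T * N)))
      (fun s' => s'.nvar 0 = 1 ∧ (∃ β, Best (candidates g R (Δ / 8) (sizeη Δ α R σ z)
        (α * gam Δ σ / 20) T B N ω T 0) (1000 * R) (s'.read d 0 0) β) ∧
        s'.drawn = 2 * N) := by
    refine Halts.seq' singleP_fineAcc fun s₂ _ h₂ => ?_
    rw [h₂, hΔ]
    refine Halts.ite (fun _ => Halts.seq' (prepP_halts (z := z) hσ (by simp [State.init])
      (by simp [State.init]) (by simp [State.init]) (by simp [State.init])
      (by simp [State.init]) (by simp [State.init])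
      (by simp [State.init])
      (by simp [State.init]) ?_ (by decide)) fun s₁ _ h₁ =>
      (selectP_halts hd hB hT hN h₁.1 h₁.2.2.1 le_rfl).mono le_rfl ?_)
      fun hb => absurd (by simpa [State.init] using h) hb
    · intro s' h4 h2
      simpa [h4, h2, State.init] using hz
    · intro s' hF hs'
      refine ⟨hs'.1, hs'.2, ?_⟩
      rw [hF.drawn (by simp [selectP, scanP, minP, bestP, evalP, evalBody, runP, stepP, gradP,
        dotP]), h₁.2.2.2]
  refine ⟨t, _, ⟨s', he, hdr, ?_⟩, ht.trans ?_, hL⟩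
  · rw [output_eq 1 h0]
    simp
  · have e1 : BExp.cost (.rlt (.var 0) (.var 2)) = 3 := rfl
    have e2 : Nat.clog 2 ⌈z⌉₊ ≤ B := by
      rw [hBdef, sizeB]; exact Nat.le_mul_of_pos_left _ (by norm_num)
    have e3 : K ≤ T := by
      rw [hTdef, sizeT, ← hKdef]
      nlinarith
    rw [e1]
    obtain ⟨a, ha⟩ : ∃ a, a = d * T * T * T * N := ⟨_, rfl⟩
    have hNpos : 0 < N := Nat.mul_pos hT hB
    have hTTT : 0 < T * T * T := Nat.mul_pos (Nat.mul_pos hT hT) hT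
    have a1 : d * N ≤ a := by
      rw [ha, show d * T * T * T * N = d * N * (T * T * T) by ring]
      exact Nat.le_mul_of_pos_right _ hTTT
    have a2 : N ≤ d * N := Nat.le_mul_of_pos_left _ hd
    have a3 : T ≤ N := hN ▸ Nat.le_mul_of_pos_right _ hB
    have a4 : B ≤ N := hN ▸ Nat.le_mul_of_pos_left _ hT
    have e4 : 2 * N * (d + 13) = 2 * (d * N) + 26 * N := by ring
    have e5 : 20000 * d * T * T * T * N = 20000 * a := by rw [ha]; ring
    have e6 : 30000 * d * N * T ^ 3 = 30000 * a := by rw [ha]; ring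
    omega

end
end

end ObliviousGLM

namespace ObliviousGLM

noncomputable section

/-! ### The truncation and the Huber loss -/

theorem ramp_eq (s r : ℝ) : ramp s r = max (-1) (min 1 (r / s)) := by
  unfold ramp
  rcases le_total (r / s) (-1) with h | h
  · rw [abs_of_nonpos (by linarith), abs_of_nonpos (by linarith), min_eq_right (by linarith),
      max_eq_left h]
    ring
  · rcases le_total (r / s) 1 with h' | h'
    · rw [abs_of_nonneg (by linarith), abs_of_nonpos (by linarith), min_eq_right h',
        max_eq_right h]
      ring
    · rw [abs_of_nonneg (by linarith), abs_of_nonneg (by linarith), min_eq_left h',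
        max_eq_right (by norm_num)]
      ring

theorem neg_one_le_ramp (s r : ℝ) : -1 ≤ ramp s r := by
  rw [ramp_eq]; exact le_max_left _ _

theorem ramp_le_one (s r : ℝ) : ramp s r ≤ 1 := by
  rw [ramp_eq]; exact max_le (by norm_num) (min_le_left _ _)

theorem abs_ramp_le_one (s r : ℝ) : |ramp s r| ≤ 1 :=
  abs_le.mpr ⟨neg_one_le_ramp s r, ramp_le_one s r⟩

theorem ramp_mono {s : ℝ} (hs : 0 < s) : Monotone (ramp s) := by
  intro a b h
  simp only [ramp_eq]
  gcongr

theorem ramp_eq_one {s r : ℝ} (hs : 0 < s) (h : s ≤ r) : ramp s r = 1 := by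
  rw [ramp_eq, min_eq_left ((one_le_div hs).mpr h), max_eq_right (by norm_num)]

theorem ramp_neg (s r : ℝ) : ramp s (-r) = -ramp s r := by
  unfold ramp
  rw [neg_div, show -(r / s) + 1 = -(r / s - 1) by ring, show -(r / s) - 1 = -(r / s + 1) by ring,
    abs_neg, abs_neg]
  ring

theorem ramp_nonneg {s r : ℝ} (hs : 0 < s) (h : 0 ≤ r) : 0 ≤ ramp s r := by
  rw [ramp_eq]
  exact le_max_of_le_right (le_min (by norm_num) (div_nonneg h hs.le))

theorem abs_ramp_sub_le {s : ℝ} (hs : 0 < s) (a b : ℝ) :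
    |ramp s a - ramp s b| ≤ |a - b| / s := by
  simp only [ramp_eq]
  refine (abs_max_sub_max_le_max _ _ _ _).trans (max_le (by simp; positivity) ?_)
  refine (abs_min_sub_min_le_max _ _ _ _).trans (max_le (by simp; positivity) ?_)
  rw [← sub_div, abs_div, abs_of_pos hs]

theorem continuous_ramp (s : ℝ) : Continuous (ramp s) := by
  unfold ramp; fun_prop

theorem continuous_huber (s : ℝ) : Continuous (huber s) := by
  have := continuous_ramp s
  unfold huber; fun_prop

/-- The Huber loss is the maximum over |q| ≤ 1 of the affine functions r q - s q²/2, attained at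
`ramp s r`; its convexity and its Lipschitz bound follow from this. On the quadratic branch r = s p
the difference is s (p - q)²/2. -/
theorem le_huber {s : ℝ} (hs : 0 < s) (r : ℝ) {q : ℝ} (hq : |q| ≤ 1) :
    r * q - s * (q * q) / 2 ≤ huber s r := by
  obtain ⟨h1, h2⟩ := abs_le.mp hq
  unfold huber
  rcases le_total s r with h | h
  · rw [ramp_eq_one hs h]
    nlinarith [mul_nonneg (sub_nonneg.mpr h2) (sub_nonneg.mpr h),
      mul_nonneg hs.le (mul_nonneg (sub_nonneg.mpr h2) (sub_nonneg.mpr h2))]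
  · rcases le_total r (-s) with h' | h'
    · have : ramp s r = -1 := by
        rw [← neg_neg r, ramp_neg, ramp_eq_one hs (by linarith)]
      rw [this]
      nlinarith [mul_nonneg (neg_le_iff_add_nonneg.mp h1) (sub_nonneg.mpr h'),
        mul_nonneg hs.le (mul_nonneg (neg_le_iff_add_nonneg.mp h1) (neg_le_iff_add_nonneg.mp h1))]
    · have e : ramp s r = r / s := by
        rw [ramp_eq, min_eq_right ((div_le_one hs).mpr h), max_eq_right]
        rw [le_div_iff₀ hs]; linarith
      obtain ⟨p, rfl⟩ : ∃ p, r = s * p := ⟨r / s, by field_simp⟩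
      rw [e, mul_div_cancel_left₀ _ hs.ne']
      nlinarith [mul_nonneg hs.le (sq_nonneg (p - q))]

theorem ramp_mul_le_huber_sub {s : ℝ} (hs : 0 < s) (a b : ℝ) :
    ramp s b * (a - b) ≤ huber s a - huber s b := by
  have := le_huber hs a (abs_ramp_le_one s b)
  have e : huber s b = b * ramp s b - s * (ramp s b * ramp s b) / 2 := rfl
  rw [e]; linarith

theorem abs_huber_sub_le {s : ℝ} (hs : 0 < s) (a b : ℝ) : |huber s a - huber s b| ≤ |a - b| := by
  have key : ∀ a b, huber s a - huber s b ≤ |a - b| := by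
    intro a b
    have h1 := ramp_mul_le_huber_sub hs b a
    have h2 : ramp s a * (a - b) ≤ |a - b| := by
      refine (le_abs_self _).trans ?_
      rw [abs_mul]
      exact mul_le_of_le_one_left (abs_nonneg _) (abs_ramp_le_one s a)
    linarith
  refine abs_le.mpr ⟨?_, key a b⟩
  have := key b a
  rw [abs_sub_comm] at this
  linarith

/-! ### The iteration -/

section
variable {d : ℕ} {g : ℝ → ℝ} {ω : ℕ → Sample d}

theorem norm_clip_le {R : ℝ} (hR : 0 < R) (w : Vec d) : ‖clip R w‖ ≤ R := by
  have hm : 0 < max R ‖w‖ := lt_max_of_lt_left hR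
  rw [clip, norm_smul, Real.norm_of_nonneg (by positivity), div_mul_eq_mul_div, div_le_iff₀ hm]
  gcongr
  exact le_max_right _ _

/-- For l = R/‖w‖ ≤ 1 one has ⟨w, v⟩ ≤ ‖w‖ R = l ‖w‖², so the squared distance drops by at least (1
- l)² ‖w‖². -/
theorem norm_clip_sub_le {R : ℝ} (hR : 0 < R) (w v : Vec d) (hv : ‖v‖ ≤ R) :
    ‖clip R w - v‖ ≤ ‖w - v‖ := by
  rcases le_total ‖w‖ R with h | h
  · rw [clip, max_eq_left h, div_self hR.ne', one_smul]
  · have hw : 0 < ‖w‖ := hR.trans_le h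
    rw [clip, max_eq_right h]
    set l := R / ‖w‖ with hl
    have hlw : l * ‖w‖ = R := div_mul_cancel₀ R hw.ne'
    have hl0 : 0 ≤ l := by positivity
    have hl1 : l ≤ 1 := (div_le_one hw).mpr h
    refine le_of_sq_le_sq ?_ (norm_nonneg _)
    rw [norm_sub_sq_real, norm_sub_sq_real, norm_smul, inner_smul_left, Real.norm_of_nonneg hl0]
    have h1 : (inner ℝ w v : ℝ) ≤ ‖w‖ * R :=
      (real_inner_le_norm w v).trans (by gcongr)
    simp only [conj_trivial]
    have h2 := mul_le_mul_of_nonneg_left h1 (sub_nonneg.mpr hl1)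
    rw [← hlw] at h2
    nlinarith [mul_nonneg (sub_nonneg.mpr hl1) (mul_nonneg (sub_nonneg.mpr hl1) (sq_nonneg ‖w‖))]

theorem norm_descent_le {R : ℝ} (hR : 0 < R) (s η b c : ℝ) (B : ℕ) (ω : ℕ → Sample d) (t : ℕ) :
    ‖descent g R s η b c B ω t‖ ≤ R := by
  cases t with
  | zero => simpa [descent] using hR.le
  | succ t => exact norm_clip_le hR _

/-- An iterate sees only the batches before it. This gives both the adaptedness for the martingale
bound and the independence from the holdout sample. -/
theorem descent_congr {R s η b c : ℝ} {B : ℕ} {ω ω' : ℕ → Sample d} {t : ℕ}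
    (h : ∀ i < t * B, ω i = ω' i) :
    descent g R s η b c B ω t = descent g R s η b c B ω' t := by
  induction t with
  | zero => rfl
  | succ t ih =>
    have ih := ih fun i hi => h i (by nlinarith)
    simp only [descent, ih]
    congr 2
    refine Finset.sum_congr rfl fun j hj => ?_
    rw [h (t * B + j) (by have := Finset.mem_range.mp hj; nlinarith)]

theorem continuous_coeff (hg : Continuous g) (s b c : ℝ) :
    Continuous fun p : Vec d × Sample d => coeff g s b c p.1 p.2 := by
  have := continuous_ramp s
  unfold coeff; fun_prop

theorem continuous_clip {R : ℝ} (hR : 0 < R) : Continuous (clip R : Vec d → Vec d) := by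
  unfold clip
  refine Continuous.smul (Continuous.div continuous_const (continuous_const.max continuous_norm)
    fun w => ?_) continuous_id
  exact (lt_max_of_lt_left hR).ne'

theorem continuous_descent (hg : Continuous g) {R : ℝ} (hR : 0 < R) (s η b c : ℝ) (B t : ℕ) :
    Continuous fun ω : ℕ → Sample d => descent g R s η b c B ω t := by
  induction t with
  | zero => exact continuous_const
  | succ t ih =>
    refine (continuous_clip hR).comp (ih.add (continuous_finsetSum _ fun j _ => ?_))
    refine Continuous.smul (continuous_const.mul ((continuous_coeff hg s b c).comp
      (ih.prodMk (continuous_apply _)))) ?_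
    exact continuous_fst.comp (continuous_apply _)

theorem abs_coeff_le {s b c : ℝ} (hc : |c| ≤ 2) (w : Vec d) (z : Sample d) :
    |coeff g s b c w z| ≤ 3 :=
  (abs_sub _ _).trans (by have := abs_ramp_le_one s (z.2 - b - g (inner ℝ w z.1)); linarith)

/-- The regret bound of projected descent. -/
theorem descent_regret {R q s b c : ℝ} (hR : 0 < R) (hq : 0 < q) {B : ℕ} (hB : 0 < B)
    (hc : |c| ≤ 2) (hω : ∀ i, ‖(ω i).1‖ ≤ 1) {v : Vec d} (hv : ‖v‖ ≤ R) {T : ℕ} (hT : (T : ℝ) = q ^ 2) :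
    ∑ t ∈ Finset.range T, ∑ j ∈ Finset.range B,
      coeff g s b c (descent g R s (R / q / B) b c B ω t) (ω (t * B + j)) *
        (inner ℝ (v - descent g R s (R / q / B) b c B ω t) (ω (t * B + j)).1 : ℝ)
      ≤ 5 * R * q * B := by
  set h := R / q / B with hh
  have hB' : (0 : ℝ) < B := by exact_mod_cast hB
  have hpos : 0 < h := by positivity
  set w := fun t => descent g R s h b c B ω t with hw
  set A := fun t => ∑ j ∈ Finset.range B, coeff g s b c (w t) (ω (t * B + j)) • (ω (t * B + j)).1
    with hA
  have hAn : ∀ t, ‖A t‖ ≤ 3 * B := by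
    intro t
    refine (norm_sum_le_of_le (f := fun j => coeff g s b c (w t) (ω (t * B + j)) •
      (ω (t * B + j)).1) _ (n := fun _ => 3) fun j _ => ?_).trans (by simp [mul_comm])
    rw [norm_smul, Real.norm_eq_abs]
    exact (mul_le_mul (abs_coeff_le hc _ _) (hω _) (norm_nonneg _) (by norm_num)).trans (by norm_num)
  have hstep : ∀ t, w (t + 1) = clip R (w t + h • A t) := by
    intro t
    simp only [hw, hA, descent, Finset.smul_sum, smul_smul]
  -- The squared distance to `v` serves as potential. Projection does not increase it, and the
  -- update lowers it by 2h⟨v - w_t, A_t⟩ up to h²‖A_t‖² ≤ h² (3B)².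
  have hsum : ∀ T, 2 * h * ∑ t ∈ Finset.range T, (inner ℝ (v - w t) (A t) : ℝ) ≤
      R ^ 2 + T * (h ^ 2 * (3 * B) ^ 2) - ‖w T - v‖ ^ 2 := by
    intro T
    induction T with
    | zero =>
      have : ‖w 0 - v‖ ≤ R := by simpa [hw, descent] using hv
      have := pow_le_pow_left₀ (norm_nonneg _) this 2
      simp; linarith
    | succ T ih =>
      have h1 : ‖w (T + 1) - v‖ ^ 2 ≤ ‖(w T - v) + h • A T‖ ^ 2 := by
        refine pow_le_pow_left₀ (norm_nonneg _) ?_ 2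
        rw [hstep]
        refine (norm_clip_sub_le hR _ v hv).trans (le_of_eq ?_)
        congr 1; abel
      rw [norm_add_sq_real, inner_smul_right, norm_smul, mul_pow, Real.norm_eq_abs, sq_abs] at h1
      have h2 : h ^ 2 * ‖A T‖ ^ 2 ≤ h ^ 2 * (3 * B) ^ 2 := by
        gcongr; exact hAn T
      have h3 : (inner ℝ (v - w T) (A T) : ℝ) = - inner ℝ (w T - v) (A T) := by
        rw [← neg_sub, inner_neg_left]
      rw [Finset.sum_range_succ, mul_add, h3]
      push_cast
      linarith
  have e : ∀ t, (inner ℝ (v - w t) (A t) : ℝ) = ∑ j ∈ Finset.range B,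
      coeff g s b c (w t) (ω (t * B + j)) * (inner ℝ (v - w t) (ω (t * B + j)).1 : ℝ) := by
    intro t
    simp only [hA, inner_sum, inner_smul_right]
  change ∑ t ∈ Finset.range T, ∑ j ∈ Finset.range B,
      coeff g s b c (w t) (ω (t * B + j)) * (inner ℝ (v - w t) (ω (t * B + j)).1 : ℝ) ≤ _
  simp only [← e]
  have := hsum T
  -- With h B = R/q and T = q² the right side is at most R² + 9R², and 10R² = 2h · 5RqB.
  have h4 : 2 * h * ∑ t ∈ Finset.range T, (inner ℝ (v - w t) (A t) : ℝ) ≤ 2 * h * (5 * R * q * B) := by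
    refine this.trans ?_
    have e1 : 2 * h * (5 * R * q * B) = 10 * R ^ 2 := by rw [hh]; field_simp; norm_num
    have e2 : (T : ℝ) * (h ^ 2 * (3 * B) ^ 2) = 9 * R ^ 2 := by rw [hh, hT]; field_simp; norm_num
    rw [e1, e2]
    nlinarith [sq_nonneg ‖w T - v‖]
  exact le_of_mul_le_mul_left h4 (by positivity)

end
end

end ObliviousGLM

namespace ObliviousGLM

noncomputable section

/-! ### Concentration of sums of adapted bounded variables -/

section
variable {Z : Type*} [MeasurableSpace Z] (P : Measure Z) [IsProbabilityMeasure P]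

/-- Replacing one coordinate by an independent copy preserves the product law. Integration over the
copy plays the role of a conditional expectation, so no filtration is needed. -/
theorem measurePreserving_update (n : ℕ) :
    MeasurePreserving (fun p : (ℕ → Z) × Z => Function.update p.1 n p.2)
      ((Measure.infinitePi fun _ : ℕ => P).prod P) (Measure.infinitePi fun _ : ℕ => P) := by
  have hm : Measurable fun p : (ℕ → Z) × Z => Function.update p.1 n p.2 := by
    refine measurable_pi_lambda _ fun i => ?_
    by_cases h : i = n
    · subst h; simpa using measurable_snd
    · simpa [h, Function.comp_def] using (measurable_pi_apply i).comp
        (measurable_fst (α := ℕ → Z) (β := Z))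
  refine ⟨hm, ?_⟩
  refine Measure.eq_infinitePi _ fun s t ht => ?_
  rw [Measure.map_apply hm (MeasurableSet.pi s.countable_toSet fun i _ => ht i)]
  have : (fun p : (ℕ → Z) × Z => Function.update p.1 n p.2) ⁻¹' (Set.pi s t) =
      (Set.pi (s.erase n) t) ×ˢ (if n ∈ s then t n else Set.univ) := by
    ext ⟨ω, z⟩
    simp only [Set.mem_preimage, Set.mem_pi, Finset.mem_coe, Set.mem_prod, Finset.mem_erase]
    constructor
    · intro h
      refine ⟨fun i hi => by simpa [hi.1] using h i hi.2, ?_⟩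
      split_ifs with hn
      · simpa using h n hn
      · trivial
    · rintro ⟨h1, h2⟩ i hi
      by_cases hin : i = n
      · subst hin; simpa [hi] using h2
      · simpa [hin] using h1 i ⟨hin, hi⟩
  rw [this, Measure.prod_prod, Measure.infinitePi_pi _ fun i _ => ht i]
  split_ifs with hn
  · rw [Finset.prod_erase_mul _ _ hn]
  · rw [Finset.erase_eq_of_notMem hn]; simp

/-- Hoeffding's lemma for an interval of length 2M, which gives the variance proxy M². -/
theorem lintegral_exp_centered_le {f : Z → ℝ} (hf : Measurable f) {M : ℝ}
    (hM : ∀ᵐ z ∂P, |f z| ≤ M) (r : ℝ) :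
    ∫⁻ z, ENNReal.ofReal (Real.exp (r * (f z - ∫ y, f y ∂P))) ∂P ≤
      ENNReal.ofReal (Real.exp (M ^ 2 * r ^ 2 / 2)) := by
  have h := hasSubgaussianMGF_of_mem_Icc (μ := P) (X := f) (a := -M) (b := M) hf.aemeasurable
    (hM.mono fun z hz => abs_le.mp hz)
  rw [← ofReal_integral_eq_lintegral_ofReal (h.integrable_exp_mul r)
    (Filter.Eventually.of_forall fun _ => (Real.exp_pos _).le)]
  refine ENNReal.ofReal_le_ofReal ((h.mgf_le r).trans (le_of_eq ?_))
  congr 1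
  have : (‖M - -M‖ / 2) ^ 2 = M ^ 2 := by
    rw [div_pow, Real.norm_eq_abs, sq_abs]; ring
  push_cast
  rw [this]

variable {F : ℕ → (ℕ → Z) → Z → ℝ}

/-- Induction on `n`: resample coordinate `n`. Neither the earlier terms nor the function `F n` see
it, so the integral over the copy is bounded by Hoeffding's lemma. Lower integrals avoid
integrability conditions on the products. -/
theorem lintegral_exp_sum_le (hF : ∀ i, Measurable fun p : (ℕ → Z) × Z => F i p.1 p.2)
    (hdep : ∀ i ω ω', (∀ j < i, ω j = ω' j) → F i ω = F i ω') {M : ℝ}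
    (hM : ∀ i ω, ∀ᵐ z ∂P, |F i ω z| ≤ M) (r : ℝ) (n : ℕ) :
    ∫⁻ ω, ENNReal.ofReal (Real.exp (r * ∑ i ∈ Finset.range n,
      (F i ω (ω i) - ∫ z, F i ω z ∂P))) ∂(Measure.infinitePi fun _ : ℕ => P) ≤
      ENNReal.ofReal (Real.exp (n * (M ^ 2 * r ^ 2 / 2))) := by
  have hY : ∀ i, Measurable fun ω : ℕ → Z => F i ω (ω i) - ∫ z, F i ω z ∂P := by
    intro i
    refine ((hF i).comp (measurable_id.prodMk (measurable_pi_apply i))).sub ?_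
    exact ((hF i).stronglyMeasurable.integral_prod_right' (ν := P)).measurable
  have hS : ∀ n, Measurable fun ω : ℕ → Z => ∑ i ∈ Finset.range n,
      (F i ω (ω i) - ∫ z, F i ω z ∂P) := fun n => Finset.measurable_fun_sum _ fun i _ => hY i
  have hE : ∀ n, Measurable fun ω : ℕ → Z => ENNReal.ofReal (Real.exp (r *
      ∑ i ∈ Finset.range n, (F i ω (ω i) - ∫ z, F i ω z ∂P))) := fun n =>
    ENNReal.measurable_ofReal.comp (Real.measurable_exp.comp ((hS n).const_mul r))
  induction n with
  | zero => simp
  | succ n ih =>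
    rw [← (measurePreserving_update P n).lintegral_comp (hE (n + 1))]
    refine (lintegral_prod _
      ((hE (n + 1)).comp (measurePreserving_update P n).measurable).aemeasurable).le.trans ?_
    have hFn : ∀ ω z, F n (Function.update ω n z) = F n ω := fun ω z =>
      hdep n _ _ fun j hj => Function.update_of_ne hj.ne _ _
    have key : ∀ ω z, ∑ i ∈ Finset.range (n + 1), (F i (Function.update ω n z)
        (Function.update ω n z i) - ∫ y, F i (Function.update ω n z) y ∂P) =
        ∑ i ∈ Finset.range n, (F i ω (ω i) - ∫ y, F i ω y ∂P) +
          (F n ω z - ∫ y, F n ω y ∂P) := by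
      intro ω z
      rw [Finset.sum_range_succ]
      congr 1
      · refine Finset.sum_congr rfl fun i hi => ?_
        have hi := Finset.mem_range.mp hi
        rw [hdep i (Function.update ω n z) ω fun j hj =>
          Function.update_of_ne (hj.trans hi).ne _ _, Function.update_of_ne hi.ne]
      · simp [hFn]
    simp only [Function.comp_apply, key, mul_add, Real.exp_add, ENNReal.ofReal_mul (Real.exp_pos _).le]
    calc _ ≤ ∫⁻ ω, ENNReal.ofReal (Real.exp (r * ∑ i ∈ Finset.range n,
          (F i ω (ω i) - ∫ z, F i ω z ∂P))) * ENNReal.ofReal (Real.exp (M ^ 2 * r ^ 2 / 2))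
          ∂(Measure.infinitePi fun _ : ℕ => P) := by
          refine lintegral_mono fun ω => ?_
          have hmz : Measurable (F n ω) := (hF n).comp (measurable_const.prodMk measurable_id)
          rw [lintegral_const_mul' _ _ ENNReal.ofReal_ne_top]
          gcongr
          exact lintegral_exp_centered_le P hmz (hM n ω) r
      _ ≤ _ := by
          rw [lintegral_mul_const' _ _ ENNReal.ofReal_ne_top]
          refine (mul_le_mul_left ih _).trans (le_of_eq ?_)
          rw [← ENNReal.ofReal_mul (Real.exp_pos _).le, ← Real.exp_add]
          congr 2
          push_cast; ring

/-- The Azuma–Hoeffding inequality for functions of independent variables. -/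
theorem measure_le_sum_le (hF : ∀ i, Measurable fun p : (ℕ → Z) × Z => F i p.1 p.2)
    (hdep : ∀ i ω ω', (∀ j < i, ω j = ω' j) → F i ω = F i ω') {M : ℝ} (hM0 : 0 < M)
    (hM : ∀ i ω, ∀ᵐ z ∂P, |F i ω z| ≤ M) {n : ℕ} (hn : 0 < n) {a : ℝ} (ha : 0 ≤ a) :
    (Measure.infinitePi fun _ : ℕ => P) {ω | a ≤ ∑ i ∈ Finset.range n,
      (F i ω (ω i) - ∫ z, F i ω z ∂P)} ≤
      ENNReal.ofReal (Real.exp (-(a ^ 2 / (2 * n * M ^ 2)))) := by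
  have hn' : (0 : ℝ) < n := by exact_mod_cast hn
  -- The minimiser of n M² r²/2 - r a.
  set r := a / (n * M ^ 2) with hr
  have hr0 : 0 ≤ r := by positivity
  have hsub : {ω : ℕ → Z | a ≤ ∑ i ∈ Finset.range n, (F i ω (ω i) - ∫ z, F i ω z ∂P)} ⊆
      {ω | ENNReal.ofReal (Real.exp (r * a)) ≤ ENNReal.ofReal (Real.exp (r *
        ∑ i ∈ Finset.range n, (F i ω (ω i) - ∫ z, F i ω z ∂P)))} := by
    intro ω hω
    refine ENNReal.ofReal_le_ofReal (Real.exp_le_exp.mpr ?_)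
    exact mul_le_mul_of_nonneg_left hω hr0
  refine (measure_mono hsub).trans ?_
  have h1 := mul_meas_ge_le_lintegral₀ (μ := Measure.infinitePi fun _ : ℕ => P)
    (f := fun ω => ENNReal.ofReal (Real.exp (r *
        ∑ i ∈ Finset.range n, (F i ω (ω i) - ∫ z, F i ω z ∂P)))) (by
    refine (ENNReal.measurable_ofReal.comp (Real.measurable_exp.comp (Measurable.const_mul
      (Finset.measurable_fun_sum _ fun i _ => ?_) r))).aemeasurable
    refine ((hF i).comp (measurable_id.prodMk (measurable_pi_apply i))).sub ?_
    exact ((hF i).stronglyMeasurable.integral_prod_right' (ν := P)).measurable)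
    (ENNReal.ofReal (Real.exp (r * a)))
  have h2 := h1.trans (lintegral_exp_sum_le P hF hdep hM r n)
  have hpos : ENNReal.ofReal (Real.exp (r * a)) ≠ 0 := by
    simpa using Real.exp_pos _
  rw [mul_comm, ← ENNReal.le_div_iff_mul_le (Or.inl hpos) (Or.inl ENNReal.ofReal_ne_top),
    ← ENNReal.ofReal_div_of_pos (Real.exp_pos _), ← Real.exp_sub] at h2
  refine h2.trans (le_of_eq ?_)
  congr 2
  rw [hr]; field_simp; ring

end
end

end ObliviousGLM

namespace ObliviousGLM

noncomputable section

/-! ### The law of the noise -/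

/-- The expectation of the truncation of `z - t`. -/
def meanRamp (Λ : Measure ℝ) (s t : ℝ) : ℝ := ∫ z, ramp s (z - t) ∂Λ

/-- The expected tilted Huber loss of `z - t`, relative to that of `z`. -/
def pot (Λ : Measure ℝ) (s c t : ℝ) : ℝ := ∫ z, (huber s (z - t) - huber s z) ∂Λ + c * t

theorem pot_tilt (Λ : Measure ℝ) (s c c' t : ℝ) :
    pot Λ s c' t = pot Λ s c t + (c' - c) * t := by
  unfold pot; ring

section
variable {Λ : Measure ℝ} [IsProbabilityMeasure Λ] {s : ℝ}

theorem integrable_ramp (s t : ℝ) : Integrable (fun z => ramp s (z - t)) Λ :=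
  Integrable.of_bound ((continuous_ramp s).comp (by fun_prop)).aestronglyMeasurable 1
    (Filter.Eventually.of_forall fun z => abs_ramp_le_one _ _)

theorem integrable_huber_sub (hs : 0 < s) (t u : ℝ) :
    Integrable (fun z => huber s (z - t) - huber s (z - u)) Λ := by
  have := continuous_huber s
  refine Integrable.of_bound (by fun_prop) |t - u| (Filter.Eventually.of_forall fun z => ?_)
  rw [Real.norm_eq_abs]
  refine (abs_huber_sub_le hs _ _).trans (le_of_eq ?_)
  rw [show z - t - (z - u) = -(t - u) by ring, abs_neg]

theorem abs_meanRamp_le_one (t : ℝ) : |meanRamp Λ s t| ≤ 1 := by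
  have := norm_integral_le_of_norm_le_const (μ := Λ) (f := fun z => ramp s (z - t)) (C := 1)
    (Filter.Eventually.of_forall fun z => abs_ramp_le_one _ _)
  simpa [meanRamp] using this

theorem meanRamp_antitone (hs : 0 < s) : Antitone (meanRamp Λ s) := by
  intro a b h
  refine integral_mono (integrable_ramp s b) (integrable_ramp s a) fun z => ?_
  exact ramp_mono hs (by linarith)

theorem abs_meanRamp_sub_le (hs : 0 < s) (a b : ℝ) :
    |meanRamp Λ s a - meanRamp Λ s b| ≤ |a - b| / s := by
  unfold meanRamp
  rw [← integral_sub (integrable_ramp s a) (integrable_ramp s b)]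
  have := norm_integral_le_of_norm_le_const (μ := Λ)
    (f := fun z => ramp s (z - a) - ramp s (z - b)) (C := |a - b| / s)
    (Filter.Eventually.of_forall fun z => by
      rw [Real.norm_eq_abs]
      refine (abs_ramp_sub_le hs _ _).trans (le_of_eq ?_)
      rw [show z - a - (z - b) = -(a - b) by ring, abs_neg])
  simpa using this

theorem continuous_meanRamp (hs : 0 < s) : Continuous (meanRamp Λ s) := by
  refine (LipschitzWith.of_dist_le_mul (K := ⟨1 / s, by positivity⟩) fun a b => ?_).continuous
  rw [Real.dist_eq, Real.dist_eq]
  refine (abs_meanRamp_sub_le hs a b).trans (le_of_eq ?_)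
  change _ = 1 / s * _
  ring

theorem pot_sub_eq (hs : 0 < s) (c a b : ℝ) :
    pot Λ s c a - pot Λ s c b = ∫ z, (huber s (z - a) - huber s (z - b)) ∂Λ + c * (a - b) := by
  have h0 : ∀ t, Integrable (fun z => huber s (z - t) - huber s z) Λ := fun t => by
    simpa using integrable_huber_sub (Λ := Λ) hs t 0
  unfold pot
  have := integral_sub (h0 a) (h0 b)
  simp only [sub_sub_sub_cancel_right] at this
  rw [this]; ring

/-- The subgradient inequality of the Huber loss, integrated: `pot` is convex with slope `c -
meanRamp Λ s b` at `b`. Only differences of losses occur, and these are bounded even if the noise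
has no mean. -/
theorem pot_sub_ge (hs : 0 < s) (c a b : ℝ) :
    (c - meanRamp Λ s b) * (a - b) ≤ pot Λ s c a - pot Λ s c b := by
  rw [pot_sub_eq hs, sub_mul, sub_eq_add_neg, add_comm]
  gcongr
  unfold meanRamp
  rw [← neg_mul, ← integral_neg, ← integral_mul_const]
  refine integral_mono (((integrable_ramp s b).neg).mul_const _) (integrable_huber_sub hs a b)
    fun z => ?_
  have := ramp_mul_le_huber_sub hs (z - a) (z - b)
  calc -ramp s (z - b) * (a - b) = ramp s (z - b) * (z - a - (z - b)) := by ring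
    _ ≤ _ := this

theorem pot_sub_le (hs : 0 < s) (c a b : ℝ) :
    pot Λ s c a - pot Λ s c b ≤ (c - meanRamp Λ s a) * (a - b) := by
  have := pot_sub_ge (Λ := Λ) hs c b a
  linarith

theorem abs_pot_sub_le (hs : 0 < s) (c a b : ℝ) :
    |pot Λ s c a - pot Λ s c b| ≤ (1 + |c|) * |a - b| := by
  have h := norm_integral_le_of_norm_le_const (μ := Λ)
    (f := fun z => huber s (z - a) - huber s (z - b)) (C := |a - b|)
    (Filter.Eventually.of_forall fun z => by
      rw [Real.norm_eq_abs]
      refine (abs_huber_sub_le hs _ _).trans (le_of_eq ?_)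
      rw [show z - a - (z - b) = -(a - b) by ring, abs_neg])
  rw [Real.norm_eq_abs, probReal_univ, mul_one] at h
  rw [pot_sub_eq hs, add_mul, one_mul, ← abs_mul]
  exact (abs_add_le _ _).trans (add_le_add_left h _)

theorem continuous_pot (hs : 0 < s) (c : ℝ) : Continuous (pot Λ s c) := by
  refine (LipschitzWith.of_dist_le_mul (K := ⟨1 + |c|, by positivity⟩) fun a b => ?_).continuous
  rw [Real.dist_eq, Real.dist_eq]
  exact abs_pot_sub_le hs c a b

/-- For z in [0, s] the truncation is nonnegative at offset 0 and equals -1 at offset t, since z - t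
≤ -s. For other z monotonicity suffices. -/
theorem meanRamp_drop (hs : 0 < s) {κ : ℝ} (hκ : κ ≤ Λ.real (Set.Icc 0 s)) {t : ℝ}
    (ht : 2 * s ≤ t) : κ ≤ meanRamp Λ s 0 - meanRamp Λ s t := by
  unfold meanRamp
  rw [← integral_sub (integrable_ramp s 0) (integrable_ramp s t)]
  refine hκ.trans ?_
  rw [← integral_indicator_one measurableSet_Icc]
  refine integral_mono ((integrable_const (1 : ℝ)).indicator measurableSet_Icc)
    ((integrable_ramp s 0).sub (integrable_ramp s t)) fun z => ?_
  by_cases hz : z ∈ Set.Icc 0 s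
  · rw [Set.indicator_of_mem hz]
    have h1 : 0 ≤ ramp s (z - 0) := ramp_nonneg hs (by simpa using hz.1)
    have h2 : ramp s (z - t) = -1 := by
      rw [← neg_sub, ramp_neg, ramp_eq_one hs (by linarith [hz.2])]
    simp only [Pi.one_apply, h2]; linarith
  · rw [Set.indicator_of_notMem hz]
    have : ramp s (z - t) ≤ ramp s (z - 0) := ramp_mono hs (by linarith)
    linarith

theorem meanRamp_rise (hs : 0 < s) {κ : ℝ} (hκ : κ ≤ Λ.real (Set.Icc (-s) 0)) {t : ℝ}
    (ht : t ≤ -(2 * s)) : κ ≤ meanRamp Λ s t - meanRamp Λ s 0 := by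
  unfold meanRamp
  rw [← integral_sub (integrable_ramp s t) (integrable_ramp s 0)]
  refine hκ.trans ?_
  rw [← integral_indicator_one measurableSet_Icc]
  refine integral_mono ((integrable_const (1 : ℝ)).indicator measurableSet_Icc)
    ((integrable_ramp s t).sub (integrable_ramp s 0)) fun z => ?_
  by_cases hz : z ∈ Set.Icc (-s) 0
  · rw [Set.indicator_of_mem hz]
    have h1 : 0 ≤ ramp s (-(z - 0)) := ramp_nonneg hs (by simpa using hz.2)
    rw [ramp_neg] at h1
    have h2 : ramp s (z - t) = 1 := ramp_eq_one hs (by linarith [hz.1])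
    simp only [Pi.one_apply, h2]; linarith
  · rw [Set.indicator_of_notMem hz]
    have : ramp s (z - 0) ≤ ramp s (z - t) := ramp_mono hs (by linarith)
    linarith

end

/-- The law of the sum of the oblivious and the Gaussian noise. -/
def noiseLaw (ν : Measure ℝ) (σ : ℝ) : Measure ℝ :=
  (ν.prod (gaussianReal 0 (σ ^ 2).toNNReal)).map fun p => p.1 + p.2

theorem isProbabilityMeasure_noiseLaw (ν : Measure ℝ) [IsProbabilityMeasure ν] (σ : ℝ) :
    IsProbabilityMeasure (noiseLaw ν σ) :=
  Measure.isProbabilityMeasure_map (by fun_prop)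

/-- On [0, σ] the density is at least e^(-1/2)/(√(2π) σ) ≥ (3/5)/(3σ) = 1/(5σ). -/
theorem gaussian_Icc_ge {σ m : ℝ} (hσ : 0 < σ) (hm : 0 ≤ m) (hmσ : m ≤ σ) :
    m / (5 * σ) ≤ (gaussianReal 0 (σ ^ 2).toNNReal).real (Set.Icc 0 m) := by
  have hv : (σ ^ 2).toNNReal ≠ 0 := by simpa using hσ.ne'
  have hint : IntegrableOn (gaussianPDFReal 0 (σ ^ 2).toNNReal) (Set.Icc 0 m) :=
    (integrable_gaussianPDFReal _ _).integrableOn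
  have hpt : ∀ x ∈ Set.Icc 0 m, 1 / (5 * σ) ≤ gaussianPDFReal 0 (σ ^ 2).toNNReal x := by
    intro x hx
    rw [gaussianPDFReal, Real.coe_toNNReal _ (sq_nonneg σ), Real.sqrt_mul' _ (sq_nonneg σ),
      Real.sqrt_sq hσ.le]
    have h1 : √(2 * Real.pi) ≤ 3 := by
      rw [Real.sqrt_le_left (by norm_num)]
      linarith [Real.pi_lt_four, Real.pi_lt_d2]
    have h2 : 3 / 5 ≤ Real.exp (-(1 / 2)) := by
      refine (sq_le_sq₀ (by norm_num) (Real.exp_pos _).le).1 ?_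
      rw [← Real.exp_nat_mul, show ((2 : ℕ) : ℝ) * -(1 / 2) = -1 by norm_num, Real.exp_neg]
      rw [le_inv_comm₀ (by norm_num) (Real.exp_pos _)]
      linarith [Real.exp_one_lt_d9]
    have h3 : -(1 / 2) ≤ -(x - 0) ^ 2 / (2 * σ ^ 2) := by
      rw [sub_zero, neg_div, neg_le_neg_iff, div_le_div_iff₀ (by positivity) (by norm_num)]
      nlinarith [hx.1, hx.2.trans hmσ]
    have h4 : 1 / (3 * σ) ≤ (√(2 * Real.pi) * σ)⁻¹ := by
      rw [one_div]
      gcongr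
    calc 1 / (5 * σ) = 1 / (3 * σ) * (3 / 5) := by field_simp
      _ ≤ _ := mul_le_mul h4 (h2.trans (Real.exp_le_exp.2 h3)) (by norm_num) (by positivity)
  have h := setIntegral_ge_of_const_le_real measurableSet_Icc (by simp) hpt hint
  rw [measureReal_def, gaussianReal_apply_eq_integral _ hv, ENNReal.toReal_ofReal]
  · refine le_trans (le_of_eq ?_) h
    simp [hm]; ring
  · exact le_trans (by positivity) h

theorem gaussian_neg_Icc (σ m : ℝ) :
    (gaussianReal 0 (σ ^ 2).toNNReal).real (Set.Icc (-m) 0) =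
      (gaussianReal 0 (σ ^ 2).toNNReal).real (Set.Icc 0 m) := by
  have h := gaussianReal_map_neg (μ := 0) (v := (σ ^ 2).toNNReal)
  rw [neg_zero] at h
  conv_lhs => rw [← h]
  rw [measureReal_def, Measure.map_apply (by fun_prop) measurableSet_Icc, measureReal_def]
  congr 2
  ext z
  simp [and_comm]

/-- The interval is cut down to length min(Δ/8, σ), where the density bound applies. For σ = 0 the
law is the point mass at 0. -/
theorem gaussian_ge {Δ σ : ℝ} (hΔ : 0 < Δ) (hσ : 0 ≤ σ) :
    gam Δ σ / 10 ≤ (gaussianReal 0 (σ ^ 2).toNNReal).real (Set.Icc 0 (Δ / 8)) := by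
  rcases hσ.eq_or_lt with rfl | hσ
  · have h0 : (0 : ℝ) ∈ Set.Icc 0 (Δ / 8) := ⟨le_rfl, by positivity⟩
    rw [gam, if_pos rfl]
    simp [measureReal_def, h0]
    norm_num
  · have h1 := gaussian_Icc_ge hσ (m := min (Δ / 8) σ) (by positivity) (min_le_right _ _)
    refine le_trans ?_ (h1.trans (measureReal_mono (Set.Icc_subset_Icc_right (min_le_left _ _))))
    rw [gam, if_neg hσ.ne']
    rcases le_total (Δ / 8) σ with h | h
    · rw [min_eq_left h]
      refine (div_le_div_of_nonneg_right (min_le_left _ _) (by norm_num)).trans (le_of_eq ?_)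
      field_simp; norm_num
    · rw [min_eq_right h]
      refine (div_le_div_of_nonneg_right (min_le_right _ _) (by norm_num)).trans ?_
      rw [le_div_iff₀ (by positivity)]; linarith

/-- Only the event ξ = 0 is used, as nothing is known about the other values of ξ. -/
theorem noiseLaw_ge {ν : Measure ℝ} [IsProbabilityMeasure ν] {σ : ℝ} {a b : ℝ} :
    ν.real {0} * (gaussianReal 0 (σ ^ 2).toNNReal).real (Set.Icc a b) ≤
      (noiseLaw ν σ).real (Set.Icc a b) := by
  rw [noiseLaw, measureReal_def (μ := Measure.map _ _),
    Measure.map_apply (by fun_prop) measurableSet_Icc, measureReal_def, measureReal_def,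
    ← ENNReal.toReal_mul, ← Measure.prod_prod]
  refine ENNReal.toReal_mono (measure_ne_top _ _) (measure_mono ?_)
  rintro ⟨x, y⟩ ⟨hx, hy⟩
  have hx : x = 0 := hx
  subst hx
  simpa using hy

/-- The anchor of the noise at zero, on both sides. -/
theorem noiseLaw_anchor {ν : Measure ℝ} [IsProbabilityMeasure ν] {Δ α σ : ℝ} (hΔ : 0 < Δ)
    (hσ : 0 ≤ σ) (hα : α ≤ ν.real {0}) :
    α * gam Δ σ / 10 ≤ (noiseLaw ν σ).real (Set.Icc 0 (Δ / 8)) ∧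
      α * gam Δ σ / 10 ≤ (noiseLaw ν σ).real (Set.Icc (-(Δ / 8)) 0) := by
  have h := gaussian_ge hΔ hσ
  have hg : 0 ≤ gam Δ σ := by
    unfold gam; split_ifs <;> positivity
  have key : α * gam Δ σ / 10 ≤ ν.real {0} *
      (gaussianReal 0 (σ ^ 2).toNNReal).real (Set.Icc 0 (Δ / 8)) := by
    rw [mul_div_assoc]
    gcongr
  refine ⟨key.trans noiseLaw_ge, ?_⟩
  rw [← gaussian_neg_Icc] at key
  exact key.trans noiseLaw_ge

theorem glmLaw_eq {d : ℕ} (D : Measure (Vec d)) [IsProbabilityMeasure D] (ν : Measure ℝ)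
    [IsProbabilityMeasure ν] {g : ℝ → ℝ} (hg : Continuous g) (σ : ℝ) (w : Vec d) :
    glmLaw D ν g σ w =
      (D.prod (noiseLaw ν σ)).map fun p => (p.1, g (inner ℝ w p.1) + p.2) := by
  unfold glmLaw noiseLaw
  have h1 : D.prod ((ν.prod (gaussianReal 0 (σ ^ 2).toNNReal)).map fun p => p.1 + p.2) =
      (D.prod (ν.prod (gaussianReal 0 (σ ^ 2).toNNReal))).map
        (Prod.map id fun p : ℝ × ℝ => p.1 + p.2) := by
    rw [← Measure.map_prod_map _ _ measurable_id (by fun_prop), Measure.map_id]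
  rw [h1, Measure.map_map _ (by fun_prop)]
  · congr 1
    funext p
    simp [add_assoc]
  · exact Continuous.measurable (by fun_prop)

end

end ObliviousGLM

namespace ObliviousGLM

noncomputable section

/-! ### The population quantities of the model -/

/-- The difference of the predictions of `w` and `v`. -/
def gap {d : ℕ} (g : ℝ → ℝ) (v w x : Vec d) : ℝ := g (inner ℝ w x) - g (inner ℝ v x)

/-- The law of `(x, g (v ⬝ x) + ζ)`, where `x ∼ D` and `ζ ∼ Λ` are independent. -/
def model {d : ℕ} (D : Measure (Vec d)) (Λ : Measure ℝ) (g : ℝ → ℝ) (v : Vec d) :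
    Measure (Sample d) :=
  (D.prod Λ).map fun p => (p.1, g (inner ℝ v p.1) + p.2)

/-- The progress that a step of descent at `w` makes in expectation. -/
def slack {d : ℕ} (D : Measure (Vec d)) (Λ : Measure ℝ) (g : ℝ → ℝ) (s b : ℝ) (v w : Vec d) : ℝ :=
  ∫ x, |meanRamp Λ s (b + gap g v w x) - meanRamp Λ s b| * |gap g v w x| ∂D

/-- The tilted Huber loss of the sample `z`. -/
def sampleLoss {d : ℕ} (g : ℝ → ℝ) (s b c : ℝ) (w : Vec d) (z : Sample d) : ℝ :=
  huberGap g s b w z + c * shift g b w z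

variable {d : ℕ} {g : ℝ → ℝ}

theorem continuous_gap (hg : Continuous g) (v : Vec d) :
    Continuous fun p : Vec d × Vec d => gap g v p.1 p.2 := by
  unfold gap; fun_prop

theorem continuous_gap_right (hg : Continuous g) (v w : Vec d) : Continuous (gap g v w) :=
  (continuous_gap hg v).comp (by fun_prop : Continuous fun x : Vec d => (w, x))

theorem abs_inner_le {R : ℝ} {w x : Vec d} (hw : ‖w‖ ≤ R) (hx : ‖x‖ ≤ 1) :
    |(inner ℝ w x : ℝ)| ≤ R := by
  have := abs_real_inner_le_norm w x
  have := norm_nonneg w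
  have := norm_nonneg x
  nlinarith

theorem abs_gap_le_inner (hg : LipschitzWith 1 g) (v w x : Vec d) :
    |gap g v w x| ≤ |(inner ℝ (v - w) x : ℝ)| := by
  have := hg.dist_le_mul (inner ℝ w x) (inner ℝ v x)
  rw [inner_sub_left, abs_sub_comm]
  simpa [Real.dist_eq, gap] using this

theorem abs_gap_le (hg : LipschitzWith 1 g) {R : ℝ} {v w x : Vec d} (hv : ‖v‖ ≤ R)
    (hw : ‖w‖ ≤ R) (hx : ‖x‖ ≤ 1) : |gap g v w x| ≤ 2 * R := by
  refine (abs_gap_le_inner hg v w x).trans ?_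
  rw [inner_sub_left]
  have := abs_inner_le hv hx
  have := abs_inner_le hw hx
  exact (abs_sub _ _).trans (by linarith)

theorem continuous_sampleLoss (hg : Continuous g) (s b c : ℝ) :
    Continuous fun p : Vec d × Sample d => sampleLoss g s b c p.1 p.2 := by
  have := continuous_huber s
  unfold sampleLoss huberGap shift; fun_prop

/-- Both Huber terms contain the same label, so they differ by at most |b + g(w·x) - g 0| ≤ 9R
whatever the label is. Subtracting the loss of the constant predictor thus makes the loss bounded;
the tilt adds at most 2 · 9R. -/
theorem abs_sampleLoss_le (hg : LipschitzWith 1 g) {R s b c : ℝ} (hs : 0 < s)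
    (hb : |b| ≤ 8 * R) (hc : |c| ≤ 2) {w : Vec d} (hw : ‖w‖ ≤ R) {z : Sample d}
    (hz : ‖z.1‖ ≤ 1) : |sampleLoss g s b c w z| ≤ 27 * R := by
  have h1 : |b + g (inner ℝ w z.1) - g 0| ≤ 9 * R := by
    have h := hg.dist_le_mul (inner ℝ w z.1) 0
    have h' := abs_inner_le hw hz
    rw [Real.dist_eq, Real.dist_eq, sub_zero, NNReal.coe_one, one_mul] at h
    rw [add_sub_assoc]
    exact (abs_add_le _ _).trans (by linarith)
  have h2 : |huberGap g s b w z| ≤ 9 * R := by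
    refine (abs_huber_sub_le hs _ _).trans (le_trans (le_of_eq ?_) h1)
    rw [← abs_neg]; congr 1; ring
  rw [sampleLoss]
  refine (abs_add_le _ _).trans ?_
  rw [abs_mul]
  have h3 : |c| * |shift g b w z| ≤ 2 * (9 * R) := mul_le_mul hc h1 (abs_nonneg _) (by norm_num)
  linarith

theorem ae_model {D : Measure (Vec d)} {Λ : Measure ℝ} {v : Vec d} (hg : Continuous g)
    (hD : ∀ᵐ x ∂D, ‖x‖ ≤ 1) :
    ∀ᵐ z ∂model D Λ g v, ‖z.1‖ ≤ 1 := by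
  rw [model, ae_map_iff (Continuous.aemeasurable (by fun_prop))
    (measurableSet_le (by fun_prop) (by fun_prop))]
  exact Measure.quasiMeasurePreserving_fst.ae hD

section
variable {D : Measure (Vec d)} [IsProbabilityMeasure D] {Λ : Measure ℝ} [IsProbabilityMeasure Λ]
  {R s : ℝ} {v w : Vec d}

theorem isProbabilityMeasure_model (hg : Continuous g) :
    IsProbabilityMeasure (model D Λ g v) :=
  Measure.isProbabilityMeasure_map (Continuous.aemeasurable (by fun_prop))

theorem integral_model (hg : Continuous g) {f : Sample d → ℝ} (hf : Continuous f) {M : ℝ}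
    (hM : ∀ᵐ z ∂model D Λ g v, |f z| ≤ M) :
    ∫ z, f z ∂model D Λ g v = ∫ x, ∫ z, f (x, g (inner ℝ v x) + z) ∂Λ ∂D := by
  have hT : Continuous fun p : Vec d × ℝ => (p.1, g (inner ℝ v p.1) + p.2) := by fun_prop
  have := isProbabilityMeasure_model (D := D) (Λ := Λ) (v := v) hg
  have hi : Integrable f (model D Λ g v) := Integrable.of_bound hf.aestronglyMeasurable M hM
  rw [model] at hi ⊢
  rw [integral_map hT.aemeasurable hf.aestronglyMeasurable]
  exact integral_prod _ ((integrable_map_measure hf.aestronglyMeasurable hT.aemeasurable).1 hi)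

theorem integrable_of_gap (hg : LipschitzWith 1 g) (hD : ∀ᵐ x ∂D, ‖x‖ ≤ 1) (hv : ‖v‖ ≤ R)
    (hw : ‖w‖ ≤ R) {φ : ℝ → ℝ} (hφ : Continuous φ) :
    Integrable (fun x => φ (gap g v w x)) D := by
  obtain ⟨M, hM⟩ := (isCompact_Icc (a := -(2 * R)) (b := 2 * R)).exists_bound_of_continuousOn
    hφ.continuousOn
  refine Integrable.of_bound
    (hφ.comp (continuous_gap_right hg.continuous v w)).aestronglyMeasurable M ?_
  filter_upwards [hD] with x hx
  exact hM _ (abs_le.mp (abs_gap_le hg hv hw hx))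

/-- Given x, the coefficient has mean G(b + f) - c, where f is the gap and G is `meanRamp`. As G is
antitone and g monotone, G(b + f) - G(b) has the sign of (v - w)·x, and |f| ≤ |(v - w)·x|. Replacing
c by G(b) costs at most 2R |G(b) - c|. -/
theorem integral_coeff_ge (hg : LipschitzWith 1 g) (hmono : Monotone g) (hs : 0 < s)
    (hD : ∀ᵐ x ∂D, ‖x‖ ≤ 1) (hv : ‖v‖ ≤ R) (hw : ‖w‖ ≤ R) {b c : ℝ} (hc : |c| ≤ 2) :
    slack D Λ g s b v w - 2 * R * |meanRamp Λ s b - c| ≤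
      ∫ z, coeff g s b c w z * inner ℝ (v - w) z.1 ∂model D Λ g v := by
  have hvw : ‖v - w‖ ≤ 2 * R := (norm_sub_le _ _).trans (by linarith)
  have hcont : Continuous fun z : Sample d => coeff g s b c w z * inner ℝ (v - w) z.1 :=
    ((continuous_coeff hg.continuous s b c).comp
      (by fun_prop : Continuous fun z : Sample d => (w, z))).mul (by fun_prop)
  have hG := continuous_meanRamp (Λ := Λ) hs
  have hgap := continuous_gap_right hg.continuous v w
  rw [integral_model hg.continuous hcont (M := 6 * R)]
  · have h1 : ∀ x, ∫ z, coeff g s b c w (x, g (inner ℝ v x) + z) *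
        (inner ℝ (v - w) (x, g (inner ℝ v x) + z).1 : ℝ) ∂Λ =
        (meanRamp Λ s (b + gap g v w x) - c) * inner ℝ (v - w) x := by
      intro x
      refine (integral_mul_const (inner ℝ (v - w) x : ℝ)
        fun z => coeff g s b c w (x, g (inner ℝ v x) + z)).trans ?_
      congr 1
      have : ∀ z, coeff g s b c w (x, g (inner ℝ v x) + z) =
          ramp s (z - (b + gap g v w x)) - c := by
        intro z; unfold coeff gap; ring_nf
      simp only [this]
      rw [integral_sub (integrable_ramp _ _) (integrable_const _)]
      simp [meanRamp]
    simp only [h1]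
    have h2 : Integrable (fun x => |meanRamp Λ s (b + gap g v w x) - meanRamp Λ s b| *
        |gap g v w x|) D :=
      integrable_of_gap hg hD hv hw
        (φ := fun t => |meanRamp Λ s (b + t) - meanRamp Λ s b| * |t|) (by fun_prop)
    rw [slack, show 2 * R * |meanRamp Λ s b - c| = ∫ _, 2 * R * |meanRamp Λ s b - c| ∂D by simp,
      ← integral_sub h2 (integrable_const _)]
    refine integral_mono_ae (h2.sub (integrable_const _)) ?_ ?_
    · refine Integrable.of_bound (Continuous.aestronglyMeasurable (by fun_prop)) (3 * (2 * R)) ?_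
      filter_upwards [hD] with x hx
      rw [Real.norm_eq_abs, abs_mul]
      have := abs_meanRamp_le_one (Λ := Λ) (s := s) (b + gap g v w x)
      refine mul_le_mul ((abs_sub _ _).trans (by linarith)) (abs_inner_le hvw hx)
        (abs_nonneg _) (by norm_num)
    · filter_upwards [hD] with x hx
      have h3 := abs_inner_le hvw hx
      have h4 := abs_gap_le_inner hg v w x
      have hanti := meanRamp_antitone (Λ := Λ) hs
      have h5 : -(2 * R * |meanRamp Λ s b - c|) ≤
          (meanRamp Λ s b - c) * (inner ℝ (v - w) x : ℝ) := by
        refine le_trans ?_ (neg_abs_le _)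
        rw [abs_mul, mul_comm]
        have := mul_le_mul_of_nonneg_left h3 (abs_nonneg (meanRamp Λ s b - c))
        linarith
      have h6 : |meanRamp Λ s (b + gap g v w x) - meanRamp Λ s b| * |gap g v w x| ≤
          (meanRamp Λ s (b + gap g v w x) - meanRamp Λ s b) * (inner ℝ (v - w) x : ℝ) := by
        refine (mul_le_mul_of_nonneg_left h4 (abs_nonneg _)).trans (le_of_eq ?_)
        rw [← abs_mul]
        refine abs_of_nonneg ?_
        rcases le_total (inner ℝ w x : ℝ) (inner ℝ v x) with h | h
        · have hf : gap g v w x ≤ 0 := sub_nonpos.2 (hmono h)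
          have := hanti (show b + gap g v w x ≤ b by linarith)
          exact mul_nonneg (sub_nonneg.2 this) (by rw [inner_sub_left]; linarith)
        · have hf : 0 ≤ gap g v w x := sub_nonneg.2 (hmono h)
          have := hanti (show b ≤ b + gap g v w x by linarith)
          exact mul_nonneg_of_nonpos_of_nonpos (sub_nonpos.2 this)
            (by rw [inner_sub_left]; linarith)
      linarith
  · filter_upwards [ae_model hg.continuous hD] with z hz
    rw [abs_mul]
    have := mul_le_mul (abs_coeff_le (g := g) (s := s) (b := b) hc w z) (abs_inner_le hvw hz)
      (abs_nonneg _) (by norm_num)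
    linarith

/-- The expected tilted Huber loss, up to a constant. -/
theorem integral_sampleLoss (hg : LipschitzWith 1 g) (hs : 0 < s) (hD : ∀ᵐ x ∂D, ‖x‖ ≤ 1)
    (hv : ‖v‖ ≤ R) (hw : ‖w‖ ≤ R) {b c : ℝ} (hb : |b| ≤ 8 * R) (hc : |c| ≤ 2) :
    ∫ z, sampleLoss g s b c w z ∂model D Λ g v =
      ∫ x, pot Λ s c (b + gap g v w x) ∂D - ∫ x, pot Λ s c (gap g v 0 x) ∂D := by
  have hR : 0 ≤ R := (norm_nonneg v).trans hv
  have hcont : Continuous fun z : Sample d => sampleLoss g s b c w z :=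
    (continuous_sampleLoss hg.continuous s b c).comp
      (by fun_prop : Continuous fun z : Sample d => (w, z))
  have hpot := continuous_pot (Λ := Λ) hs c
  rw [integral_model hg.continuous hcont (M := 27 * R)]
  · rw [← integral_sub (integrable_of_gap hg hD hv hw (φ := fun t => pot Λ s c (b + t))
      (by fun_prop)) (integrable_of_gap hg hD hv (w := 0) (by simpa using hR) hpot)]
    congr 1
    funext x
    rw [pot_sub_eq hs]
    have : ∀ z, sampleLoss g s b c w (x, g (inner ℝ v x) + z) =
        (huber s (z - (b + gap g v w x)) - huber s (z - gap g v 0 x)) +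
          c * (b + gap g v w x - gap g v 0 x) := by
      intro z
      unfold sampleLoss huberGap shift gap
      simp only [inner_zero_left]
      ring_nf
    simp only [this]
    rw [integral_add (integrable_huber_sub hs _ _) (integrable_const _)]
    simp
  · filter_upwards [ae_model hg.continuous hD] with z hz
    exact abs_sampleLoss_le hg hs hb hc hw hz

/-- Small slack at offset zero forces a small excess loss. -/
theorem excessLoss_le_of_slack (hg : LipschitzWith 1 g) (hs : 0 < s) (hD : ∀ᵐ x ∂D, ‖x‖ ≤ 1)
    (hv : ‖v‖ ≤ R) (hw : ‖w‖ ≤ R) {κ : ℝ} (hκ0 : 0 < κ) (h₁ : κ ≤ Λ.real (Set.Icc 0 s))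
    (h₂ : κ ≤ Λ.real (Set.Icc (-s) 0)) :
    excessLoss D g w v ≤ 2 * s + slack D Λ g s 0 v w / κ := by
  have hG := continuous_meanRamp (Λ := Λ) hs
  have hi : Integrable (fun x => |meanRamp Λ s (0 + gap g v w x) - meanRamp Λ s 0| *
      |gap g v w x|) D :=
    integrable_of_gap hg hD hv hw
      (φ := fun t => |meanRamp Λ s (0 + t) - meanRamp Λ s 0| * |t|) (by fun_prop)
  have hj : Integrable (fun x => |gap g v w x|) D := integrable_of_gap hg hD hv hw continuous_abs
  rw [excessLoss, slack, ← integral_div, show 2 * s = ∫ _, 2 * s ∂D by simp,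
    ← integral_add (integrable_const _) (hi.div_const κ)]
  refine integral_mono hj ((integrable_const _).add (hi.div_const κ)) fun x => ?_
  simp only [zero_add]
  change |gap g v w x| ≤ _
  have hq := div_nonneg (mul_nonneg (abs_nonneg (meanRamp Λ s (gap g v w x) - meanRamp Λ s 0))
    (abs_nonneg (gap g v w x))) hκ0.le
  -- Gaps up to 2s are paid by the first term. Beyond, the anchor mass moves `meanRamp` by at least
  -- κ, so the slack integrand is at least κ times the gap.
  rcases le_or_gt (|gap g v w x|) (2 * s) with h | h
  · linarith
  · have hdrop : κ ≤ |meanRamp Λ s (gap g v w x) - meanRamp Λ s 0| := by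
      rcases lt_abs.1 h with h | h
      · rw [abs_sub_comm]
        exact (meanRamp_drop hs h₁ h.le).trans (le_abs_self _)
      · exact (meanRamp_rise hs h₂ (by linarith)).trans (le_abs_self _)
    have : |gap g v w x| ≤
        |meanRamp Λ s (gap g v w x) - meanRamp Λ s 0| * |gap g v w x| / κ := by
      rw [le_div_iff₀ hκ0, mul_comm]
      gcongr
    linarith

end

end

end ObliviousGLM

namespace ObliviousGLM

noncomputable section

/-! ### Concentration along the iteration -/

theorem sum_range_mul_div {B : ℕ} (hB : 0 < B) (f : ℕ → ℕ → ℝ) (T : ℕ) :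
    ∑ i ∈ Finset.range (T * B), f (i / B) i =
      ∑ t ∈ Finset.range T, ∑ j ∈ Finset.range B, f t (t * B + j) := by
  induction T with
  | zero => simp
  | succ T ih =>
    rw [Nat.succ_mul, Finset.sum_range_add, ih, Finset.sum_range_succ]
    congr 1
    refine Finset.sum_congr rfl fun j hj => ?_
    rw [mul_comm T B, Nat.mul_add_div hB, Nat.div_eq_of_lt (Finset.mem_range.1 hj), add_zero]

variable {d : ℕ} {g : ℝ → ℝ} {D : Measure (Vec d)} [IsProbabilityMeasure D] {Λ : Measure ℝ}
  [IsProbabilityMeasure Λ] {R s : ℝ} {v : Vec d}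

/-- Some iterate has small slack, if the tilt fits the offset. -/
theorem measure_slack_le (hg : LipschitzWith 1 g) (hmono : Monotone g) (hs : 0 < s) (hR : 0 < R)
    (hD : ∀ᵐ x ∂D, ‖x‖ ≤ 1) (hv : ‖v‖ ≤ R) {b c p q : ℝ} (hc : |c| ≤ 2) (hp : 0 < p)
    (hbc : 2 * R * |meanRamp Λ s b - c| ≤ p / 2) (hq : 20 * R / p ≤ q) {T B : ℕ}
    (hT : (T : ℝ) = q ^ 2) (hB : 0 < B) :
    (Measure.infinitePi fun _ : ℕ => model D Λ g v)
      {ω | ∀ t < T, p < slack D Λ g s b v (descent g R s (R / q / B) b c B ω t)} ≤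
      ENNReal.ofReal (Real.exp (-(B / 3))) := by
  have := isProbabilityMeasure_model (D := D) (Λ := Λ) (v := v) hg.continuous
  have hq0 : 0 < q := lt_of_lt_of_le (by positivity) hq
  have hT0 : 0 < T := by
    have : (0 : ℝ) < T := by rw [hT]; positivity
    exact_mod_cast this
  have hB' : (0 : ℝ) < B := by exact_mod_cast hB
  set W : ℕ → (ℕ → Sample d) → Vec d := fun t ω => descent g R s (R / q / B) b c B ω t with hW
  have hWR : ∀ t ω, ‖W t ω‖ ≤ R := fun t ω => norm_descent_le hR _ _ _ _ _ _ _
  -- The sign makes the upper tail the event of too little progress; `i / B` is the batch of sample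
  -- `i`.
  set F : ℕ → (ℕ → Sample d) → Sample d → ℝ := fun i ω z =>
    -(coeff g s b c (W (i / B) ω) z * inner ℝ (v - W (i / B) ω) z.1) with hF
  have hFm : ∀ i, Measurable fun p : (ℕ → Sample d) × Sample d => F i p.1 p.2 := by
    intro i
    have h1 : Continuous fun p : (ℕ → Sample d) × Sample d => W (i / B) p.1 :=
      (continuous_descent hg.continuous hR _ _ _ _ _ _).comp continuous_fst
    have h2 := (continuous_coeff hg.continuous s b c).comp (h1.prodMk continuous_snd)
    have h3 : Continuous fun p : (ℕ → Sample d) × Sample d =>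
        (inner ℝ (v - W (i / B) p.1) p.2.1 : ℝ) :=
      (continuous_const.sub h1).inner (continuous_fst.comp continuous_snd)
    exact (h2.mul h3).neg.measurable
  have hdep : ∀ i ω ω', (∀ j < i, ω j = ω' j) → F i ω = F i ω' := by
    intro i ω ω' h
    have : W (i / B) ω = W (i / B) ω' :=
      descent_congr fun j hj => h j (hj.trans_le (Nat.div_mul_le_self i B))
    simp only [hF, this]
  have hM : ∀ i ω, ∀ᵐ z ∂model D Λ g v, |F i ω z| ≤ 6 * R := by
    intro i ω
    filter_upwards [ae_model hg.continuous hD] with z hz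
    have hvw : ‖v - W (i / B) ω‖ ≤ 2 * R :=
      (norm_sub_le _ _).trans (by linarith [hWR (i / B) ω])
    simp only [hF]
    rw [abs_neg, abs_mul]
    have := mul_le_mul (abs_coeff_le (g := g) (s := s) (b := b) hc (W (i / B) ω) z)
      (abs_inner_le hvw hz) (abs_nonneg _) (by norm_num)
    linarith
  have hTB : (0 : ℝ) < (T * B : ℕ) := by exact_mod_cast Nat.mul_pos hT0 hB
  have key := measure_le_sum_le (P := model D Λ g v) hFm hdep (by positivity) hM
    (n := T * B) (Nat.mul_pos hT0 hB) (a := (T * B : ℕ) * p / 4) (by positivity)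
  -- The regret bound is pathwise and needs all features in the unit ball, which fails on a null set
  -- only.
  have hnull : (Measure.infinitePi fun _ : ℕ => model D Λ g v)
      {ω | ¬ ∀ i, ‖(ω i).1‖ ≤ 1} = 0 := by
    have : ∀ᵐ ω ∂(Measure.infinitePi fun _ : ℕ => model D Λ g v), ∀ i, ‖(ω i).1‖ ≤ 1 := by
      rw [ae_all_iff]
      intro i
      exact (measurePreserving_eval_infinitePi (fun _ : ℕ => model D Λ g v)
        i).quasiMeasurePreserving.ae (ae_model hg.continuous hD)
    exact this
  refine le_trans (measure_mono (t := {ω | (T * B : ℕ) * p / 4 ≤ ∑ i ∈ Finset.range (T * B),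
    (F i ω (ω i) - ∫ z, F i ω z ∂model D Λ g v)} ∪ {ω | ¬ ∀ i, ‖(ω i).1‖ ≤ 1}) ?_) ?_
  · intro ω hω
    rw [Set.mem_ofPred_eq] at hω
    by_cases hx : ∀ i, ‖(ω i).1‖ ≤ 1
    · left
      rw [Set.mem_ofPred_eq]
      have h1 := descent_regret (g := g) (s := s) (b := b) (v := v) hR hq0 hB hc hx hv hT
      -- If every slack exceeds p, each mean progress is at least p - p/2. The regret allows at most
      -- T B p/4 in total, so the sum deviates by at least T B p/4.
      have h2 : ∀ i ∈ Finset.range (T * B), p / 2 ≤ -∫ z, F i ω z ∂model D Λ g v := by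
        intro i hi
        have h3 := integral_coeff_ge (Λ := Λ) hg hmono hs hD hv (hWR (i / B) ω) (b := b) hc
        have h4 := hω (i / B) (Nat.div_lt_of_lt_mul (by
          rw [mul_comm]; exact Finset.mem_range.1 hi))
        simp only [hF]
        rw [integral_neg, neg_neg]
        simp only [hW] at h3 ⊢
        linarith
      rw [Finset.sum_sub_distrib, sub_eq_add_neg, ← Finset.sum_neg_distrib]
      have h5 := Finset.sum_le_sum h2
      rw [Finset.sum_const, Finset.card_range, nsmul_eq_mul] at h5
      have h6 := sum_range_mul_div hB (fun t i => -(coeff g s b c (W t ω) (ω i) *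
        (inner ℝ (v - W t ω) (ω i).1 : ℝ))) T
      simp only [Finset.sum_neg_distrib] at h6
      have h7 : 5 * R * q * B ≤ (T * B : ℕ) * p / 4 := by
        rw [div_le_iff₀ hp] at hq
        push_cast
        rw [hT]
        have : 0 ≤ q * B := by positivity
        nlinarith
      simp only [hF, Finset.sum_neg_distrib] at h5 ⊢
      rw [h6]
      simp only [hW] at h5 ⊢
      linarith
    · right; exact hx
  · refine (measure_union_le _ _).trans ?_
    rw [hnull, add_zero]
    -- The exponent is (T B p/4)²/(2 T B (6R)²) = B (q p)²/(1152 R²), and q p ≥ 20R makes it at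
    -- least B/3.
    refine key.trans (ENNReal.ofReal_le_ofReal (Real.exp_le_exp.2 (neg_le_neg ?_)))
    rw [le_div_iff₀ (by positivity)]
    rw [div_le_iff₀ hp] at hq
    have h8 : (20 * R) ^ 2 ≤ (q * p) ^ 2 := by gcongr
    push_cast
    rw [hT]
    have h9 : 0 ≤ (B : ℝ) ^ 2 * q ^ 2 := by positivity
    nlinarith

/-- The empirical loss of a vector that is independent of the holdout sample. -/
theorem measure_empLoss_le (hg : LipschitzWith 1 g) (hs : 0 < s) (hR : 0 < R)
    (hD : ∀ᵐ x ∂D, ‖x‖ ≤ 1) {b c p : ℝ} (hb : |b| ≤ 8 * R) (hc : |c| ≤ 2) (hp : 0 < p)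
    {N : ℕ} (hN : 0 < N) {W : (ℕ → Sample d) → Vec d} (hW : Continuous W)
    (hdep : ∀ ω ω', (∀ j < N, ω j = ω' j) → W ω = W ω') (hWR : ∀ ω, ‖W ω‖ ≤ R) :
    (Measure.infinitePi fun _ : ℕ => model D Λ g v)
      {ω | p < |empLoss g s b c N ω (W ω) -
        ∫ z, sampleLoss g s b c (W ω) z ∂model D Λ g v|} ≤
      2 * ENNReal.ofReal (Real.exp (-(N * p ^ 2 / (4 * (27 * R) ^ 2)))) := by
  have := isProbabilityMeasure_model (D := D) (Λ := Λ) (v := v) hg.continuous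
  have hN' : (0 : ℝ) < N := by exact_mod_cast hN
  have main : ∀ e : ℝ, |e| = 1 → (Measure.infinitePi fun _ : ℕ => model D Λ g v)
      {ω | N * p ≤ e * (N * (empLoss g s b c N ω (W ω) -
        ∫ z, sampleLoss g s b c (W ω) z ∂model D Λ g v))} ≤
      ENNReal.ofReal (Real.exp (-(N * p ^ 2 / (4 * (27 * R) ^ 2)))) := by
    intro e he
    -- The martingale bound is applied to 2N samples with the first N terms set to zero. Then `W ω`
    -- belongs to the past of every term that counts, at the price of a factor 2 in the exponent.
    set F : ℕ → (ℕ → Sample d) → Sample d → ℝ := fun i ω z =>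
      if i < N then 0 else e * sampleLoss g s b c (W ω) z with hF
    have hFm : ∀ i, Measurable fun p : (ℕ → Sample d) × Sample d => F i p.1 p.2 := by
      intro i
      by_cases hi : i < N
      · simp [hF, hi]
      · simp only [hF, hi, if_false]
        have h1 : Continuous fun p : (ℕ → Sample d) × Sample d => W p.1 := hW.comp continuous_fst
        exact (continuous_const.mul ((continuous_sampleLoss hg.continuous s b c).comp
          (h1.prodMk continuous_snd))).measurable
    have hFdep : ∀ i ω ω', (∀ j < i, ω j = ω' j) → F i ω = F i ω' := by
      intro i ω ω' h
      by_cases hi : i < N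
      · simp [hF, hi]
      · have := hdep ω ω' fun j hj => h j (by omega)
        simp only [hF, this]
    have hM : ∀ i ω, ∀ᵐ z ∂model D Λ g v, |F i ω z| ≤ 27 * R := by
      intro i ω
      filter_upwards [ae_model hg.continuous hD] with z hz
      by_cases hi : i < N
      · simp only [hF, hi, if_true, abs_zero]; positivity
      · simp only [hF, hi, if_false]
        rw [abs_mul, he, one_mul]
        exact abs_sampleLoss_le hg hs hb hc (hWR ω) hz
    have key := measure_le_sum_le (P := model D Λ g v) hFm hFdep (by positivity) hM
      (n := N + N) (by omega) (a := N * p) (by positivity)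
    have hexp : (N : ℝ) * p ^ 2 / (4 * (27 * R) ^ 2) =
        (N * p) ^ 2 / (2 * (N + N : ℕ) * (27 * R) ^ 2) := by
      push_cast; field_simp; ring
    rw [hexp]
    refine le_trans (measure_mono fun ω hω => ?_) key
    rw [Set.mem_ofPred_eq] at hω ⊢
    refine hω.trans (le_of_eq ?_)
    rw [Finset.sum_range_add]
    have h1 : ∑ i ∈ Finset.range N, (F i ω (ω i) - ∫ z, F i ω z ∂model D Λ g v) = 0 := by
      refine Finset.sum_eq_zero fun i hi => ?_
      simp [hF, Finset.mem_range.1 hi]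
    have h2 : ∀ i, F (N + i) ω (ω (N + i)) - ∫ z, F (N + i) ω z ∂model D Λ g v =
        e * (sampleLoss g s b c (W ω) (ω (N + i)) -
          ∫ z, sampleLoss g s b c (W ω) z ∂model D Λ g v) := by
      intro i
      simp only [hF, show ¬ N + i < N by omega, if_false]
      rw [integral_const_mul]; ring
    simp only [h1, h2, zero_add]
    rw [← Finset.mul_sum, Finset.sum_sub_distrib, Finset.sum_const, Finset.card_range,
      nsmul_eq_mul, empLoss, huberSum, shiftSum, mul_sub, mul_div_cancel₀ _ hN'.ne', Finset.mul_sum,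
      ← Finset.sum_add_distrib]
    rfl
  rw [two_mul]
  refine le_trans (measure_mono (t := _ ∪ _) fun ω hω => ?_) ((measure_union_le _ _).trans
    (add_le_add (main 1 (by simp)) (main (-1) (by simp))))
  rw [Set.mem_ofPred_eq] at hω
  rcases lt_abs.1 hω with h | h
  · left
    rw [Set.mem_ofPred_eq, one_mul]
    exact mul_le_mul_of_nonneg_left h.le hN'.le
  · right
    rw [Set.mem_ofPred_eq]
    have := mul_le_mul_of_nonneg_left h.le hN'.le
    linarith

end

end ObliviousGLM

namespace ObliviousGLM

noncomputable section

/-! ### Comparison of population losses -/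

theorem exists_nat_near {M : ℕ} (hM : 0 < M) {x : ℝ} (h0 : 0 ≤ x) (hx : x ≤ M) :
    ∃ k < M, (k : ℝ) ≤ x ∧ x ≤ k + 1 := by
  rcases hx.eq_or_lt with rfl | hx
  -- The right end point is assigned to the last cell.
  · refine ⟨M - 1, by omega, by simp, ?_⟩
    rw [← Nat.cast_succ, Nat.succ_eq_add_one, Nat.sub_add_cancel hM]
  · exact ⟨⌊x⌋₊, (Nat.floor_lt h0).2 hx, Nat.floor_le h0, (Nat.lt_floor_add_one x).le⟩

/-- The tilts are the midpoints of `M` equal cells of [-1, 1]. -/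
theorem exists_tilt_near {M : ℕ} (hM : 0 < M) {y : ℝ} (hy : |y| ≤ 1) :
    ∃ k < M, |y - tilt M k| ≤ 1 / M := by
  have hM' : (0 : ℝ) < M := by exact_mod_cast hM
  obtain ⟨h1, h2⟩ := abs_le.mp hy
  obtain ⟨k, hk, h3, h4⟩ := exists_nat_near hM (x := (y + 1) * M / 2) (by
    have : 0 ≤ y + 1 := by linarith
    positivity) (by nlinarith)
  refine ⟨k, hk, ?_⟩
  have : y - tilt M k = (2 * ((y + 1) * M / 2) - (2 * k + 1)) / M := by
    unfold tilt; push_cast; field_simp; ring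
  rw [this, abs_div, abs_of_pos hM']
  gcongr
  exact abs_le.2 ⟨by linarith, by linarith⟩

theorem exists_offset_near {M : ℕ} (hM : 0 < M) {R b : ℝ} (hR : 0 < R) (hb : |b| ≤ 8 * R) :
    ∃ k < M, |b - offset R M k| ≤ 16 * R / M := by
  have hM' : (0 : ℝ) < M := by exact_mod_cast hM
  obtain ⟨h1, h2⟩ := abs_le.mp hb
  obtain ⟨k, hk, h3, h4⟩ := exists_nat_near hM (x := (b + 8 * R) * M / (16 * R)) (by
    have : 0 ≤ b + 8 * R := by linarith
    positivity) (by rw [div_le_iff₀ (by positivity)]; nlinarith)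
  refine ⟨k, hk, ?_⟩
  have : b - offset R M k = 16 * R / M * ((b + 8 * R) * M / (16 * R) - k) := by
    unfold offset; field_simp; ring
  rw [this, abs_mul, abs_of_nonneg (by positivity)]
  refine mul_le_of_le_one_right (by positivity) (abs_le.2 ⟨by linarith, by linarith⟩)

theorem abs_tilt_le {M k : ℕ} (hk : k < M) : |tilt M k| ≤ 1 := by
  have hM' : (0 : ℝ) < M := by exact_mod_cast (Nat.zero_le k).trans_lt hk
  have h1 : ((2 * k + 1 : ℕ) : ℝ) / M ≤ 2 := by
    rw [div_le_iff₀ hM']; exact_mod_cast (by omega : 2 * k + 1 ≤ 2 * M)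
  have h2 : 0 ≤ ((2 * k + 1 : ℕ) : ℝ) / M := by positivity
  unfold tilt
  exact abs_le.2 ⟨by linarith, by linarith⟩

theorem abs_offset_le {M k : ℕ} (hk : k < M) {R : ℝ} (hR : 0 < R) : |offset R M k| ≤ 8 * R := by
  have hM' : (0 : ℝ) < M := by exact_mod_cast (Nat.zero_le k).trans_lt hk
  have h1 : (k : ℝ) / M ≤ 1 := by rw [div_le_one hM']; exact_mod_cast hk.le
  have h2 : 0 ≤ (k : ℝ) / M := by positivity
  unfold offset
  exact abs_le.2 ⟨by nlinarith, by nlinarith⟩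

/-- The expected tilted Huber loss of `g (w ⬝ x) + b`, up to a constant. -/
def popLoss {d : ℕ} (D : Measure (Vec d)) (Λ : Measure ℝ) (g : ℝ → ℝ) (s b c : ℝ) (v w : Vec d) :
    ℝ :=
  ∫ x, pot Λ s c (b + gap g v w x) ∂D

variable {d : ℕ} {g : ℝ → ℝ} {D : Measure (Vec d)} [IsProbabilityMeasure D] {Λ : Measure ℝ}
  [IsProbabilityMeasure Λ] {R s : ℝ} {v w : Vec d}

theorem integrable_popLoss (hg : LipschitzWith 1 g) (hs : 0 < s) (hD : ∀ᵐ x ∂D, ‖x‖ ≤ 1)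
    (hv : ‖v‖ ≤ R) (hw : ‖w‖ ≤ R) (b c : ℝ) :
    Integrable (fun x => pot Λ s c (b + gap g v w x)) D := by
  have := continuous_pot (Λ := Λ) hs c
  exact integrable_of_gap hg hD hv hw (φ := fun t => pot Λ s c (b + t)) (by fun_prop)

/-- The loss of a vector with small slack at offset `b`. -/
theorem popLoss_le (hg : LipschitzWith 1 g) (hs : 0 < s) (hD : ∀ᵐ x ∂D, ‖x‖ ≤ 1)
    (hv : ‖v‖ ≤ R) (hw : ‖w‖ ≤ R) (b c : ℝ) :
    popLoss D Λ g s b c v w ≤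
      pot Λ s c b + slack D Λ g s b v w + |c - meanRamp Λ s b| * excessLoss D g w v := by
  have hG := continuous_meanRamp (Λ := Λ) hs
  have hi : Integrable (fun x => |meanRamp Λ s (b + gap g v w x) - meanRamp Λ s b| *
      |gap g v w x|) D :=
    integrable_of_gap hg hD hv hw
      (φ := fun t => |meanRamp Λ s (b + t) - meanRamp Λ s b| * |t|) (by fun_prop)
  have hj : Integrable (fun x => |gap g v w x|) D := integrable_of_gap hg hD hv hw continuous_abs
  have he : excessLoss D g w v = ∫ x, |gap g v w x| ∂D := rfl
  have hc : pot Λ s c b = ∫ _, pot Λ s c b ∂D := by simp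
  have hci : Integrable (fun x => pot Λ s c b +
      |meanRamp Λ s (b + gap g v w x) - meanRamp Λ s b| * |gap g v w x|) D :=
    (integrable_const _).add hi
  rw [popLoss, slack, he, hc, ← integral_const_mul, ← integral_add (integrable_const _) hi,
    ← integral_add hci (hj.const_mul _)]
  refine integral_mono (integrable_popLoss hg hs hD hv hw b c) (hci.add (hj.const_mul _))
    fun x => ?_
  have h1 := pot_sub_le (Λ := Λ) hs c (b + gap g v w x) b
  rw [add_sub_cancel_left] at h1
  set f := gap g v w x
  have h2 : (c - meanRamp Λ s (b + f)) * f =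
      (meanRamp Λ s b - meanRamp Λ s (b + f)) * f + (c - meanRamp Λ s b) * f := by ring
  have h3 : (meanRamp Λ s b - meanRamp Λ s (b + f)) * f ≤
      |meanRamp Λ s (b + f) - meanRamp Λ s b| * |f| := by
    rw [abs_sub_comm, ← abs_mul]; exact le_abs_self _
  have h4 : (c - meanRamp Λ s b) * f ≤ |c - meanRamp Λ s b| * |f| := by
    rw [← abs_mul]; exact le_abs_self _
  linarith

theorem excessLoss_le (hg : LipschitzWith 1 g) (hD : ∀ᵐ x ∂D, ‖x‖ ≤ 1) (hv : ‖v‖ ≤ R)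
    (hw : ‖w‖ ≤ R) : excessLoss D g w v ≤ 2 * R := by
  have hj : Integrable (fun x => |gap g v w x|) D := integrable_of_gap hg hD hv hw continuous_abs
  have h2 : 2 * R = ∫ _, 2 * R ∂D := by simp
  rw [h2]
  refine integral_mono_ae hj (integrable_const _) ?_
  filter_upwards [hD] with x hx
  exact abs_gap_le hg hv hw hx

/-- Offset zero is almost optimal for tilts near `meanRamp Λ s 0`. -/
theorem pot_zero_le (hs : 0 < s) {κ c t θ : ℝ} (h₁ : κ ≤ Λ.real (Set.Icc 0 s))
    (h₂ : κ ≤ Λ.real (Set.Icc (-s) 0)) (hc : |c - meanRamp Λ s 0| ≤ θ) (hθ : θ ≤ κ) :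
    pot Λ s c 0 ≤ pot Λ s c t + θ * (2 * s) := by
  obtain ⟨hc1, hc2⟩ := abs_le.mp hc
  -- On [-2s, 2s] the slope at zero costs at most θ · 2s. At ±2s the slope points outwards, because
  -- `meanRamp` has moved by κ ≥ θ, so by convexity the loss does not decrease further out.
  have near : ∀ u, |u| ≤ 2 * s → pot Λ s c 0 ≤ pot Λ s c u + θ * (2 * s) := by
    intro u hu
    have h := pot_sub_le (Λ := Λ) hs c 0 u
    have h' : (c - meanRamp Λ s 0) * (0 - u) ≤ θ * (2 * s) := by
      refine (le_abs_self _).trans ?_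
      rw [abs_mul, zero_sub, abs_neg]
      exact mul_le_mul hc hu (abs_nonneg _) ((abs_nonneg _).trans hc)
    linarith
  rcases le_or_gt |t| (2 * s) with ht | ht
  · exact near t ht
  · rcases lt_abs.1 ht with ht | ht
    · have h := pot_sub_ge (Λ := Λ) hs c t (2 * s)
      have h3 := meanRamp_drop hs h₁ le_rfl
      have h4 : 0 ≤ (c - meanRamp Λ s (2 * s)) * (t - 2 * s) :=
        mul_nonneg (by linarith) (by linarith)
      have := near (2 * s) (abs_of_pos (by positivity)).le
      linarith
    · have h := pot_sub_ge (Λ := Λ) hs c t (-(2 * s))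
      have h3 := meanRamp_rise hs h₂ le_rfl
      have h4 : 0 ≤ (c - meanRamp Λ s (-(2 * s))) * (t - -(2 * s)) :=
        mul_nonneg_of_nonpos_of_nonpos (by linarith) (by linarith)
      have := near (-(2 * s)) (by rw [abs_neg, abs_of_pos (by positivity)])
      linarith

/-- A vector with small slack at offset zero has nearly the least loss among all predictors. -/
theorem popLoss_zero_le (hg : LipschitzWith 1 g) (hs : 0 < s) (hD : ∀ᵐ x ∂D, ‖x‖ ≤ 1)
    (hv : ‖v‖ ≤ R) (hw : ‖w‖ ≤ R) {κ c : ℝ} (hκ0 : 0 < κ) (h₁ : κ ≤ Λ.real (Set.Icc 0 s))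
    (h₂ : κ ≤ Λ.real (Set.Icc (-s) 0)) (hc : |c - meanRamp Λ s 0| ≤ 3 * κ / 5)
    (hQ : slack D Λ g s 0 v w ≤ κ * s) (t : ℝ) :
    popLoss D Λ g s 0 c v w ≤ pot Λ s c t + 4 * (κ * s) := by
  have h3 := popLoss_le (Λ := Λ) hg hs hD hv hw 0 c
  have h4 := excessLoss_le_of_slack hg hs hD hv hw hκ0 h₁ h₂
  have h5 := pot_zero_le hs (t := t) h₁ h₂ hc (by linarith)
  have h6 : slack D Λ g s 0 v w / κ ≤ s := by rw [div_le_iff₀ hκ0]; linarith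
  -- The excess loss is at most 3s, so this term is 9κs/5. With the slack κs and the offset error
  -- (3κ/5)(2s) the total is 4κs.
  have h7 : |c - meanRamp Λ s 0| * excessLoss D g w v ≤ 3 * κ / 5 * (3 * s) :=
    mul_le_mul hc (by linarith) (integral_nonneg fun x => abs_nonneg _) (by positivity)
  linarith

theorem le_popLoss (hg : LipschitzWith 1 g) (hs : 0 < s) (hD : ∀ᵐ x ∂D, ‖x‖ ≤ 1)
    (hv : ‖v‖ ≤ R) (hw : ‖w‖ ≤ R) {b c a : ℝ} (h : ∀ t, a ≤ pot Λ s c t) :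
    a ≤ popLoss D Λ g s b c v w := by
  have h2 : a = ∫ _, a ∂D := by simp
  rw [h2]
  exact integral_mono (integrable_const _) (integrable_popLoss hg hs hD hv hw b c) fun x => h _

/-- The loss of the zero vector at an offset below all relevant values, for a large tilt. -/
theorem popLoss_low (hg : LipschitzWith 1 g) (hs : 0 < s) (hR : 0 < R) (hD : ∀ᵐ x ∂D, ‖x‖ ≤ 1)
    (hv : ‖v‖ ≤ R) {c t : ℝ} (hc : meanRamp Λ s (-(8 * R)) ≤ c) (ht : |t| ≤ 2 * R) :
    popLoss D Λ g s (-(4 * R)) c v 0 ≤ pot Λ s c t := by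
  have h2 : pot Λ s c t = ∫ _, pot Λ s c t ∂D := by simp
  rw [h2]
  refine integral_mono_ae (integrable_popLoss hg hs hD hv (by simpa using hR.le) _ c)
    (integrable_const _) ?_
  filter_upwards [hD] with x hx
  -- The offset plus gap lies in [-6R, -2R], to the left of `t`, and the potential is nondecreasing
  -- on [-8R, ∞) for such a tilt.
  have h3 := abs_le.mp (abs_gap_le hg hv (w := 0) (by simpa using hR.le) hx)
  have h4 := pot_sub_le (Λ := Λ) hs c (-(4 * R) + gap g v 0 x) t
  have h5 := meanRamp_antitone (Λ := Λ) hs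
    (show -(8 * R) ≤ -(4 * R) + gap g v 0 x by linarith)
  have h6 := mul_nonpos_of_nonneg_of_nonpos
    (show 0 ≤ c - meanRamp Λ s (-(4 * R) + gap g v 0 x) by linarith)
    (show -(4 * R) + gap g v 0 x - t ≤ 0 by linarith [(abs_le.mp ht).1])
  linarith

/-- The loss of the zero vector at an offset above all relevant values, for a small tilt. -/
theorem popLoss_high (hg : LipschitzWith 1 g) (hs : 0 < s) (hR : 0 < R) (hD : ∀ᵐ x ∂D, ‖x‖ ≤ 1)
    (hv : ‖v‖ ≤ R) {c t : ℝ} (hc : c ≤ meanRamp Λ s (8 * R)) (ht : |t| ≤ 2 * R) :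
    popLoss D Λ g s (4 * R) c v 0 ≤ pot Λ s c t := by
  have h2 : pot Λ s c t = ∫ _, pot Λ s c t ∂D := by simp
  rw [h2]
  refine integral_mono_ae (integrable_popLoss hg hs hD hv (by simpa using hR.le) _ c)
    (integrable_const _) ?_
  filter_upwards [hD] with x hx
  have h3 := abs_le.mp (abs_gap_le hg hv (w := 0) (by simpa using hR.le) hx)
  have h4 := pot_sub_le (Λ := Λ) hs c (4 * R + gap g v 0 x) t
  have h5 := meanRamp_antitone (Λ := Λ) hs
    (show 4 * R + gap g v 0 x ≤ 8 * R by linarith)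
  have h6 := mul_nonpos_of_nonpos_of_nonneg
    (show c - meanRamp Λ s (4 * R + gap g v 0 x) ≤ 0 by linarith)
    (show 0 ≤ 4 * R + gap g v 0 x - t by linarith [(abs_le.mp ht).2])
  linarith

/-- A vector with nearly the least loss for two tilts has nearly constant difference to the
target. -/
theorem integral_abs_gap_sub_le (hg : LipschitzWith 1 g) (hs : 0 < s) (hR : 0 < R)
    (hD : ∀ᵐ x ∂D, ‖x‖ ≤ 1) (hv : ‖v‖ ≤ R) (hw : ‖w‖ ≤ R) {c κ ε : ℝ} (hκ : 0 < κ)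
    (h₁ : ∀ t, |t| ≤ 2 * R → popLoss D Λ g s 0 (c + κ) v w ≤ pot Λ s (c + κ) t + ε)
    (h₂ : ∀ t, |t| ≤ 2 * R → popLoss D Λ g s 0 (c - κ) v w ≤ pot Λ s (c - κ) t + ε) :
    ∃ m, ∫ x, |gap g v w x - m| ∂D ≤ 2 * ε / κ := by
  -- Minimisers are taken over [-2R, 2R], which almost surely contains the gap; on the whole line
  -- there may be none.
  have hmin : ∀ c', ∃ m, |m| ≤ 2 * R ∧ ∀ t, |t| ≤ 2 * R → pot Λ s c' m ≤ pot Λ s c' t := by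
    intro c'
    obtain ⟨m, hm, h⟩ := (isCompact_Icc (a := -(2 * R)) (b := 2 * R)).exists_isMinOn
      ⟨0, by constructor <;> linarith⟩ (continuous_pot (Λ := Λ) hs c').continuousOn
    exact ⟨m, abs_le.2 hm, fun t ht => h (abs_le.mp ht)⟩
  obtain ⟨m, hm, h0⟩ := hmin c
  obtain ⟨m₁, hm₁, h3⟩ := hmin (c + κ)
  obtain ⟨m₂, hm₂, h4⟩ := hmin (c - κ)
  refine ⟨m, ?_⟩
  have hi := integrable_popLoss (Λ := Λ) hg hs hD hv hw 0 (c + κ)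
  have hj := integrable_popLoss (Λ := Λ) hg hs hD hv hw 0 (c - κ)
  have hk : Integrable (fun x => |gap g v w x - m|) D :=
    integrable_of_gap hg hD hv hw (φ := fun t => |t - m|) (by fun_prop)
  have hi' : Integrable (fun x => pot Λ s (c + κ) (0 + gap g v w x) - pot Λ s (c + κ) m₁) D :=
    hi.sub (integrable_const _)
  have hj' : Integrable (fun x => pot Λ s (c - κ) (0 + gap g v w x) - pot Λ s (c - κ) m₂) D :=
    hj.sub (integrable_const _)
  rw [le_div_iff₀ hκ]
  have key : ∫ x, |gap g v w x - m| * κ ∂D ≤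
      ∫ x, ((pot Λ s (c + κ) (0 + gap g v w x) - pot Λ s (c + κ) m₁) +
        (pot Λ s (c - κ) (0 + gap g v w x) - pot Λ s (c - κ) m₂)) ∂D := by
    refine integral_mono_ae (hk.mul_const κ) (hi'.add hj') ?_
    filter_upwards [hD] with x hx
    have hf := abs_gap_le hg hv hw hx
    simp only [zero_add]
    set f := gap g v w x
    have a1 := h3 f hf
    have a2 := h4 f hf
    have a3 := h0 f hf
    have a4 := h3 m hm
    have a5 := h4 m hm
    have b1 := pot_tilt Λ s c (c + κ) f
    have b2 := pot_tilt Λ s c (c + κ) m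
    have b3 := pot_tilt Λ s c (c - κ) f
    have b4 := pot_tilt Λ s c (c - κ) m
    -- To the right of `m` the tilt `c + κ` adds κ(f - m) to a nonnegative difference of potentials,
    -- to the left `c - κ` adds κ(m - f). The other summand is nonnegative by minimality.
    rcases le_total m f with h | h
    · rw [abs_of_nonneg (sub_nonneg.2 h)]
      linarith
    · rw [abs_of_nonpos (sub_nonpos.2 h)]
      linarith
  rw [integral_mul_const, integral_add hi' hj', integral_sub hi (integrable_const _),
    integral_sub hj (integrable_const _)] at key
  have c1 := h₁ m₁ hm₁
  have c2 := h₂ m₂ hm₂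
  unfold popLoss at c1 c2
  simp only [integral_const, probReal_univ, smul_eq_mul, one_mul] at key
  linarith

/-- Identifiability, in the contrapositive. -/
theorem Identifiable.excessLoss_le_of_integral {Δ τ m : ℝ} (h : Identifiable D g Δ τ)
    (hτ : 0 < τ) (hg : LipschitzWith 1 g) (hD : ∀ᵐ x ∂D, ‖x‖ ≤ 1)
    (hv : ‖v‖ ≤ R) (hw : ‖w‖ ≤ R) (hm : ∫ x, |gap g v w x - m| ∂D ≤ τ ^ 2) :
    excessLoss D g w v ≤ Δ := by
  by_contra! hlt
  have h1 := h w v hlt m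
  have hk : Integrable (fun x => |gap g v w x - m|) D :=
    integrable_of_gap hg hD hv hw (φ := fun t => |t - m|) (by fun_prop)
  have h2 := mul_meas_ge_le_integral_of_nonneg
    (Filter.Eventually.of_forall fun x => abs_nonneg (gap g v w x - m)) hk τ
  have h3 : D.real {x | τ < |g (inner ℝ w x) - g (inner ℝ v x) - m|} ≤
      D.real {x | τ ≤ |gap g v w x - m|} :=
    measureReal_mono fun x hx => le_of_lt (show τ < |gap g v w x - m| from hx)
  -- Markov's inequality bounds τ times the probability by τ², while identifiability makes the
  -- probability exceed τ.
  nlinarith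

end

end ObliviousGLM

namespace ObliviousGLM

noncomputable section

/-! ### The selection of a candidate -/

/-- The events on which the selection succeeds. -/
structure GoodRun {d : ℕ} (D : Measure (Vec d)) (Λ : Measure ℝ) (g : ℝ → ℝ) (R s η κ p : ℝ)
    (T B N : ℕ) (ω : ℕ → Sample d) (v : Vec d) : Prop where
  fit_zero : ∀ k < T, 2 * R * |meanRamp Λ s 0 - tilt T k| ≤ p / 2 →
    ∃ t < T, slack D Λ g s 0 v (descent g R s η 0 (tilt T k) B ω t) ≤ p
  fit_offset : ∀ k < T, ∀ i < T, ∀ c, (c = tilt T k + κ ∨ c = tilt T k - κ) →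
    2 * R * |meanRamp Λ s (offset R T i) - c| ≤ p / 2 →
    ∃ t < T, slack D Λ g s (offset R T i) v (descent g R s η (offset R T i) c B ω t) ≤ p
  loss_zero : ∀ k < T, ∀ t < T, ∀ c, (c = tilt T k + κ ∨ c = tilt T k - κ) →
    |iterLoss g R s η B N ω 0 (tilt T k) c t -
      ∫ z, sampleLoss g s 0 c (descent g R s η 0 (tilt T k) B ω t) z ∂model D Λ g v| ≤ p
  loss_offset : ∀ k < T, ∀ i < T, ∀ t < T, ∀ c, (c = tilt T k + κ ∨ c = tilt T k - κ) →
    |iterLoss g R s η B N ω (offset R T i) c c t -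
      ∫ z, sampleLoss g s (offset R T i) c (descent g R s η (offset R T i) c B ω t) z
        ∂model D Λ g v| ≤ p

variable {d : ℕ} {g : ℝ → ℝ} {D : Measure (Vec d)} [IsProbabilityMeasure D] {Λ : Measure ℝ}
  [IsProbabilityMeasure Λ] {R s η κ : ℝ} {T B N : ℕ} {ω : ℕ → Sample d} {v : Vec d}

theorem abs_le_two_of_tilt {k : ℕ} (hk : k < T) (hκ : 0 ≤ κ) (hκ1 : κ ≤ 1) {c : ℝ}
    (hc : c = tilt T k + κ ∨ c = tilt T k - κ) : |c| ≤ 2 := by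
  obtain ⟨h1, h2⟩ := abs_le.mp (abs_tilt_le hk)
  rcases hc with rfl | rfl <;> exact abs_le.2 ⟨by linarith, by linarith⟩

/-- Some iterate competes with any constant offset. -/
theorem GoodRun.exists_competitor (hg : LipschitzWith 1 g) (hs : 0 < s) (hR : 0 < R)
    (hD : ∀ᵐ x ∂D, ‖x‖ ≤ 1) (hv : ‖v‖ ≤ R) (hκ : 0 < κ) (hT : 0 < T) (hT4 : 4 ∣ T)
    (hTs : 64 * R ^ 2 ≤ T * s * (2 * κ * s)) {c : ℝ} {k : ℕ} (hk : k < T)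
    (hc : c = tilt T k + κ ∨ c = tilt T k - κ)
    (h : GoodRun D Λ g R s η κ (2 * κ * s) T B N ω v) {a : ℝ} (ha : |a| ≤ 2 * R) :
    ∃ i < T, ∃ t < T, popLoss D Λ g s (offset R T i) c v
      (descent g R s η (offset R T i) c B ω t) ≤ pot Λ s c a + 4 * (2 * κ * s) := by
  have hT' : (0 : ℝ) < T := by exact_mod_cast hT
  have hG := meanRamp_antitone (Λ := Λ) hs
  obtain ⟨n, rfl⟩ := hT4
  have hn : (0 : ℝ) < n := by
    have : 0 < n := by omega
    exact_mod_cast this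
  have hp : 0 < 2 * κ * s := by positivity
  -- For a tilt beyond the values of `meanRamp` on [-8R, 8R] the potential is monotone there, and
  -- the zero vector, which is iterate 0, beats all constants at offset -4R or 4R. Both are grid
  -- points since 4 divides `T`.
  rcases le_or_gt (meanRamp Λ s (-(8 * R))) c with h1 | h1
  · refine ⟨n, by omega, 0, hT, ?_⟩
    have : offset R (4 * n) n = -(4 * R) := by
      unfold offset; push_cast; field_simp; ring
    rw [this]
    exact (popLoss_low hg hs hR hD hv h1 ha).trans (by linarith)
  rcases le_or_gt c (meanRamp Λ s (8 * R)) with h2 | h2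
  · refine ⟨3 * n, by omega, 0, hT, ?_⟩
    have : offset R (4 * n) (3 * n) = 4 * R := by
      unfold offset; push_cast; field_simp; ring
    rw [this]
    exact (popLoss_high hg hs hR hD hv h2 ha).trans (by linarith)
  -- Otherwise the tilt is the value of `meanRamp` at some offset, and the nearest grid offset fits
  -- up to the Lipschitz error 16R/(T s).
  obtain ⟨b, hb, rfl⟩ := intermediate_value_Icc' (show -(8 * R) ≤ 8 * R by linarith)
    (continuous_meanRamp (Λ := Λ) hs).continuousOn ⟨h2.le, h1.le⟩
  obtain ⟨i, hi, hbi⟩ := exists_offset_near hT hR (abs_le.2 hb)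
  have hoff := abs_offset_le hi hR
  have hfit : 2 * R * |meanRamp Λ s (offset R (4 * n) i) - meanRamp Λ s b| ≤ 2 * κ * s / 2 := by
    have h3 := abs_meanRamp_sub_le (Λ := Λ) hs (offset R (4 * n) i) b
    rw [abs_sub_comm (offset R (4 * n) i)] at h3
    have h4 : |meanRamp Λ s (offset R (4 * n) i) - meanRamp Λ s b| ≤
        16 * R / (4 * n : ℕ) / s := h3.trans (by gcongr)
    have h5 := mul_le_mul_of_nonneg_left h4 (show 0 ≤ 2 * R by positivity)
    refine h5.trans ?_
    rw [div_div, mul_div_assoc', div_le_iff₀ (by positivity)]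
    nlinarith
  obtain ⟨t, ht, hslack⟩ := h.fit_offset k hk i hi _ hc hfit
  refine ⟨i, hi, t, ht, ?_⟩
  have hw := norm_descent_le (g := g) hR s η (offset R (4 * n) i) (meanRamp Λ s b) B ω t
  have h6 := popLoss_le (Λ := Λ) hg hs hD hv hw (offset R (4 * n) i) (meanRamp Λ s b)
  have h7 := excessLoss_le hg hD hv hw
  have h8 := pot_sub_le (Λ := Λ) hs (meanRamp Λ s b) (offset R (4 * n) i) a
  -- With p = 2κs, the errors 10R|·| and 2R|·| add up to 6 · 2R|·| ≤ 3p by `hfit`; the slack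
  -- contributes one more p.
  have h9 : (meanRamp Λ s b - meanRamp Λ s (offset R (4 * n) i)) * (offset R (4 * n) i - a) ≤
      |meanRamp Λ s (offset R (4 * n) i) - meanRamp Λ s b| * (10 * R) := by
    refine (le_abs_self _).trans ?_
    rw [abs_mul, abs_sub_comm]
    gcongr
    exact (abs_sub _ _).trans (by linarith)
  have h10 : |meanRamp Λ s b - meanRamp Λ s (offset R (4 * n) i)| *
      excessLoss D g (descent g R s η (offset R (4 * n) i) (meanRamp Λ s b) B ω t) v ≤
      |meanRamp Λ s (offset R (4 * n) i) - meanRamp Λ s b| * (2 * R) := by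
    rw [abs_sub_comm]; gcongr
  linarith

/-- The candidate of least score is accurate, up to a constant shift. -/
theorem GoodRun.integral_abs_gap_sub_le (hg : LipschitzWith 1 g) (hs : 0 < s) (hR : 0 < R)
    (hsR : 8 * s ≤ R) (hD : ∀ᵐ x ∂D, ‖x‖ ≤ 1) (hv : ‖v‖ ≤ R) (hκ : 0 < κ) (hκ1 : κ ≤ 1)
    (h₁ : 2 * κ ≤ Λ.real (Set.Icc 0 s)) (h₂ : 2 * κ ≤ Λ.real (Set.Icc (-s) 0)) (hT : 0 < T)
    (hT4 : 4 ∣ T) (hTs : 64 * R ^ 2 ≤ T * s * (2 * κ * s)) (hTκ : 1 / T ≤ κ / 5)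
    (hTR : 2 * R / T ≤ κ * s) (h : GoodRun D Λ g R s η κ (2 * κ * s) T B N ω v) {u : Vec d} {β : ℝ}
    (hu : Best (candidates g R s η κ T B N ω T 0) (1000 * R) u β) :
    ‖u‖ ≤ R ∧ ∃ m, ∫ x, |gap g v u x - m| ∂D ≤ 52 * s := by
  have hT' : (0 : ℝ) < T := by exact_mod_cast hT
  have hp : 0 < 2 * κ * s := by positivity
  have hpR : 2 * κ * s ≤ R := by nlinarith
  have hW : ∀ b c t, ‖descent g R s η b c B ω t‖ ≤ R := fun b c t => norm_descent_le hR s η b c B ω t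
  obtain ⟨k, hk, hkG⟩ := exists_tilt_near hT (abs_meanRamp_le_one (Λ := Λ) (s := s) 0)
  obtain ⟨t, ht, hslack⟩ := h.fit_zero k hk (by
    have := mul_le_mul_of_nonneg_left hkG (show 0 ≤ 2 * R by positivity)
    rw [mul_one_div] at this
    linarith)
  -- With p = 2κs, two estimation errors and the 4p of `popLoss_zero_le` add up to 6p. If the scan
  -- ended at its initial value, the difference is negative, because the expected loss is at most
  -- 27R.
  have hgood : ∀ c, (c = tilt T k + κ ∨ c = tilt T k - κ) →
      iterLoss g R s η B N ω 0 (tilt T k) c t - scanMin g R s η T B N ω c ≤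
        6 * (2 * κ * s) := by
    intro c hc
    have hc2 := abs_le_two_of_tilt hk hκ.le hκ1 hc
    have h0 := (abs_le.mp (h.loss_zero k hk t ht c hc)).2
    rcases (isLeast_scanMin (g := g) (ω := ω) R s η T B N c).1 with hm | ⟨i, t', hit, hm⟩
    · rw [hm]
      have hbound : ∫ z, sampleLoss g s 0 c (descent g R s η 0 (tilt T k) B ω t) z
          ∂model D Λ g v ≤ 27 * R := by
        have := isProbabilityMeasure_model (D := D) (Λ := Λ) (v := v) hg.continuous
        refine (le_abs_self _).trans ?_
        have := norm_integral_le_of_norm_le_const (μ := model D Λ g v)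
          (f := sampleLoss g s 0 c (descent g R s η 0 (tilt T k) B ω t)) (C := 27 * R) (by
            filter_upwards [ae_model hg.continuous hD] with z hz
            exact abs_sampleLoss_le hg hs (by simpa using hR.le) hc2 (hW _ _ _) hz)
        simpa using this
      linarith
    · obtain ⟨hi, ht'⟩ : i < T ∧ t' < T := by
        rcases hit with hit | hit
        · exact hit
        · exact absurd hit.2 (Nat.not_lt_zero _)
      rw [hm]
      have h3 := (abs_le.mp (h.loss_offset k hk i hi t' ht' c hc)).1
      rw [integral_sampleLoss hg hs hD hv (hW _ _ _) (abs_offset_le hi hR) hc2] at h3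
      rw [integral_sampleLoss hg hs hD hv (hW _ _ _) (by simpa using hR.le) hc2] at h0
      -- The grid error κ/5 and the shift κ add up to 6κ/5, which is 3/5 of the anchor mass 2κ.
      have hcG : |c - meanRamp Λ s 0| ≤ 3 * (2 * κ) / 5 := by
        obtain ⟨h4, h5⟩ := abs_le.mp hkG
        rcases hc with rfl | rfl <;> exact abs_le.2 ⟨by linarith, by linarith⟩
      have h6 := popLoss_zero_le (Λ := Λ) hg hs hD hv (hW 0 (tilt T k) t) (by positivity) h₁ h₂
        hcG hslack
      have h7 := le_popLoss (Λ := Λ) (b := offset R T i) hg hs hD hv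
        (hW (offset R T i) c t') (c := c) fun y => sub_le_iff_le_add.2 (h6 y)
      unfold popLoss at h7
      linarith
  have hmem : (descent g R s η 0 (tilt T k) B ω t, score g R s η κ T B N ω k t) ∈
      candidates g R s η κ T B N ω T 0 := ⟨k, t, Or.inl ⟨hk, ht⟩, rfl⟩
  have hβ : β ≤ 6 * (2 * κ * s) :=
    (hu.2.2 _ hmem).trans (max_le (hgood _ (Or.inl rfl)) (hgood _ (Or.inr rfl)))
  -- A score of at most 6p ≤ 6R is below the initial value, so a genuine candidate was chosen.
  obtain ⟨k', t', hkt, heq⟩ := hu.2.1.resolve_left (by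
    intro h0
    linarith)
  obtain ⟨hk', ht'⟩ : k' < T ∧ t' < T := by
    rcases hkt with hkt | hkt
    · exact hkt
    · exact absurd hkt.2 (Nat.not_lt_zero _)
  rw [Prod.mk.injEq] at heq
  obtain ⟨rfl, rfl⟩ := heq
  refine ⟨hW _ _ _, ?_⟩
  -- The score gives 6p, the two estimation errors 2p and the competitor 4p, which is within 13p.
  -- The comparison of two tilts then yields 2 · 13p/κ = 52s.
  have hsel : ∀ c, (c = tilt T k' + κ ∨ c = tilt T k' - κ) →
      iterLoss g R s η B N ω 0 (tilt T k') c t' - scanMin g R s η T B N ω c ≤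
        6 * (2 * κ * s) →
      ∀ a, |a| ≤ 2 * R → popLoss D Λ g s 0 c v (descent g R s η 0 (tilt T k') B ω t') ≤
        pot Λ s c a + 13 * (2 * κ * s) := by
    intro c hc hsc a ha
    have hc2 := abs_le_two_of_tilt hk' hκ.le hκ1 hc
    obtain ⟨i, hi, r, hr, hcomp⟩ :=
      h.exists_competitor hg hs hR hD hv hκ hT hT4 hTs hk' hc ha
    have h3 := (abs_le.mp (h.loss_offset k' hk' i hi r hr c hc)).2
    have h0 := (abs_le.mp (h.loss_zero k' hk' t' ht' c hc)).1
    rw [integral_sampleLoss hg hs hD hv (hW _ _ _) (abs_offset_le hi hR) hc2] at h3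
    rw [integral_sampleLoss hg hs hD hv (hW _ _ _) (by simpa using hR.le) hc2] at h0
    have h4 := (isLeast_scanMin (g := g) (ω := ω) R s η T B N c).2
      (Set.mem_insert_of_mem _ ⟨i, r, Or.inl ⟨hi, hr⟩, rfl⟩)
    unfold popLoss at hcomp ⊢
    linarith
  obtain ⟨m, hm⟩ := ObliviousGLM.integral_abs_gap_sub_le (Λ := Λ) hg hs hR hD hv (hW _ _ _) hκ
    (hsel _ (Or.inl rfl) ((le_max_left _ _).trans hβ))
    (hsel _ (Or.inr rfl) ((le_max_right _ _).trans hβ))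
  refine ⟨m, hm.trans (le_of_eq ?_)⟩
  field_simp; norm_num

end

end ObliviousGLM

/-! ### Failure probability of the selection -/

namespace ObliviousGLM

noncomputable section

variable {d : ℕ} {g : ℝ → ℝ} {D : Measure (Vec d)} [IsProbabilityMeasure D] {Λ : Measure ℝ}
  [IsProbabilityMeasure Λ] {R s q κ p : ℝ} {T B : ℕ} {v : Vec d}

/-- The selection fails with small probability only. -/
theorem measure_not_goodRun_le (hg : LipschitzWith 1 g) (hmono : Monotone g) (hs : 0 < s)
    (hR : 0 < R) (hD : ∀ᵐ x ∂D, ‖x‖ ≤ 1) (hv : ‖v‖ ≤ R) (hκ : 0 ≤ κ) (hκ1 : κ ≤ 1) (hp : 0 < p)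
    (hq : 40 * R / p ≤ q) (hT : (T : ℝ) = q ^ 2) (hB : 0 < B) :
    (Measure.infinitePi fun _ : ℕ => model D Λ g v)
      {ω | ¬ GoodRun D Λ g R s (R / q / B) κ p T B (T * B) ω v} ≤
      ENNReal.ofReal (12 * T ^ 3 * Real.exp (-(B / 3))) := by
  have hq0 : 0 < q := lt_of_lt_of_le (by positivity) hq
  have hT0 : 0 < T := by
    have : (0 : ℝ) < T := by rw [hT]; positivity
    exact_mod_cast this
  have hB' : (0 : ℝ) < B := by exact_mod_cast hB
  have hq' : 20 * R / p ≤ q := le_trans (by gcongr; norm_num) hq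
  set μ := Measure.infinitePi fun _ : ℕ => model D Λ g v with hμ
  set η := R / q / B with hη
  set e := ENNReal.ofReal (Real.exp (-(B / 3))) with he
  have hslack : ∀ b c, |c| ≤ 2 → μ {ω | 2 * R * |meanRamp Λ s b - c| ≤ p / 2 ∧
      ∀ t < T, p < slack D Λ g s b v (descent g R s η b c B ω t)} ≤ e := by
    intro b c hc
    by_cases h : 2 * R * |meanRamp Λ s b - c| ≤ p / 2
    · exact (measure_mono fun ω hω => hω.2).trans
        (measure_slack_le hg hmono hs hR hD hv hc hp h hq' hT hB)
    · simp [h]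
  have hloss : ∀ b c c' t, |b| ≤ 8 * R → |c'| ≤ 2 → t < T →
      μ {ω | p < |iterLoss g R s η B (T * B) ω b c c' t -
        ∫ z, sampleLoss g s b c' (descent g R s η b c B ω t) z ∂model D Λ g v|} ≤ 2 * e := by
    intro b c c' t hb hc' ht
    refine (measure_empLoss_le (D := D) (Λ := Λ) (v := v) hg hs hR hD hb hc' hp
      (Nat.mul_pos hT0 hB) (continuous_descent hg.continuous hR s η b c B t) (fun ω ω' h =>
        descent_congr fun j hj => h j (hj.trans_le (Nat.mul_le_mul_right B ht.le)))
      fun ω => norm_descent_le hR _ _ _ _ _ _ _).trans ?_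
    gcongr
    refine ENNReal.ofReal_le_ofReal (Real.exp_le_exp.2 (neg_le_neg ?_))
    rw [le_div_iff₀ (by positivity)]
    rw [div_le_iff₀ hp] at hq
    -- With N = T B and T = q², the exponent is at least B · 1600/2916, since q p ≥ 40R.
    have h8 : (40 * R) ^ 2 ≤ (q * p) ^ 2 := by gcongr
    push_cast
    rw [hT]
    nlinarith
  -- An index consists of a tilt, an offset, an iterate and the sign of κ, so there are 2T³ of them.
  set tl : Fin T × Fin T × Fin T × Bool → ℝ := fun x => tilt T x.1 + cond x.2.2.2 κ (-κ) with htl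
  have htl2 : ∀ x, |tl x| ≤ 2 := by
    rintro ⟨k, i, t, b⟩
    refine abs_le_two_of_tilt k.2 hκ hκ1 ?_
    cases b
    · exact Or.inr rfl
    · exact Or.inl rfl
  set bad : Fin T × Fin T × Fin T × Bool → Set (ℕ → Sample d) := fun x =>
    ({ω | 2 * R * |meanRamp Λ s 0 - tilt T x.1| ≤ p / 2 ∧
      ∀ t < T, p < slack D Λ g s 0 v (descent g R s η 0 (tilt T x.1) B ω t)} ∪
    {ω | 2 * R * |meanRamp Λ s (offset R T x.2.1) - tl x| ≤ p / 2 ∧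
      ∀ t < T, p < slack D Λ g s (offset R T x.2.1) v
        (descent g R s η (offset R T x.2.1) (tl x) B ω t)}) ∪
    ({ω | p < |iterLoss g R s η B (T * B) ω 0 (tilt T x.1) (tl x) x.2.2.1 -
        ∫ z, sampleLoss g s 0 (tl x) (descent g R s η 0 (tilt T x.1) B ω x.2.2.1) z
          ∂model D Λ g v|} ∪
    {ω | p < |iterLoss g R s η B (T * B) ω (offset R T x.2.1) (tl x) (tl x) x.2.2.1 -
        ∫ z, sampleLoss g s (offset R T x.2.1) (tl x)
          (descent g R s η (offset R T x.2.1) (tl x) B ω x.2.2.1) z ∂model D Λ g v|}) with hbad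
  -- Two slack events of probability `e` and two loss events of probability `2 * e`; summed over all
  -- indices this is 12 T³ e.
  have hbad6 : ∀ x, μ (bad x) ≤ (e + e) + (2 * e + 2 * e) := by
    intro x
    have hk := (abs_tilt_le x.1.2).trans one_le_two
    refine (measure_union_le _ _).trans (add_le_add ((measure_union_le _ _).trans
      (add_le_add (hslack _ _ hk) (hslack _ _ (htl2 x)))) ((measure_union_le _ _).trans
      (add_le_add (hloss _ _ _ _ (by simpa using hR.le) (htl2 x) x.2.2.1.2)
        (hloss _ _ _ _ (abs_offset_le x.2.1.2 hR) (htl2 x) x.2.2.1.2))))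
  have hsub : {ω | ¬ GoodRun D Λ g R s η κ p T B (T * B) ω v} ⊆ ⋃ x, bad x := by
    intro ω hω
    by_contra hnot
    refine hω ?_
    simp only [hbad, Set.mem_iUnion, Set.mem_union, not_exists, not_or, Set.mem_ofPred_eq,
      not_and, not_lt, not_forall] at hnot
    have hsign : ∀ k : Fin T, ∀ i t : Fin T, ∀ c, (c = tilt T k + κ ∨ c = tilt T k - κ) →
        ∃ b, tl (k, i, t, b) = c := by
      rintro k i t c (rfl | rfl)
      · exact ⟨true, rfl⟩
      · exact ⟨false, rfl⟩
    constructor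
    · intro k hk h
      obtain ⟨t, ht, h'⟩ := (hnot (⟨k, hk⟩, ⟨0, hT0⟩, ⟨0, hT0⟩, true)).1.1 h
      exact ⟨t, ht, h'⟩
    · intro k hk i hi c hc h
      obtain ⟨b, rfl⟩ := hsign ⟨k, hk⟩ ⟨i, hi⟩ ⟨0, hT0⟩ c hc
      obtain ⟨t, ht, h'⟩ := (hnot (⟨k, hk⟩, ⟨i, hi⟩, ⟨0, hT0⟩, b)).1.2 h
      exact ⟨t, ht, h'⟩
    · intro k hk t ht c hc
      obtain ⟨b, rfl⟩ := hsign ⟨k, hk⟩ ⟨0, hT0⟩ ⟨t, ht⟩ c hc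
      exact (hnot (⟨k, hk⟩, ⟨0, hT0⟩, ⟨t, ht⟩, b)).2.1
    · intro k hk i hi t ht c hc
      obtain ⟨b, rfl⟩ := hsign ⟨k, hk⟩ ⟨i, hi⟩ ⟨t, ht⟩ c hc
      exact (hnot (⟨k, hk⟩, ⟨i, hi⟩, ⟨t, ht⟩, b)).2.2
  refine (measure_mono hsub).trans ((measure_iUnion_fintype_le _ _).trans
    ((Finset.sum_le_sum fun x _ => hbad6 x).trans (le_of_eq ?_)))
  rw [Finset.sum_const, Finset.card_univ]
  simp only [Fintype.card_prod, Fintype.card_fin, Fintype.card_bool, nsmul_eq_mul]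
  rw [ENNReal.ofReal_mul (by positivity), ENNReal.ofReal_mul (by positivity),
    ENNReal.ofReal_pow (by positivity), ENNReal.ofReal_natCast, ← he]
  push_cast
  rw [show ENNReal.ofReal 12 = 12 by norm_num]
  ring

end

end ObliviousGLM

namespace ObliviousGLM

noncomputable section

/-! ### The sizes -/

theorem gam_pos {Δ σ : ℝ} (hΔ : 0 < Δ) (hσ : 0 ≤ σ) : 0 < gam Δ σ := by
  unfold gam
  split_ifs with h
  · norm_num
  · have := lt_of_le_of_ne hσ (Ne.symm h)
    positivity

theorem gam_le (Δ σ : ℝ) : gam Δ σ ≤ 1 / 2 := by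
  unfold gam
  split_ifs
  · exact le_rfl
  · exact min_le_right _ _

/-- A lower bound on the ratio turns each ceiling into a constant factor. -/
theorem two_le_ratio {Δ α R σ : ℝ} (hΔ : 0 < Δ) (hα : 0 < α) (hα1 : α ≤ 1) (hσ : 0 ≤ σ)
    (hR : Δ < R) : 2 ≤ R / (gam Δ σ * α * Δ) := by
  have hγ := gam_pos hΔ hσ
  rw [le_div_iff₀ (by positivity)]
  have h1 : gam Δ σ * α ≤ 1 / 2 * 1 := mul_le_mul (gam_le _ _) hα1 hα.le (by norm_num)
  nlinarith

theorem sizeK_ge (Δ α R σ : ℝ) : 64 * (R / (gam Δ σ * α * Δ)) ≤ sizeK Δ α R σ := by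
  rw [← mul_div_assoc]; exact Nat.le_ceil _

theorem sizeK_le {Δ α R σ : ℝ} (h : 2 ≤ R / (gam Δ σ * α * Δ)) :
    (sizeK Δ α R σ : ℝ) ≤ 65 * (R / (gam Δ σ * α * Δ)) := by
  have h1 := Nat.ceil_lt_add_one (a := 64 * R / (gam Δ σ * α * Δ)) (by
    rw [mul_div_assoc]; linarith)
  rw [sizeK]
  rw [mul_div_assoc] at h1 ⊢
  linarith

theorem cast_sizeT (Δ α R σ : ℝ) : (sizeT Δ α R σ : ℝ) = (100 * sizeK Δ α R σ) ^ 2 := by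
  unfold sizeT; push_cast; ring

theorem sizeB_pos {z : ℝ} (hz : 1 < z) : 0 < sizeB z := by
  have : 1 < ⌈z⌉₊ := by rw [Nat.lt_ceil]; simpa using hz
  exact Nat.mul_pos (by norm_num) (Nat.clog_pos (by norm_num) this)

/-- The batch size is 12 L with 2^L ≥ z, and e ≥ 2 gives e^(-4L) ≤ z^(-4). The fourth power is what
pays for a union over order T³ events. -/
theorem exp_neg_sizeB_le {z : ℝ} (hz : 0 < z) : Real.exp (-(sizeB z / 3)) ≤ (1 / z) ^ 4 := by
  set L := Nat.clog 2 ⌈z⌉₊ with hL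
  have h1 : z ≤ 2 ^ L := by
    have : ⌈z⌉₊ ≤ 2 ^ L := Nat.le_pow_clog (by norm_num) _
    exact (Nat.le_ceil z).trans (by exact_mod_cast this)
  have h2 : Real.exp (-(sizeB z / 3)) = (Real.exp (-1) ^ L) ^ 4 := by
    rw [← Real.exp_nat_mul, ← Real.exp_nat_mul, sizeB, ← hL]
    congr 1; push_cast; ring
  have h3 : Real.exp (-1) ≤ 1 / 2 := by
    rw [Real.exp_neg, ← one_div]
    exact one_div_le_one_div_of_le (by norm_num) (by linarith [Real.add_one_le_exp (1 : ℝ)])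
  rw [h2]
  gcongr
  calc Real.exp (-1) ^ L ≤ (1 / 2) ^ L := by gcongr
    _ = 1 / 2 ^ L := by rw [div_pow, one_pow]
    _ ≤ 1 / z := by gcongr

/-- Rounding up gives 2^L ≤ 4y, hence L log 2 ≤ 3 log y because y ≥ 2. -/
theorem sizeB_le {z y : ℝ} (hz : 1 < z) (hzy : z ≤ y) (hy : 2 ≤ y) :
    (sizeB z : ℝ) ≤ 60 * Real.log y := by
  set L := Nat.clog 2 ⌈z⌉₊ with hL
  have h1 : 1 < ⌈z⌉₊ := by rw [Nat.lt_ceil]; simpa using hz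
  have hL0 : 0 < L := Nat.clog_pos (by norm_num) h1
  have h2 : 2 ^ (L - 1) < ⌈z⌉₊ := Nat.pow_pred_clog_lt_self (by norm_num) h1
  have h3 : (2 : ℝ) ^ L ≤ 4 * y := by
    have h4 : ((2 ^ (L - 1) : ℕ) : ℝ) < z + 1 :=
      lt_trans (by exact_mod_cast h2) (Nat.ceil_lt_add_one (by linarith))
    have h5 : (2 : ℝ) ^ L = 2 * 2 ^ (L - 1) := by
      rw [← pow_succ', Nat.sub_add_cancel hL0]
    push_cast at h4
    rw [h5]; linarith
  have h6 := Real.log_le_log (by positivity) h3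
  rw [Real.log_pow, Real.log_mul (by norm_num) (by linarith), show (4 : ℝ) = 2 ^ 2 by norm_num,
    Real.log_pow] at h6
  have h7 := Real.log_le_log (by norm_num) hy
  have h8 := Real.log_two_gt_d9
  rw [sizeB, ← hL]
  push_cast at h6 ⊢
  nlinarith [(Nat.cast_nonneg L : (0 : ℝ) ≤ L)]

/-- The sample sizes of the algorithms, up to the constant. -/
theorem sizeN_le {Δ α R σ z y : ℝ} (h : 2 ≤ R / (gam Δ σ * α * Δ)) (hz : 1 < z) (hzy : z ≤ y)
    (hy : 2 ≤ y) :
    (2 * sizeN Δ α R σ z : ℝ) ≤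
      10 ^ 10 * (α⁻¹ ^ 2 * Real.log y * (R ^ 2 / (gam Δ σ * Δ) ^ 2)) := by
  have h1 := sizeK_le h
  have h2 := sizeB_le hz hzy hy
  have h3 : α⁻¹ ^ 2 * Real.log y * (R ^ 2 / (gam Δ σ * Δ) ^ 2) =
      (R / (gam Δ σ * α * Δ)) ^ 2 * Real.log y := by
    rw [div_pow, mul_pow, mul_pow, mul_pow, inv_pow, div_eq_mul_inv, div_eq_mul_inv, mul_inv,
      mul_inv, mul_inv]
    ring
  have h0 := Real.log_nonneg (show 1 ≤ y by linarith)
  rw [h3, sizeN, Nat.cast_mul, cast_sizeT]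
  set r := R / (gam Δ σ * α * Δ)
  calc 2 * ((100 * (sizeK Δ α R σ : ℝ)) ^ 2 * sizeB z)
      ≤ 2 * ((100 * (65 * r)) ^ 2 * (60 * Real.log y)) := by gcongr
    _ = 5070000000 * (r ^ 2 * Real.log y) := by ring
    _ ≤ 10 ^ 10 * (r ^ 2 * Real.log y) := by gcongr; norm_num

theorem sizeT_le {Δ α R σ : ℝ} (h : 2 ≤ R / (gam Δ σ * α * Δ)) :
    sizeT Δ α R σ ≤ numSteps (10 ^ 10) Δ α R σ := by
  have h1 := sizeK_le h
  have : (sizeT Δ α R σ : ℝ) ≤ numSteps (10 ^ 10) Δ α R σ := by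
    refine le_trans ?_ (Nat.le_ceil _)
    rw [cast_sizeT]
    set r := R / (gam Δ σ * α * Δ)
    calc (100 * (sizeK Δ α R σ : ℝ)) ^ 2 ≤ (100 * (65 * r)) ^ 2 := by gcongr
      _ = 42250000 * r ^ 2 := by ring
      _ ≤ _ := by gcongr; norm_num
  exact_mod_cast this

theorem numSteps_pos {Δ α R σ : ℝ} (hΔ : 0 < Δ) (hα : 0 < α) (hσ : 0 ≤ σ) (hR : 0 < R) :
    0 < numSteps (10 ^ 10) Δ α R σ := by
  have := gam_pos hΔ hσ
  exact Nat.ceil_pos.2 (by positivity)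

theorem listSize_pos {Δ α R σ : ℝ} (hΔ : 0 < Δ) (hα : 0 < α) (hσ : 0 ≤ σ) (hR : 0 < R) :
    0 < listSize (10 ^ 10) Δ α R σ := by
  have := gam_pos hΔ hσ
  exact Nat.mul_pos (numSteps_pos hΔ hα hσ hR) (Nat.ceil_pos.2 (by positivity))

theorem listSamples_pos {Δ α R σ δ : ℝ} (hΔ : 0 < Δ) (hα : 0 < α) (hσ : 0 ≤ σ) (hR : 0 < R)
    (hδ : 0 < δ) : 0 < listSamples (10 ^ 10) Δ α R σ δ := by
  have := gam_pos hΔ hσ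
  have h : 0 < Real.log (2 + R / (Δ * α * δ)) := by
    refine Real.log_pos ?_
    have : 0 < R / (Δ * α * δ) := by positivity
    linarith
  exact Nat.ceil_pos.2 (by positivity)

theorem fineAcc_pos {Δ τ : ℝ} (hΔ : 0 < Δ) (hτ : 0 < τ) : 0 < fineAcc Δ τ := by
  unfold fineAcc; positivity

theorem singleSamples_pos {Δ α R σ δ τ : ℝ} (hΔ : 0 < Δ) (hα : 0 < α) (hσ : 0 ≤ σ) (hR : 0 < R)
    (hδ : 0 < δ) (hδ1 : δ < 1) (hτ : 0 < τ) :
    0 < singleSamples (10 ^ 10) Δ α R σ δ τ := by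
  have hf := fineAcc_pos hΔ hτ
  have := gam_pos hf hσ
  have h : 0 < Real.log (listSize (10 ^ 10) (fineAcc Δ τ) α R σ / δ) := by
    refine Real.log_pos ?_
    rw [lt_div_iff₀ hδ, one_mul]
    have : (1 : ℝ) ≤ listSize (10 ^ 10) (fineAcc Δ τ) α R σ := by
      exact_mod_cast listSize_pos hf hα hσ hR
    linarith
  have h2 : 0 < R ^ 2 / (gam (fineAcc Δ τ) σ * fineAcc Δ τ) ^ 2 +
      1 / (τ * ratio τ σ) ^ 2 := add_pos_of_pos_of_nonneg (by positivity) (by positivity)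
  exact Nat.ceil_pos.2 (by positivity)

/-- The resources of `candidatesP`. -/
theorem candidatesP_resources {d : ℕ} (hd : 0 < d) {g : ℝ → ℝ} {Δ α R σ δ : ℝ} (hΔ : 0 < Δ)
    (hα : 0 < α) (hα1 : α ≤ 1) (hR : 0 < R) (hσ : 0 ≤ σ) (hδ : 0 < δ) (hδ1 : δ < 1)
    (ω : ℕ → Sample d) :
    ∃ (t n : ℕ) (L : List (Vec d)), Returns candidatesP g [Δ, α, R, σ, δ] ω t n L ∧
      (t : ℝ) ≤ 10 ^ 10 * (d * numSteps (10 ^ 10) Δ α R σ * listSamples (10 ^ 10) Δ α R σ δ) ∧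
      n ≤ listSamples (10 ^ 10) Δ α R σ δ ∧ L.length ≤ listSize (10 ^ 10) Δ α R σ := by
  have hns := numSteps_pos hΔ hα hσ hR
  have hls := listSamples_pos hΔ hα hσ hR hδ
  rcases le_or_gt R Δ with h | h
  · obtain ⟨t, ht, ht5⟩ := candidatesP_small (g := g) (α := α) (σ := σ) (δ := δ) (ω := ω) h
    refine ⟨t, 0, _, ht, ?_, Nat.zero_le _, ?_⟩
    · have : 1 ≤ d * numSteps (10 ^ 10) Δ α R σ * listSamples (10 ^ 10) Δ α R σ δ :=
        Nat.mul_pos (Nat.mul_pos hd hns) hls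
      have : t ≤ 10 ^ 10 * (d * numSteps (10 ^ 10) Δ α R σ * listSamples (10 ^ 10) Δ α R σ δ) := by
        omega
      exact_mod_cast this
    · exact listSize_pos hΔ hα hσ hR
  · have hr := two_le_ratio hΔ hα hα1 hσ h
    have hK : 0 < sizeK Δ α R σ := by
      have := sizeK_ge Δ α R σ
      have : (0 : ℝ) < sizeK Δ α R σ := by linarith
      exact_mod_cast this
    have hz : 1 < 1 / δ := by rw [lt_div_iff₀ hδ]; linarith
    have hTle := sizeT_le hr
    have hKT : sizeK Δ α R σ ≤ sizeT Δ α R σ := by unfold sizeT; nlinarith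
    have hN : sizeN Δ α R σ (1 / δ) ≤ listSamples (10 ^ 10) Δ α R σ δ := by
      have hzy : 1 / δ ≤ R / (Δ * α * δ) := by
        rw [div_le_div_iff₀ hδ (by positivity), one_mul]
        have : Δ * α ≤ R := by nlinarith
        nlinarith
      have h1 := sizeN_le hr hz (y := 2 + R / (Δ * α * δ)) (by linarith) (by linarith)
      have h2 : (sizeN Δ α R σ (1 / δ) : ℝ) ≤ listSamples (10 ^ 10) Δ α R σ δ := by
        refine le_trans ?_ (h1.trans (Nat.le_ceil _))
        have : (0 : ℝ) ≤ sizeN Δ α R σ (1 / δ) := Nat.cast_nonneg _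
        linarith
      exact_mod_cast h2
    obtain ⟨t, L, hret, ht, hL, -⟩ :=
      candidatesP_large (g := g) (ω := ω) hd hσ h hK (sizeB_pos hz)
    refine ⟨t, _, L, hret, ?_, hN, ?_⟩
    · have : t ≤ 10 ^ 10 * (d * numSteps (10 ^ 10) Δ α R σ * listSamples (10 ^ 10) Δ α R σ δ) := by
        calc t ≤ 10000 * d * sizeK Δ α R σ * sizeN Δ α R σ (1 / δ) := ht
          _ ≤ 10 ^ 10 * d * numSteps (10 ^ 10) Δ α R σ * listSamples (10 ^ 10) Δ α R σ δ := by
            gcongr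
            · norm_num
            · exact hKT.trans hTle
          _ = _ := by ring
      exact_mod_cast this
    · rw [hL, listSize, mul_comm]
      exact Nat.mul_le_mul_right _ hTle

/-- The resources of `singleP`. -/
theorem singleP_resources {d : ℕ} (hd : 0 < d) {g : ℝ → ℝ} {Δ α R σ δ τ : ℝ} (hΔ : 0 < Δ)
    (hα : 0 < α) (hα1 : α ≤ 1) (hR : 0 < R) (hσ : 0 ≤ σ) (hδ : 0 < δ) (hδ1 : δ < 1)
    (hτ : 0 < τ) (ω : ℕ → Sample d) :
    ∃ (t n : ℕ) (v : Vec d), Returns singleP g [Δ, α, R, σ, δ, τ] ω t n [v] ∧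
      (t : ℝ) ≤ 10 ^ 10 * (d * singleSamples (10 ^ 10) Δ α R σ δ τ *
        (listSize (10 ^ 10) (fineAcc Δ τ) α R σ : ℝ) ^ 2) ∧
      n ≤ singleSamples (10 ^ 10) Δ α R σ δ τ := by
  have hf := fineAcc_pos hΔ hτ
  have hls := listSize_pos hf hα hσ hR
  have hss := singleSamples_pos hΔ hα hσ hR hδ hδ1 hτ
  set W := listSize (10 ^ 10) (fineAcc Δ τ) α R σ with hW
  set m := singleSamples (10 ^ 10) Δ α R σ δ τ with hm
  rcases le_or_gt R (fineAcc Δ τ) with h | h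
  · obtain ⟨t, ht, ht5⟩ := singleP_small (g := g) (α := α) (σ := σ) (δ := δ) (ω := ω) h
    refine ⟨t, 0, _, ht, ?_, Nat.zero_le _⟩
    have : 1 ≤ d * m * W ^ 2 := Nat.mul_pos (Nat.mul_pos hd hss) (pow_pos hls 2)
    have : t ≤ 10 ^ 10 * (d * m * W ^ 2) := by omega
    exact_mod_cast this
  · have hr := two_le_ratio hf hα hα1 hσ h
    have hK : 0 < sizeK (fineAcc Δ τ) α R σ := by
      have := sizeK_ge (fineAcc Δ τ) α R σ
      have : (0 : ℝ) < sizeK (fineAcc Δ τ) α R σ := by linarith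
      exact_mod_cast this
    have hT1 : 2 ≤ sizeT (fineAcc Δ τ) α R σ := by unfold sizeT; nlinarith
    have hTW : sizeT (fineAcc Δ τ) α R σ * sizeK (fineAcc Δ τ) α R σ ≤ W :=
      Nat.mul_le_mul_right _ (sizeT_le hr)
    have hTW' : sizeT (fineAcc Δ τ) α R σ ≤ W := (Nat.le_mul_of_pos_right _ hK).trans hTW
    have hT2 : (2 : ℝ) ≤ sizeT (fineAcc Δ τ) α R σ := by exact_mod_cast hT1
    have hTW2 : (sizeT (fineAcc Δ τ) α R σ : ℝ) ≤ W := by exact_mod_cast hTW'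
    have hz2 : 2 ≤ sizeT (fineAcc Δ τ) α R σ / δ := by
      rw [le_div_iff₀ hδ]; linarith
    have hz : 1 < sizeT (fineAcc Δ τ) α R σ / δ := by linarith
    have hN : 2 * sizeN (fineAcc Δ τ) α R σ (sizeT (fineAcc Δ τ) α R σ / δ) ≤ m := by
      have hzy : sizeT (fineAcc Δ τ) α R σ / δ ≤ W / δ := by gcongr
      have h1 := sizeN_le hr hz hzy (by linarith)
      have h2 : (2 * sizeN (fineAcc Δ τ) α R σ (sizeT (fineAcc Δ τ) α R σ / δ) : ℝ) ≤ m := by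
        refine le_trans (h1.trans ?_) (Nat.le_ceil _)
        have h0 := Real.log_nonneg (show 1 ≤ W / δ by linarith)
        gcongr
        exact le_add_of_nonneg_right (by positivity)
      exact_mod_cast h2
    obtain ⟨t, v, hret, ht, -⟩ :=
      singleP_large (g := g) (ω := ω) (δ := δ) hd hσ rfl h hK rfl (sizeB_pos hz)
    refine ⟨t, _, v, hret, ?_, hN⟩
    set T := sizeT (fineAcc Δ τ) α R σ with hT
    set K := sizeK (fineAcc Δ τ) α R σ
    -- One factor T is traded for 10⁴ K², so T³ = 10⁴ (T K)², and T K ≤ W: the cubic running time is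
    -- quadratic in `W`.
    have hT3 : T ^ 3 ≤ 10000 * W ^ 2 := by
      have hTK : T = 10000 * K * K := rfl
      calc T ^ 3 = T ^ 2 * (10000 * K * K) := by rw [pow_succ, ← hTK]
        _ = 10000 * (T * K) ^ 2 := by ring
        _ ≤ _ := by gcongr
    have : t ≤ 10 ^ 10 * (d * m * W ^ 2) := by
      calc t ≤ 30000 * d * sizeN (fineAcc Δ τ) α R σ (T / δ) * T ^ 3 := ht
        _ ≤ 30000 * d * m * (10000 * W ^ 2) := by
          gcongr
          omega
        _ = 300000000 * (d * m * W ^ 2) := by ring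
        _ ≤ _ := by gcongr; norm_num
    exact_mod_cast this

end

end ObliviousGLM

namespace ObliviousGLM

noncomputable section

/-! ### The guarantees -/

variable {d : ℕ} {g : ℝ → ℝ} {Δ α R σ δ τ : ℝ}

theorem streamLaw_eq (D : Measure (Vec d)) [IsProbabilityMeasure D] (ν : Measure ℝ)
    [IsProbabilityMeasure ν] (hg : Continuous g) (σ : ℝ) (w : Vec d) :
    streamLaw D ν g σ w = Measure.infinitePi fun _ : ℕ => model D (noiseLaw ν σ) g w := by
  unfold streamLaw model
  rw [glmLaw_eq D ν hg σ w]

theorem excessLoss_zero_le {D : Measure (Vec d)} {ν : Measure ℝ} {w : Vec d}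
    (hg : LipschitzWith 1 g) (hI : IsInstance α R D ν w) : excessLoss D g 0 w ≤ R := by
  have := hI.prob_features
  have hR : 0 ≤ R := (norm_nonneg w).trans hI.target_le
  have hj : Integrable (fun x => |gap g w 0 x|) D :=
    integrable_of_gap hg hI.features_le hI.target_le (by simpa using hR) continuous_abs
  have h2 : R = ∫ _, R ∂D := by simp
  rw [h2]
  refine integral_mono_ae hj (integrable_const _) ?_
  filter_upwards [hI.features_le] with x hx
  refine (abs_gap_le_inner hg w 0 x).trans ?_
  rw [sub_zero]
  exact abs_inner_le hI.target_le hx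

theorem candidatesP_guarantee (hd : 0 < d) (hΔ : 0 < Δ) (hα : 0 < α) (hα1 : α ≤ 1) (hR : 0 < R)
    (hσ : 0 ≤ σ) (hδ : 0 < δ) (hδ1 : δ < 1) (hg : LipschitzWith 1 g) (hmono : Monotone g)
    {D : Measure (Vec d)} {ν : Measure ℝ} {w : Vec d} (hI : IsInstance α R D ν w) :
    streamLaw D ν g σ w {ω | ¬ ∃ (t n : ℕ) (L : List (Vec d)),
      Returns candidatesP g [Δ, α, R, σ, δ] ω t n L ∧ ∃ v ∈ L, excessLoss D g v w ≤ Δ} ≤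
      ENNReal.ofReal δ := by
  have := hI.prob_features
  have := hI.prob_noise
  have := isProbabilityMeasure_noiseLaw ν σ
  rw [streamLaw_eq D ν hg.continuous]
  rcases le_or_gt R Δ with h | h
  · refine (measure_mono (t := ∅) fun ω hω => ?_).trans (by simp)
    obtain ⟨t, ht, -⟩ := candidatesP_small (g := g) (α := α) (σ := σ) (δ := δ) (ω := ω) h
    exact (hω ⟨t, 0, _, ht, 0, by simp, (excessLoss_zero_le hg hI).trans h⟩).elim
  have hγ := gam_pos hΔ hσ
  have hr := two_le_ratio hΔ hα hα1 hσ h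
  have hKge := sizeK_ge Δ α R σ
  have hK' : (0 : ℝ) < sizeK Δ α R σ := by linarith
  have hK : 0 < sizeK Δ α R σ := by exact_mod_cast hK'
  have hz : 1 < 1 / δ := by rw [lt_div_iff₀ hδ]; linarith
  have hB := sizeB_pos hz
  obtain ⟨hanch₁, hanch₂⟩ := noiseLaw_anchor hΔ hσ hI.noise_zero
  obtain ⟨k, hk, hkG⟩ := exists_tilt_near hK
    (abs_meanRamp_le_one (Λ := noiseLaw ν σ) (s := Δ / 8) 0)
  have hKR : R / sizeK Δ α R σ ≤ gam Δ σ * α * Δ / 64 := by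
    rw [mul_div_assoc', div_le_iff₀ (by positivity)] at hKge
    rw [div_le_div_iff₀ hK' (by norm_num)]
    linarith
  -- The width s = Δ/8 accounts for 2s = Δ/4 of the excess loss; this p, divided by the anchor mass
  -- αγ/10, accounts for the remaining 3Δ/4.
  set p := 3 * (α * gam Δ σ / 10) * Δ / 4 with hp
  have hfit : 2 * R * |meanRamp (noiseLaw ν σ) (Δ / 8) 0 - tilt (sizeK Δ α R σ) k| ≤ p / 2 := by
    have h1 := mul_le_mul_of_nonneg_left hkG (show 0 ≤ 2 * R by positivity)
    have h2 : 2 * R * (1 / sizeK Δ α R σ) = 2 * (R / sizeK Δ α R σ) := by ring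
    have h3 : 0 < gam Δ σ * α * Δ := by positivity
    rw [h2] at h1
    refine h1.trans ?_
    rw [hp]
    linarith
  have hq : 20 * R / p ≤ 100 * sizeK Δ α R σ := by
    rw [div_le_iff₀ (by positivity)]
    rw [div_le_div_iff₀ hK' (by norm_num)] at hKR
    rw [hp]
    linarith
  have key := measure_slack_le (Λ := noiseLaw ν σ) (s := Δ / 8) (b := 0) hg hmono (by positivity)
    hR hI.features_le hI.target_le ((abs_tilt_le hk).trans one_le_two) (by positivity) hfit hq
    (cast_sizeT Δ α R σ) hB
  refine (measure_mono fun ω hω t ht => ?_).trans (key.trans (ENNReal.ofReal_le_ofReal ?_))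
  · by_contra! hle
    refine hω ?_
    obtain ⟨t', L, hret, -, -, hL⟩ :=
      candidatesP_large (g := g) (ω := ω) (δ := δ) hd hσ h hK hB
    refine ⟨t', _, L, hret, _, hL k hk t ht, ?_⟩
    refine (excessLoss_le_of_slack (Λ := noiseLaw ν σ) (s := Δ / 8) hg (by positivity)
      hI.features_le hI.target_le (norm_descent_le hR _ _ _ _ _ _ _) (by positivity)
      hanch₁ hanch₂).trans ?_
    have h5 : p / (α * gam Δ σ / 10) = 3 * Δ / 4 := by
      rw [hp]; field_simp
    have h6 := (div_le_div_iff_of_pos_right (show 0 < α * gam Δ σ / 10 by positivity)).2 hle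
    rw [h5] at h6
    unfold sizeη
    linarith
  · refine (exp_neg_sizeB_le (by positivity)).trans ?_
    rw [one_div_one_div]
    exact pow_le_of_le_one hδ.le hδ1.le (by norm_num)

/-- All conditions follow from T = (100K)² and K ρ ≥ 64R for ρ = γαE: the step count exceeds every
required multiple of R/ρ and, as ρ ≤ E/2, of R²/(Eρ). -/
theorem sizeT_conditions {E : ℝ} (hE : 0 < E) (hα : 0 < α) (hα1 : α ≤ 1) (hσ : 0 ≤ σ) (h : E < R) :
    40 * R / (2 * (α * gam E σ / 20) * (E / 8)) ≤ 100 * sizeK E α R σ ∧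
    64 * R ^ 2 ≤ sizeT E α R σ * (E / 8) * (2 * (α * gam E σ / 20) * (E / 8)) ∧
    1 / (sizeT E α R σ : ℝ) ≤ α * gam E σ / 20 / 5 ∧
    2 * R / sizeT E α R σ ≤ α * gam E σ / 20 * (E / 8) ∧
    0 < sizeK E α R σ := by
  have hR : 0 < R := hE.trans h
  have hγ := gam_pos hE hσ
  have hγ1 := gam_le E σ
  have hKge := sizeK_ge E α R σ
  have hr := two_le_ratio hE hα hα1 hσ h
  have hT := cast_sizeT E α R σ
  generalize (sizeT E α R σ : ℝ) = T at hT ⊢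
  have hK : 0 < sizeK E α R σ := by
    have : (0 : ℝ) < sizeK E α R σ := by linarith
    exact_mod_cast this
  have hK1 : (1 : ℝ) ≤ sizeK E α R σ := by exact_mod_cast hK
  refine and_assoc.1 (and_assoc.1 (and_assoc.1 ⟨?_, hK⟩))
  generalize (sizeK E α R σ : ℝ) = K at hT hKge hK1 ⊢
  generalize gam E σ = γ at hγ hγ1 hKge ⊢
  obtain ⟨ρ, hρ⟩ : ∃ ρ, ρ = γ * α * E := ⟨_, rfl⟩
  have hρ0 : 0 < ρ := by rw [hρ]; positivity
  have hKρ : 64 * R ≤ K * ρ := by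
    rwa [← hρ, mul_div_assoc', div_le_iff₀ hρ0] at hKge
  have hp : 2 * (α * γ / 20) * (E / 8) = ρ / 80 := by rw [hρ]; ring
  have hαγ : γ * α ≤ 1 / 2 * 1 := mul_le_mul hγ1 hα1 hα.le (by norm_num)
  have hTK : T * ρ = 10000 * K * (K * ρ) := by rw [hT]; ring
  have hT0 : 0 < T := by rw [hT]; positivity
  have hTρ : 640000 * R ≤ T * ρ := by
    have : 1 * (64 * R) ≤ K * (K * ρ) := mul_le_mul hK1 hKρ (by positivity) (by positivity)
    linarith
  refine ⟨⟨⟨?_, ?_⟩, ?_⟩, ?_⟩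
  · rw [hp, div_le_iff₀ (by positivity)]
    linarith
  · have h1 : (64 * R) ^ 2 ≤ (K * ρ) ^ 2 := by gcongr
    have h2 : T * ρ ^ 2 = 10000 * (K * ρ) ^ 2 := by rw [hT]; ring
    have h3 : ρ ≤ E / 2 := by
      have := mul_le_mul_of_nonneg_right hαγ hE.le
      rw [hρ]; linarith
    have h4 : T * ρ * ρ ≤ T * ρ * (E / 2) := by gcongr
    rw [hp]
    have h5 : T * (E / 8) * (ρ / 80) = T * ρ * (E / 2) / 320 := by ring
    have h6 : T * ρ * ρ = T * ρ ^ 2 := by ring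
    have h7 : 0 ≤ R ^ 2 := sq_nonneg R
    linarith
  · rw [div_le_iff₀ hT0]
    have h2 : 640000 * E ≤ T * (γ * α) * E := by
      have : T * ρ = T * (γ * α) * E := by rw [hρ]; ring
      linarith
    have h3 := le_of_mul_le_mul_right h2 hE
    linarith
  · rw [div_le_iff₀ hT0]
    have h1 : α * γ / 20 * (E / 8) * T = T * ρ / 160 := by rw [hρ]; ring
    linarith

theorem singleP_guarantee (hd : 0 < d) (hΔ : 0 < Δ) (hα : 0 < α) (hα1 : α ≤ 1) (hR : 0 < R)
    (hσ : 0 ≤ σ) (hδ : 0 < δ) (hδ1 : δ < 1) {τ' : ℝ} (hτ' : 0 < τ') (hg : LipschitzWith 1 g)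
    (hmono : Monotone g) {D : Measure (Vec d)} {ν : Measure ℝ} {w : Vec d}
    (hI : IsInstance α R D ν w) (hτ : τ' ≤ τ) (hid : Identifiable D g Δ τ) :
    streamLaw D ν g σ w {ω | ¬ ∃ (t n : ℕ) (v : Vec d),
      Returns singleP g [Δ, α, R, σ, δ, τ'] ω t n [v] ∧ excessLoss D g v w ≤ 4 * Δ} ≤
      ENNReal.ofReal δ := by
  have := hI.prob_features
  have := hI.prob_noise
  have := isProbabilityMeasure_noiseLaw ν σ
  rw [streamLaw_eq D ν hg.continuous]
  have hf := fineAcc_pos hΔ hτ'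
  have hfΔ : fineAcc Δ τ' ≤ Δ := min_le_left _ _
  have hfτ : fineAcc Δ τ' ≤ τ' ^ 2 / 16 := min_le_right _ _
  rcases le_or_gt R (fineAcc Δ τ') with h | h
  · refine (measure_mono (t := ∅) fun ω hω => ?_).trans (by simp)
    obtain ⟨t, ht, -⟩ := singleP_small (g := g) (α := α) (σ := σ) (δ := δ) (ω := ω) h
    exact (hω ⟨t, 0, _, ht, (excessLoss_zero_le hg hI).trans (by linarith)⟩).elim
  set E := fineAcc Δ τ' with hE
  obtain ⟨hq, hTs, hTκ, hTR, hK⟩ := sizeT_conditions hf hα hα1 hσ h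
  have hγ := gam_pos hf hσ
  have hT4 : 4 ∣ sizeT E α R σ := ⟨2500 * sizeK E α R σ * sizeK E α R σ, by unfold sizeT; ring⟩
  have hT1 : 10000 ≤ sizeT E α R σ := by
    have := Nat.mul_pos hK hK
    rw [sizeT, mul_assoc]; omega
  have hT : 0 < sizeT E α R σ := by omega
  have hTr : (10000 : ℝ) ≤ sizeT E α R σ := by exact_mod_cast hT1
  have hz : 1 < sizeT E α R σ / δ := by rw [lt_div_iff₀ hδ]; linarith
  have hB := sizeB_pos hz
  obtain ⟨hanch₁, hanch₂⟩ := noiseLaw_anchor hf hσ hI.noise_zero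
  have hκ0 : 0 < α * gam E σ / 20 := by positivity
  have hαγ : α * gam E σ ≤ 1 * (1 / 2) := mul_le_mul hα1 (gam_le E σ) hγ.le zero_le_one
  have hp0 : 0 < 2 * (α * gam E σ / 20) * (E / 8) := by positivity
  have key := measure_not_goodRun_le (Λ := noiseLaw ν σ) (s := E / 8) (κ := α * gam E σ / 20)
    hg hmono (by positivity) hR hI.features_le hI.target_le hκ0.le (by linarith) hp0 hq
    (cast_sizeT E α R σ) hB
  refine le_trans (measure_mono ?_) (key.trans (ENNReal.ofReal_le_ofReal ?_))
  · intro ω hω hgood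
    refine hω ?_
    obtain ⟨t, v, hret, -, β, hβ⟩ :=
      singleP_large (g := g) (ω := ω) (δ := δ) hd hσ hE.symm h hK rfl hB
    obtain ⟨hvR, m, hm⟩ := hgood.integral_abs_gap_sub_le hg (by positivity) hR (by linarith)
      hI.features_le hI.target_le hκ0 (by linarith) (by linarith) (by linarith) hT hT4 hTs hTκ
      hTR hβ
    refine ⟨t, _, v, hret, ?_⟩
    have hττ : τ' ^ 2 ≤ τ ^ 2 := by gcongr
    -- For s = E/8 the bound 52 s is 6.5 E ≤ 6.5 τ'²/16 < τ². The excess loss is thus even at most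
    -- Δ.
    have h1 := hid.excessLoss_le_of_integral (hτ'.trans_le hτ) hg hI.features_le hI.target_le hvR
      (hm.trans (by nlinarith [sq_nonneg τ']))
    linarith
  -- For z = T/δ the failure probability is at most 12 T³ (δ/T)⁴ = 12 δ⁴/T, and T ≥ 10000.
  · have h1 := exp_neg_sizeB_le (zero_lt_one.trans hz)
    rw [one_div_div] at h1
    have hT0 : (0 : ℝ) < sizeT E α R σ := by linarith
    calc 12 * (sizeT E α R σ : ℝ) ^ 3 * Real.exp (-(sizeB (sizeT E α R σ / δ) / 3))
        ≤ 12 * (sizeT E α R σ : ℝ) ^ 3 * (δ / sizeT E α R σ) ^ 4 := by gcongr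
      _ = 12 / sizeT E α R σ * δ ^ 4 := by field_simp
      _ ≤ 1 * δ ^ 4 := by
        gcongr
        rw [div_le_one hT0]; linarith
      _ ≤ δ := by
        rw [one_mul]; exact pow_le_of_le_one hδ.le hδ1.le (by norm_num)

end

end ObliviousGLM

theorem theorem5p2 :
    -- a list of candidates, without identifiability
    (∃ (p : Prog) (C : ℝ), 0 < C ∧
      ∀ (d : ℕ) (Δ α R σ δ : ℝ) (g : ℝ → ℝ),
        0 < d → 0 < Δ → 0 < α → α ≤ 1 → 0 < R → 0 ≤ σ → 0 < δ → δ < 1 →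
        LipschitzWith 1 g → Monotone g →
        (∀ ω : ℕ → Sample d, ∃ (t n : ℕ) (L : List (Vec d)),
          Returns p g [Δ, α, R, σ, δ] ω t n L ∧
          (t : ℝ) ≤ C * (d * numSteps C Δ α R σ * listSamples C Δ α R σ δ) ∧
          n ≤ listSamples C Δ α R σ δ ∧
          L.length ≤ listSize C Δ α R σ) ∧
        ∀ (D : MeasureTheory.Measure (Vec d)) (ν : MeasureTheory.Measure ℝ) (w : Vec d),
          IsInstance α R D ν w →
          streamLaw D ν g σ w {ω | ¬ ∃ (t n : ℕ) (L : List (Vec d)),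
            Returns p g [Δ, α, R, σ, δ] ω t n L ∧
            ∃ v ∈ L, excessLoss D g v w ≤ Δ} ≤ ENNReal.ofReal δ) ∧
    -- a single candidate, under identifiability
    (∃ (p : Prog) (C : ℝ), 0 < C ∧
      ∀ (d : ℕ) (Δ α R σ δ τ' : ℝ) (g : ℝ → ℝ),
        0 < d → 0 < Δ → 0 < α → α ≤ 1 → 0 < R → 0 ≤ σ → 0 < δ → δ < 1 → 0 < τ' →
        LipschitzWith 1 g → Monotone g →
        (∀ ω : ℕ → Sample d, ∃ (t n : ℕ) (v : Vec d),
          Returns p g [Δ, α, R, σ, δ, τ'] ω t n [v] ∧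
          (t : ℝ) ≤ C * (d * singleSamples C Δ α R σ δ τ' *
            (listSize C (fineAcc Δ τ') α R σ : ℝ) ^ 2) ∧
          n ≤ singleSamples C Δ α R σ δ τ') ∧
        ∀ (D : MeasureTheory.Measure (Vec d)) (ν : MeasureTheory.Measure ℝ) (w : Vec d) (τ : ℝ),
          IsInstance α R D ν w → τ' ≤ τ → Identifiable D g Δ τ →
          streamLaw D ν g σ w {ω | ¬ ∃ (t n : ℕ) (v : Vec d),
            Returns p g [Δ, α, R, σ, δ, τ'] ω t n [v] ∧
            excessLoss D g v w ≤ 4 * Δ} ≤ ENNReal.ofReal δ) := by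
  refine ⟨⟨candidatesP, 10 ^ 10, by norm_num, ?_⟩, ⟨singleP, 10 ^ 10, by norm_num, ?_⟩⟩
  · intro d Δ α R σ δ g hd hΔ hα hα1 hR hσ hδ hδ1 hg hmono
    exact ⟨fun ω => candidatesP_resources hd hΔ hα hα1 hR hσ hδ hδ1 ω, fun D ν w hI =>
      candidatesP_guarantee hd hΔ hα hα1 hR hσ hδ hδ1 hg hmono hI⟩
  · intro d Δ α R σ δ τ' g hd hΔ hα hα1 hR hσ hδ hδ1 hτ' hg hmono
    exact ⟨fun ω => singleP_resources hd hΔ hα hα1 hR hσ hδ hδ1 hτ' ω, fun D ν w τ hI hτ hid =>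
      singleP_guarantee hd hΔ hα hα1 hR hσ hδ hδ1 hτ' hg hmono hI hτ hid⟩
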